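/- **Target calculus.** Polyadic buffered $\pi$-processes are $P ::= \sum_{i\in I}\pi_i.P_i \mid P|Q \mid (\nu c{:}n)P \mid (\nu c)P \mid {!P}$ with $I$ finite, $n\ge 1$ and prefixes $\pi ::= c(\tilde x)\mid \bar c\langle\tilde d\rangle\mid\tau$; $\mathbf 0$ is the empty sum. A buffer store $B$ is a partial map from names to pairs $(n,l)$, $n\ge1$ a capacity and $l$ a list of entries $d$ or $\nu d$ ($\nu d$: a name sent while local); $gn(B)$ and $ln(B)$ are the names with an entry $d$, respectively $\nu d$, and $B\{c/\nu c\}$, $B\{\nu c/c\}$ replace all entries $\nu c$ by $c$, respectively $c$ by $\nu c$. $\equiv_B$ is the least congruence with renaming of input-bound names and of local names not occurring in $B$; the commutative monoid laws of $(|,\mathbf 0)$; $!P\equiv P|{!P}$; $(\nu c)(\nu d)P\equiv(\nu d)(\nu c)P$; and, for $c\notin ln(B)$, $(\nu c)\mathbf 0\equiv\mathbf 0$ and $(\nu c)(P|Q)\equiv(\nu c)P|Q$ if $c$ is not free in $Q$. Transitions $P,B\xrightarrow{\alpha}P',B'$, $\alpha\in\{\tau,\ c(\tilde d),\ \bar c\langle\tilde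 o\rangle\}$ with each $o_i$ of the form $d$ or $\nu d$, are given by: $\tau.P,B\xrightarrow{\tau}P,B$; for $c\notin\mathrm{dom}\,B$, $c(\tilde x).P,B\xrightarrow{c(\tilde d)}P\{\tilde d/\tilde x\},B$ and $\bar c\langle\tilde d\rangle.P,B\xrightarrow{\bar c\langle\tilde d\rangle}P,B$; if $B(b)=(n,d{::}l)$, $b(x).P,B\xrightarrow{\tau}P\{d/x\},B[b\mapsto(n,l)]$; if $B(b)=(n,l)$ and $|l|<n$, $\bar b\langle d\rangle.P,B\xrightarrow{\tau}P,B[b\mapsto(n,l{::}d)]$; if moreover $b$ is not local in $P$, $P,B\xrightarrow{b(d)}P,B[b\mapsto(n,l{::}d)]$ and, when $B(b)=(n,d{::}l)$, $P,B\xrightarrow{\bar b\langle d\rangle}P,B[b\mapsto(n,l)]$; a sum acts as any of its summands; $P|Q,B\xrightarrow{\tau}P'|Q',B$ if $P,B\xrightarrow{c(\tilde d)}P',B$, $Q,B\xrightarrow{\bar c\langle\tilde d\rangle}Q',B$ and $c\notin\mathrm{dom}\,B$; $P|Q,B\xrightarrow{\alpha}P'|Q,B'$ if $P,B\xrightarrow{\alpha}P',B'$,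 every $(\nu c)$ in $P|Q$ lies below a prefix or below some $(\nu b{:}n)$, and no name in $\mathrm{dom}\,B'\setminus\mathrm{dom}\,B$ is free in $Q$; $(\nu c)P,B\xrightarrow{\alpha}(\nu c)P',B'\{\nu c/c\}$ if $P,B\{c/\nu c\}\xrightarrow{\alpha}P',B'$, $c\notin gn(B)$, $c\notin ln(B')$ and $c$ is not in $\alpha$; $(\nu c)P,B\xrightarrow{\bar d\langle\nu c\rangle}P',B'$ if $P,B\{c/\nu c\}\xrightarrow{\bar d\langle c\rangle}P',B'$, $d\ne c$ and $c\notin gn(B)$ (for a polyadic output $\bar d\langle\tilde o\rangle$ containing the object $c$ and not $\nu c$, every $c$ in $\tilde o$ becomes $\nu c$); $(\nu b{:}n)P,B\xrightarrow{\tau}(\nu b)P,B[b\mapsto(n,[\,])]$ if $b\notin\mathrm{dom}\,B$; and closure under $\equiv_B$ before and $\equiv_{B'}$ after a transition. $\Rightarrow$ is the reflexive transitive closure of $\xrightarrow{\tau}$. **Core Go.** Values $v$ are integers and channels $ch$. Expressions are $e::=x\mid v\mid\mathtt{make}(\mathtt{chan}\ t,n)\mid{\leftarrow}e$ ($n\ge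 0$, types $t::=\mathtt{int}\mid\mathtt{chan}\ t$), and statements are $s::=\mathtt{nil}\mid x=e\mid e_1{\leftarrow}e_2\mid s_1;s_2\mid\mathtt{go}\ f(\tilde e)\mid\mathtt{select}\{c_1\dots c_n\}$ with clauses $c ::= \mathtt{case}\ x={\leftarrow}e:s\mid\mathtt{case}\ e_1{\leftarrow}e_2:s$. A function environment $\delta_f$ is a finite map $f\mapsto\mathtt{func}\ f(\tilde x)\{s\}$. A configuration $\Lambda=\langle\Gamma,\delta\rangle$ is a finite multiset $\Gamma$ of Go-routines $(s,\sigma)$ ($\sigma$ a finite map from variables to values) with a channel store $\delta$, a finite map $ch\mapsto(n,l,g)$ (capacity, buffer, $g=1$ global or $g=0$ local). Expression steps (a label $\tau$ is omitted): $x$ evaluates to $\sigma(x)$; $\mathtt{make}(\mathtt{chan}\ t,n)$ evaluates to some $ch\notin\mathrm{dom}\,\delta$, with $\delta[ch\mapsto(n,[\,],0)]$; if $\delta(ch)=(0,[\,],g)$, ${\leftarrow}ch\xrightarrow{r(ch,v)}v$ for any $v$; if $\delta(ch)=(n,v{::}l,g)$, $n>0$, ${\leftarrow}ch$ evaluates to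 $v$, with $\delta[ch\mapsto(n,l,g)]$. Evaluation is strict and from left to right in all constructs, with the labels of expression steps. Local steps: $x=v$ becomes $\mathtt{nil}$ with $\sigma[x\mapsto v]$; $ch{\leftarrow}v$ becomes $\mathtt{nil}$, with label $s(ch,v)$ if $\delta(ch)=(0,[\,],g)$, and silently with $\delta[ch\mapsto(n,l{::}v,g)]$ if $\delta(ch)=(n,l,g)$ and $|l|<n$; $\mathtt{go}\ f(\tilde v)\xrightarrow{g(f,\tilde v)}\mathtt{nil}$; once all its communication operands are evaluated, a select performs one of its communications, with the label and effect of that communication, and becomes $x=v;s$ (clause $x={\leftarrow}ch$, value $v$ received) or $s$ (send clause); $s_1;s_2$ steps as $s_1$, and $\mathtt{nil};s_2$ steps as $s_2$ to $s_2'$. Global steps $\Lambda\xrightarrow{\alpha}_g\Lambda'$, $\alpha\in\{\tau,r(ch,v),s(ch,v),s(ch,\nu ch')\}$: a silent local step; a synchronization of $r(ch,v)$ and $s(ch,v)$ of two routines ($\alpha=\tau$); a step $g(f,\tilde v)$ with $\delta_f(f)=\mathtt{func}\ f(\tilde x)\{s_f\}$, $|\tilde x|=|\tilde v|$, which adds the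 routine $(s_f,[\tilde x\mapsto\tilde v])$ ($\alpha=\tau$); for a global unbuffered $ch$, $\delta(ch)=(0,[\,],1)$, a local step $r(ch,v)$ or $s(ch,v)$ made visible; for a global buffered $ch$, $r(ch,v)$ appends $v$ to its buffer if it is not full and $s(ch,v)$ removes its oldest value $v$. In the sending cases, if $v=ch'\in\mathrm{dom}\,\delta$ then $ch'$ becomes global, and the label is $s(ch,\nu ch')$ if $ch'$ was local. **Encoding.** Integers, channels, variables and functions are distinct names; all other names below are fresh; a trailing $\mathbf 0$ and empty object lists are omitted. - $Var(x,v)=(\nu t)(\bar t\langle v\rangle\mid{!t(z)}.x(g,p).(p(y).\bar t\langle y\rangle\mid\bar g\langle z\rangle.\bar t\langle z\rangle))$. - $LR(v_1\dots v_n,r)=\bar r\langle v_1\dots v_n\rangle$; if $e^1,\dots,e^m$ ($m\ge1$) are the non-values in a list, $LR(\dots,r)=(\nu r_1t_2r_2\dots t_mr_m)([\![e^1]\!](r_1)\mid t_2.[\![e^2]\!](r_2)\mid\dots\mid t_m.[\![e^m]\!](r_m)\mid r_1(v^1).\bar t_2.r_2(v^2)\dots\bar t_m.r_m(v^m).\bar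 r\langle v_1\dots v_n\rangle)$, where $v^i$ stands in the place of $e^i$. - $[\![v]\!](r)=\bar r\langle v\rangle$; $[\![x]\!](r)=(\nu g p)\bar x\langle g,p\rangle.g(z).\bar r\langle z\rangle$; $[\![{\leftarrow}e]\!](r)=(\nu r')([\![e]\!](r')\mid r'(y).y(z).\bar r\langle z\rangle)$; $[\![\mathtt{make}(\mathtt{chan}\ t,0)]\!](r)=\tau.(\nu a)\bar r\langle a\rangle$; $[\![\mathtt{make}(\mathtt{chan}\ t,n)]\!](r)=(\nu b{:}n)\bar r\langle b\rangle$ for $n>0$. - $[\![\mathtt{nil}]\!](r)=\bar r$; $[\![x=e]\!](r)=(\nu r')([\![e]\!](r')\mid r'(z).(\nu gp)\bar x\langle g,p\rangle.\bar p\langle z\rangle.\bar r)$; $[\![e_1{\leftarrow}e_2]\!](r)=(\nu r')(LR(e_1,e_2,r')\mid r'(y,z).\bar y\langle z\rangle.\bar r)$; $[\![s_1;s_2]\!](r)=(\nu r')([\![s_1]\!](r')\mid r'.[\![s_2]\!](r))$; $[\![\mathtt{go}\ f(\tilde e)]\!](r)=(\nu r')(LR(\tilde e,r')\mid r'(\tilde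 y).\bar f\langle\tilde y\rangle.\bar r)$; $[\![\mathtt{select}\{c_1\dots c_n\}]\!](r)=(\nu r')(LR(e_1\dots e_k,r')\mid r'(y_1\dots y_k).\sum_i SC_{c_i})$, where $e_1\dots e_k$ are the communication operands of $c_1\dots c_n$ in order, $SC_c=y_i(v).[\![x=v;s]\!](r)$ for $c=\mathtt{case}\ x={\leftarrow}e_i:s$ and $SC_c=\bar y_i\langle y_j\rangle.[\![s]\!](r)$ for $c=\mathtt{case}\ e_i{\leftarrow}e_j:s$. - $[\![\mathtt{func}\ f(x_1\dots x_n)\{s\}]\!]={!f(z_1\dots z_n)}.(\nu x_1\dots x_n)(\prod_iVar(x_i,z_i)\mid(\nu r')[\![s]\!](r'))$; $R_{s,\sigma}=(\nu\tilde x)((\nu r)[\![s]\!](r)\mid\prod_{x\in\mathrm{dom}\,\sigma}Var(x,\sigma(x)))$ with $\tilde x=\mathrm{dom}\,\sigma$. - $[\![\Lambda]\!]_g=\big((\nu\tilde{ch})(\nu\tilde f)(\prod_{(s,\sigma)\in\Gamma}R_{s,\sigma}\mid\prod_{f\in\mathrm{dom}\,\delta_f}[\![\delta_f(f)]\!]),\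 \dot\delta\big)$, where $\tilde{ch}$ are the local channels, $\tilde f=\mathrm{dom}\,\delta_f$, and the buffer store $\dot\delta$ contains the channels of positive capacity with their buffers, local channels in buffers being marked with $\nu$. - $\tau'=\tau$, $r(ch,v)'=ch(v)$, $s(ch,v)'=\overline{ch}\langle v\rangle$, $s(ch,\nu ch')'=\overline{ch}\langle\nu ch'\rangle$. **Lemma (operational completeness).** Let the parameters of each function of $\delta_f$ be distinct, and let every variable occurring in a Go-routine $(s,\sigma)$ of $\Lambda$ belong to $\mathrm{dom}\,\sigma$. Let $\Lambda\xrightarrow{\alpha}_g\Lambda'$ be a transition that respects the name convention: a channel created by it occurs nowhere in $\Lambda$ or $\delta_f$, and if $\alpha=r(ch,v)$ then $v$ is not a local channel of $\Lambda$. Then there is $C$ with $$[\![\Lambda]\!]_g\Rightarrow\xrightarrow{\alpha'}\Rightarrow C,$$ where $C=[\![\Lambda']\!]_g$, except that, if the transition is a silent step of one Go-routine that reads or writes a variable, $C$ may instead be $[\![\Lambda']\!]_g$ up to structural congruence and one dead parallel component $(\nu p)p(y).\bar t\langle y\rangle$ or $(\nu g)\bar g\langle z\rangle.\bar t\langle z\rangle$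 (with $p$, $g$ unbuffered), the unused branch of a variable cell. -/

import Mathlib

/-! ## The buffered π-calculus -/

namespace PiB

variable {N : Type}

/-- An object stored in a buffer or carried by an output label: a plain name `d`,
or a name `νd` that was sent while it was local. -/
inductive Obj (N : Type) : Type
  | free (d : N)
  | priv (d : N)

/-- The underlying name of an object. -/
def Obj.name : Obj N → N
  | .free d => d
  | .priv d => d

/-- `νc` becomes `c`. -/
def Obj.expose [DecidableEq N] (c : N) : Obj N → Obj N
  | .free d => .free d
  | .priv d => if d = c then .free d else .priv d

/-- `c` becomes `νc`. -/
def Obj.hide [DecidableEq N] (c : N) : Obj N → Obj N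
  | .free d => if d = c then .priv d else .free d
  | .priv d => .priv d

/-- Prefixes `c(x₁…xₙ)`, `c̄⟨d₁…dₙ⟩` and `τ`. -/
inductive Pre (N : Type) : Type
  | inp (c : N) (xs : List N)
  | out (c : N) (ds : List N)
  | tau

/-- Processes: finite guarded choice, composition, `(νc:n)P`, `(νc)P` and replication. -/
inductive Proc (N : Type) : Type
  | sum (n : ℕ) (π : Fin n → Pre N) (P : Fin n → Proc N)
  | par (P Q : Proc N)
  | nuB (c : N) (n : ℕ+) (P : Proc N)
  | nu (c : N) (P : Proc N)
  | repl (P : Proc N)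

namespace Proc

/-- The empty choice. -/
def zero : Proc N := sum 0 (fun i => i.elim0) (fun i => i.elim0)

/-- A single prefixed process `π.P`. -/
def pre (π : Pre N) (P : Proc N) : Proc N := sum 1 (fun _ => π) (fun _ => P)

/-- `(νc₁)…(νcₙ)P`. -/
def nus (cs : List N) (P : Proc N) : Proc N := cs.foldr nu P

/-- `P₁ | … | Pₙ`. -/
def prod (Ps : List (Proc N)) : Proc N := Ps.foldr par zero

end Proc

/-- The names bound by a prefix. -/
def Pre.bound : Pre N → List N
  | .inp _ xs => xs
  | .out _ _ => []
  | .tau => []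

/-- The names that occur in a prefix outside binding position. -/
def Pre.used : Pre N → Set N
  | .inp c _ => {c}
  | .out c ds => {a | a = c ∨ a ∈ ds}
  | .tau => ∅

namespace Proc

/-- All names occurring in a process. -/
def names : Proc N → Set N
  | sum _ π P => ⋃ i, ((π i).used ∪ {a | a ∈ (π i).bound} ∪ (P i).names)
  | par P Q => P.names ∪ Q.names
  | nuB c _ P => {c} ∪ P.names
  | nu c P => {c} ∪ P.names
  | repl P => P.names

/-- Names occurring outside the scope of every binder for them. -/
def freeNames : Proc N → Set N
  | sum _ π P => ⋃ i, ((π i).used ∪ ((P i).freeNames \ {a | a ∈ (π i).bound}))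
  | par P Q => P.freeNames ∪ Q.freeNames
  | nuB c _ P => P.freeNames \ {c}
  | nu c P => P.freeNames \ {c}
  | repl P => P.freeNames

/-- Local names: those introduced by a new operator somewhere in the process. -/
def localNames : Proc N → Set N
  | sum _ _ P => ⋃ i, (P i).localNames
  | par P Q => P.localNames ∪ Q.localNames
  | nuB c _ P => {c} ∪ P.localNames
  | nu c P => {c} ∪ P.localNames
  | repl P => P.localNames

/-- Names introduced by some binder, a new operator or an input. -/
def boundNames : Proc N → Set N
  | sum _ π P => ⋃ i, ({a | a ∈ (π i).bound} ∪ (P i).boundNames)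
  | par P Q => P.boundNames ∪ Q.boundNames
  | nuB c _ P => {c} ∪ P.boundNames
  | nu c P => {c} ∪ P.boundNames
  | repl P => P.boundNames

/-- No new operator `(νc)` is active: each one lies below a prefix or below an extended new
operator `(νb:n)`, which has to fire (like a `τ` prefix) before its body can act. -/
def NewGuarded : Proc N → Prop
  | sum _ _ _ => True
  | par P Q => P.NewGuarded ∧ Q.NewGuarded
  | nuB _ _ _ => True
  | nu _ _ => False
  | repl P => P.NewGuarded

end Proc

section
variable [DecidableEq N]

/-- The substitution `{ds/xs}` on names. -/
def ren (xs ds : List N) (a : N) : N := ((xs.zip ds).lookup a).getD a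

/-- `σ`, made the identity on `xs`. -/
def fixOn (σ : N → N) (xs : List N) (a : N) : N := if a ∈ xs then a else σ a

/-- Substitution in a prefix; binding occurrences are untouched. -/
def Pre.subst (σ : N → N) : Pre N → Pre N
  | .inp c xs => .inp (σ c) xs
  | .out c ds => .out (σ c) (ds.map σ)
  | .tau => .tau

/-- Replacement of free names. It does not rename binders, so it is only used where the
substituted names are not bound in the process; `≡` provides the renaming of binders. -/
def Proc.subst (σ : N → N) : Proc N → Proc N
  | .sum n π P => .sum n (fun i => (π i).subst σ) (fun i => (P i).subst (fixOn σ (π i).bound))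
  | .par P Q => .par (P.subst σ) (Q.subst σ)
  | .nuB c n P => .nuB c n (P.subst (fixOn σ [c]))
  | .nu c P => .nu c (P.subst (fixOn σ [c]))
  | .repl P => .repl (P.subst σ)

end

/-- Buffer stores: partial functions from names to a capacity and a list of objects
(oldest first). -/
abbrev BufStore (N : Type) : Type := N → Option (ℕ+ × List (Obj N))

namespace BufStore

def dom (B : BufStore N) : Set N := {b | B b ≠ none}

/-- Global names in the buffers. -/
def gn (B : BufStore N) : Set N := {d | ∃ b n l, B b = some (n, l) ∧ Obj.free d ∈ l}

/-- Local names in the buffers. -/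
def ln (B : BufStore N) : Set N := {d | ∃ b n l, B b = some (n, l) ∧ Obj.priv d ∈ l}

/-- All names occurring in the buffer store. -/
def names (B : BufStore N) : Set N := B.dom ∪ B.gn ∪ B.ln

variable [DecidableEq N]

/-- `B{c/νc}`. -/
def expose (c : N) (B : BufStore N) : BufStore N :=
  fun b => (B b).map fun p => (p.1, p.2.map (Obj.expose c))

/-- `B{νc/c}`. -/
def hide (c : N) (B : BufStore N) : BufStore N :=
  fun b => (B b).map fun p => (p.1, p.2.map (Obj.hide c))

/-- `B[b ↦ (n, l)]`. -/
def set (B : BufStore N) (b : N) (n : ℕ+) (l : List (Obj N)) : BufStore N :=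
  Function.update B b (some (n, l))

end BufStore

/-- Structural congruence with respect to a buffer store. -/
inductive SC [DecidableEq N] (B : BufStore N) : Proc N → Proc N → Prop
  | refl (P) : SC B P P
  | symm {P Q} : SC B P Q → SC B Q P
  | trans {P Q R} : SC B P Q → SC B Q R → SC B P R
  -- congruence
  | sum {n π} {P Q : Fin n → Proc N} : (∀ i, SC B (P i) (Q i)) → SC B (.sum n π P) (.sum n π Q)
  | par {P P' Q Q'} : SC B P P' → SC B Q Q' → SC B (.par P Q) (.par P' Q')
  | nuB {c n P Q} : SC B P Q → SC B (.nuB c n P) (.nuB c n Q)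
  | nu {c P Q} : SC B P Q → SC B (.nu c P) (.nu c Q)
  | repl {P Q} : SC B P Q → SC B (.repl P) (.repl Q)
  -- renaming of bound names, and of local names not occurring in `B`
  | alpha_inp {n} {π : Fin n → Pre N} {P : Fin n → Proc N} (i : Fin n) {c xs ys} :
      π i = .inp c xs → ys.length = xs.length → xs.Nodup → ys.Nodup →
      (∀ y ∈ ys, y ∉ (P i).names) →
      SC B (.sum n π P) (.sum n (Function.update π i (.inp c ys))
        (Function.update P i ((P i).subst (ren xs ys))))
  | alpha_nu {c d P} : c ∉ B.names → d ∉ B.names → d ∉ P.names →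
      SC B (.nu c P) (.nu d (P.subst (ren [c] [d])))
  | alpha_nuB {c d n P} : c ∉ B.names → d ∉ B.names → d ∉ P.names →
      SC B (.nuB c n P) (.nuB d n (P.subst (ren [c] [d])))
  -- laws
  | par_comm (P Q) : SC B (.par P Q) (.par Q P)
  | par_assoc (P Q R) : SC B (.par P (.par Q R)) (.par (.par P Q) R)
  | par_zero (P) : SC B (.par P .zero) P
  | repl_unfold (P) : SC B (.repl P) (.par P (.repl P))
  | nu_comm (c d P) : SC B (.nu c (.nu d P)) (.nu d (.nu c P))
  | nu_zero {c} : c ∉ B.ln → SC B (.nu c .zero) .zero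
  | nu_par {c P Q} : c ∉ B.ln → c ∉ Q.freeNames →
      SC B (.nu c (.par P Q)) (.par (.nu c P) Q)

/-- Actions: `τ`, free input `c(d̃)`, and output `c̄⟨õ⟩`, whose objects may be `d` or `νd`. -/
inductive Act (N : Type) : Type
  | tau
  | inp (c : N) (ds : List N)
  | out (c : N) (os : List (Obj N))

def Act.names : Act N → Set N
  | .tau => ∅
  | .inp c ds => {a | a = c ∨ a ∈ ds}
  | .out c os => {a | a = c ∨ ∃ o ∈ os, o.name = a}

/-- The transition relation `P, B —α→ P', B'` (early semantics, without assuming the name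
convention). Buffers hold single names, so buffered communication is monadic. -/
inductive Step [DecidableEq N] :
    Proc N → BufStore N → Act N → Proc N → BufStore N → Prop
  | tau {P B} : Step (.pre .tau P) B .tau P B
  | iu {c xs ds P B} : c ∉ B.dom → ds.length = xs.length → (∀ d ∈ ds, d ∉ P.boundNames) →
      Step (.pre (.inp c xs) P) B (.inp c ds) (P.subst (ren xs ds)) B
  | ou {c ds P B} : c ∉ B.dom →
      Step (.pre (.out c ds) P) B (.out c (ds.map Obj.free)) P B
  | ib {b x d n l P B} : B b = some (n, Obj.free d :: l) → d ∉ P.boundNames →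
      Step (.pre (.inp b [x]) P) B .tau (P.subst (ren [x] [d])) (B.set b n l)
  | ob {b d} {n : ℕ+} {l P B} : B b = some (n, l) → l.length < (n : ℕ) →
      Step (.pre (.out b [d]) P) B .tau P (B.set b n (l ++ [Obj.free d]))
  | ibg {b d} {n : ℕ+} {l P B} : B b = some (n, l) → l.length < (n : ℕ) → b ∉ P.localNames →
      Step P B (.inp b [d]) P (B.set b n (l ++ [Obj.free d]))
  | obg {b d n l P B} : B b = some (n, Obj.free d :: l) → b ∉ P.localNames →
      Step P B (.out b [Obj.free d]) P (B.set b n l)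
  | sum {n} {π : Fin n → Pre N} {P : Fin n → Proc N} (j : Fin n) {B α P' B'} :
      Step (.pre (π j) (P j)) B α P' B' → Step (.sum n π P) B α P' B'
  | com {P Q P' Q' B c ds} : Step P B (.inp c ds) P' B →
      Step Q B (.out c (ds.map Obj.free)) Q' B → c ∉ B.dom →
      Step (.par P Q) B .tau (.par P' Q') B
  -- the last condition says that a buffer created by `P` gets a name that is not used by `Q`
  | par {P Q P' B B' α} : Step P B α P' B' → (Proc.par P Q).NewGuarded →
      (∀ b ∈ B'.dom, b ∉ B.dom → b ∉ Q.freeNames) →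
      Step (.par P Q) B α (.par P' Q) B'
  | new {c P P' B B' α} : Step P (B.expose c) α P' B' → c ∉ α.names → c ∉ B.gn → c ∉ B'.ln →
      Step (.nu c P) B α (.nu c P') (B'.hide c)
  | opn {c d os P P' B B'} : Step P (B.expose c) (.out d os) P' B' → d ≠ c →
      Obj.free c ∈ os → Obj.priv c ∉ os → c ∉ B.gn →
      Step (.nu c P) B (.out d (os.map (Obj.hide c))) P' B'
  | newB {b n P B} : b ∉ B.dom → Step (.nuB b n P) B .tau (.nu b P) (B.set b n [])
  | stru {P P' Q Q' B B' α} : SC B P P' → Step P' B α Q' B' → SC B' Q' Q → Step P B α Q B'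

/-- A process together with a buffer store. -/
abbrev Conf (N : Type) : Type := Proc N × BufStore N

/-- `⇒`, the reflexive and transitive closure of `—τ→`. -/
def TauStar [DecidableEq N] : Conf N → Conf N → Prop :=
  Relation.ReflTransGen fun C D => Step C.1 C.2 .tau D.1 D.2

/-- `⇒ —α→ ⇒`; exactly one transition labelled `α` is required, also for `α = τ`. -/
def WeakStep [DecidableEq N] (C : Conf N) (α : Act N) (D : Conf N) : Prop :=
  ∃ C₁ D₁ : Conf N, TauStar C C₁ ∧ Step C₁.1 C₁.2 α D₁.1 D₁.2 ∧ TauStar D₁ D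

end PiB

/-! ## Core Go -/

namespace Go

inductive Ty : Type
  | int
  | chan (t : Ty)

/-- Values: integers and channels. -/
inductive Val : Type
  | int (n : ℤ)
  | chan (ch : ℕ)

inductive Exp : Type
  | var (x : ℕ)
  | val (v : Val)
  | make (t : Ty) (n : ℕ)
  | recv (e : Exp)

/-- Communication operations of select clauses: `x = <-e` and `e₁ <- e₂`. -/
inductive Comm : Type
  | recv (x : ℕ) (e : Exp)
  | send (e₁ e₂ : Exp)

/-- Statements; `nil` is the terminated statement. The clauses of `select n c s` are
`case c i : s i`. -/
inductive Stm : Type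
  | nil
  | assign (x : ℕ) (e : Exp)
  | send (e₁ e₂ : Exp)
  | seq (s₁ s₂ : Stm)
  | go (f : ℕ) (es : List Exp)
  | select (n : ℕ) (c : Fin n → Comm) (s : Fin n → Stm)

/-- `func f(x₁…xₙ) {s}`. -/
structure FuncDef : Type where
  params : List ℕ
  body : Stm

/-- Local stores `σ`. -/
abbrev Store : Type := Finmap fun _ : ℕ => Val

/-- Channel stores `δ_c`: capacity, buffer (oldest value first), and whether the channel is
global (`true`) or local (`false`). -/
abbrev ChanStore : Type := Finmap fun _ : ℕ => ℕ × List Val × Bool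

/-- Function environments `δ_f`. -/
abbrev FunEnv : Type := Finmap fun _ : ℕ => FuncDef

/-- Actions of expressions and of single Go-routines. -/
inductive LAct : Type
  | tau
  | r (ch : ℕ) (v : Val)
  | s (ch : ℕ) (v : Val)
  | g (f : ℕ) (vs : List Val)

/-- Evaluation of expressions; the local store never changes. -/
inductive EStep (σ : Store) : Exp → ChanStore → LAct → Exp → ChanStore → Prop
  | var {x v δ} : σ.lookup x = some v → EStep σ (.var x) δ .tau (.val v) δ
  | mak {t n ch δ} : ch ∉ δ →
      EStep σ (.make t n) δ .tau (.val (.chan ch)) (δ.insert ch (n, [], false))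
  | rvE {e e' δ δ' α} : EStep σ e δ α e' δ' → EStep σ (.recv e) δ α (.recv e') δ'
  | rvU {ch v g δ} : δ.lookup ch = some (0, [], g) →
      EStep σ (.recv (.val (.chan ch))) δ (.r ch v) (.val v) δ
  | rvB {ch n v l g δ} : δ.lookup ch = some (n, v :: l, g) → 0 < n →
      EStep σ (.recv (.val (.chan ch))) δ .tau (.val v) (δ.insert ch (n, l, g))

/-- The subexpressions of a communication operation, from left to right. -/
def Comm.operands : Comm → List Exp
  | .recv _ e => [e]
  | .send e₁ e₂ => [e₁, e₂]

/-- All subexpressions are fully evaluated. -/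
def Comm.Evaluated (c : Comm) : Prop := ∀ e ∈ c.operands, ∃ v, e = .val v

/-- Evaluation of the first non-fully evaluated subexpression of a communication operation. -/
inductive CStep (σ : Store) : Comm → ChanStore → LAct → Comm → ChanStore → Prop
  | recv {x e e' δ δ' α} : EStep σ e δ α e' δ' → CStep σ (.recv x e) δ α (.recv x e') δ'
  | send1 {e₁ e₁' e₂ δ δ' α} : EStep σ e₁ δ α e₁' δ' →
      CStep σ (.send e₁ e₂) δ α (.send e₁' e₂) δ'
  | send2 {v e₂ e₂' δ δ' α} : EStep σ e₂ δ α e₂' δ' →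
      CStep σ (.send (.val v) e₂) δ α (.send (.val v) e₂') δ'

/-- The local transition relation `⟨s, σ, δ⟩ ↪ ⟨s', σ', δ'⟩`. A clause of a select statement is
chosen only after all subexpressions of all its communication operations are evaluated. -/
inductive LStep : Stm → Store → ChanStore → LAct → Stm → Store → ChanStore → Prop
  | ass {x v σ δ} : LStep (.assign x (.val v)) σ δ .tau .nil (σ.insert x v) δ
  | asE {x e e' σ δ δ' α} : EStep σ e δ α e' δ' →
      LStep (.assign x e) σ δ α (.assign x e') σ δ'
  | sdU {ch v g σ δ} : δ.lookup ch = some (0, [], g) →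
      LStep (.send (.val (.chan ch)) (.val v)) σ δ (.s ch v) .nil σ δ
  | sdB {ch v n l g σ δ} : δ.lookup ch = some (n, l, g) → 0 < n → l.length < n →
      LStep (.send (.val (.chan ch)) (.val v)) σ δ .tau .nil σ (δ.insert ch (n, l ++ [v], g))
  | sdE1 {e₁ e₁' e₂ σ δ δ' α} : EStep σ e₁ δ α e₁' δ' →
      LStep (.send e₁ e₂) σ δ α (.send e₁' e₂) σ δ'
  | sdE2 {ch e₂ e₂' σ δ δ' α} : EStep σ e₂ δ α e₂' δ' →
      LStep (.send (.val (.chan ch)) e₂) σ δ α (.send (.val (.chan ch)) e₂') σ δ'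
  | go {f vs σ δ} : LStep (.go f (vs.map .val)) σ δ (.g f vs) .nil σ δ
  | goE {f} {vs : List Val} {e e' : Exp} {es σ δ δ' α} : EStep σ e δ α e' δ' →
      LStep (.go f (vs.map .val ++ e :: es)) σ δ α (.go f (vs.map .val ++ e' :: es)) σ δ'
  | slR {n} {c : Fin n → Comm} {s : Fin n → Stm} (i : Fin n) {x ch v σ δ δ' α} :
      (∀ j, (c j).Evaluated) → c i = .recv x (.val (.chan ch)) →
      EStep σ (.recv (.val (.chan ch))) δ α (.val v) δ' →
      LStep (.select n c s) σ δ α (.seq (.assign x (.val v)) (s i)) σ δ'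
  | slS {n} {c : Fin n → Comm} {s : Fin n → Stm} (i : Fin n) {ch v σ δ δ' α} :
      (∀ j, (c j).Evaluated) → c i = .send (.val (.chan ch)) (.val v) →
      LStep (.send (.val (.chan ch)) (.val v)) σ δ α .nil σ δ' →
      LStep (.select n c s) σ δ α (s i) σ δ'
  | slE {n} {c : Fin n → Comm} {s : Fin n → Stm} (i : Fin n) {c' σ δ δ' α} :
      (∀ j, j < i → (c j).Evaluated) → CStep σ (c i) δ α c' δ' →
      LStep (.select n c s) σ δ α (.select n (Function.update c i c') s) σ δ'
  | seq1 {s₁ s₁' s₂ σ σ' δ δ' α} : LStep s₁ σ δ α s₁' σ' δ' →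
      LStep (.seq s₁ s₂) σ δ α (.seq s₁' s₂) σ' δ'
  | seq2 {s₂ s₂' σ σ' δ δ' α} : LStep s₂ σ δ α s₂' σ' δ' →
      LStep (.seq .nil s₂) σ δ α s₂' σ' δ'

/-- Global configurations `Λ = ⟨Γ, δ_c⟩`. -/
structure Config : Type where
  routines : Multiset (Stm × Store)
  chans : ChanStore

/-- Global actions: `τ`, `r(ch, v)`, `s(ch, v)` and `s(ch, νch')`. -/
inductive GAct : Type
  | tau
  | r (ch : ℕ) (v : Val)
  | s (ch : ℕ) (v : Val)
  | sNew (ch ch' : ℕ)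

/-- The label for sending the channel `ch'` over `ch`: the `ν` is present exactly when `ch'` is
local. -/
def sendLabel (ch ch' : ℕ) (isGlobal : Bool) : GAct :=
  if isGlobal then .s ch (.chan ch') else .sNew ch ch'

/-- The value is a channel in the domain of the channel store. -/
def Val.InDom (δ : ChanStore) : Val → Prop
  | .int _ => False
  | .chan ch => ch ∈ δ

/-- The store `[x₁ ↦ v₁ … xₘ ↦ vₘ]`. -/
def argStore (xs : List ℕ) (vs : List Val) : Store :=
  ((xs.zip vs).map fun p => (⟨p.1, p.2⟩ : Sigma fun _ : ℕ => Val)).toFinmap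

/-- The global transition relation `δ_f ⊢ Λ —α→ Λ'`. -/
inductive GStep (δf : FunEnv) : Config → GAct → Config → Prop
  | loc {Γ s s' σ σ' δ δ'} : LStep s σ δ .tau s' σ' δ' →
      GStep δf ⟨(s, σ) ::ₘ Γ, δ⟩ .tau ⟨(s', σ') ::ₘ Γ, δ'⟩
  | com {Γ s₁ s₁' σ₁ s₂ s₂' σ₂ δ ch v} : LStep s₁ σ₁ δ (.r ch v) s₁' σ₁ δ →
      LStep s₂ σ₂ δ (.s ch v) s₂' σ₂ δ →
      GStep δf ⟨(s₁, σ₁) ::ₘ (s₂, σ₂) ::ₘ Γ, δ⟩ .tau ⟨(s₁', σ₁) ::ₘ (s₂', σ₂) ::ₘ Γ, δ⟩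
  | lgo {Γ s s' σ δ f vs} {d : FuncDef} : LStep s σ δ (.g f vs) s' σ δ →
      δf.lookup f = some d → d.params.length = vs.length →
      GStep δf ⟨(s, σ) ::ₘ Γ, δ⟩ .tau
        ⟨(s', σ) ::ₘ (d.body, argStore d.params vs) ::ₘ Γ, δ⟩
  | gru {Γ s s' σ δ ch v} : LStep s σ δ (.r ch v) s' σ δ → δ.lookup ch = some (0, [], true) →
      GStep δf ⟨(s, σ) ::ₘ Γ, δ⟩ (.r ch v) ⟨(s', σ) ::ₘ Γ, δ⟩
  | grb {Γ δ ch n l v} : δ.lookup ch = some (n, l, true) → 0 < n → l.length < n →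
      GStep δf ⟨Γ, δ⟩ (.r ch v) ⟨Γ, δ.insert ch (n, l ++ [v], true)⟩
  | gsu1 {Γ s s' σ δ ch v} : LStep s σ δ (.s ch v) s' σ δ → δ.lookup ch = some (0, [], true) →
      ¬ v.InDom δ →
      GStep δf ⟨(s, σ) ::ₘ Γ, δ⟩ (.s ch v) ⟨(s', σ) ::ₘ Γ, δ⟩
  | gsu2 {Γ s s' σ δ ch ch' n' l' g'} : LStep s σ δ (.s ch (.chan ch')) s' σ δ →
      δ.lookup ch = some (0, [], true) → δ.lookup ch' = some (n', l', g') →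
      GStep δf ⟨(s, σ) ::ₘ Γ, δ⟩ (sendLabel ch ch' g')
        ⟨(s', σ) ::ₘ Γ, δ.insert ch' (n', l', true)⟩
  | gsb1 {Γ δ ch n v l} : δ.lookup ch = some (n, v :: l, true) → 0 < n → ¬ v.InDom δ →
      GStep δf ⟨Γ, δ⟩ (.s ch v) ⟨Γ, δ.insert ch (n, l, true)⟩
  | gsb2 {Γ δ ch n ch' l n' l' g'} : δ.lookup ch = some (n, .chan ch' :: l, true) → 0 < n →
      δ.lookup ch' = some (n', l', g') →
      GStep δf ⟨Γ, δ⟩ (sendLabel ch ch' g')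
        ⟨Γ, (δ.insert ch' (n', l', true)).insert ch (n, l, true)⟩

/-! ### Variables and channels occurring in programs -/

def Val.chans : Val → Set ℕ
  | .int _ => ∅
  | .chan ch => {ch}

def Exp.vars : Exp → Set ℕ
  | .var x => {x}
  | .val _ => ∅
  | .make _ _ => ∅
  | .recv e => e.vars

def Exp.chans : Exp → Set ℕ
  | .var _ => ∅
  | .val v => v.chans
  | .make _ _ => ∅
  | .recv e => e.chans

def Comm.vars : Comm → Set ℕ
  | .recv x e => {x} ∪ e.vars
  | .send e₁ e₂ => e₁.vars ∪ e₂.vars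

def Comm.chans : Comm → Set ℕ
  | .recv _ e => e.chans
  | .send e₁ e₂ => e₁.chans ∪ e₂.chans

def Stm.vars : Stm → Set ℕ
  | .nil => ∅
  | .assign x e => {x} ∪ e.vars
  | .send e₁ e₂ => e₁.vars ∪ e₂.vars
  | .seq s₁ s₂ => s₁.vars ∪ s₂.vars
  | .go _ es => {x | ∃ e ∈ es, x ∈ e.vars}
  | .select _ c s => ⋃ i, ((c i).vars ∪ (s i).vars)

def Stm.chans : Stm → Set ℕ
  | .nil => ∅
  | .assign _ e => e.chans
  | .send e₁ e₂ => e₁.chans ∪ e₂.chans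
  | .seq s₁ s₂ => s₁.chans ∪ s₂.chans
  | .go _ es => {ch | ∃ e ∈ es, ch ∈ e.chans}
  | .select _ c s => ⋃ i, ((c i).chans ∪ (s i).chans)

/-- The channel `ch` occurs in the configuration or in the function declarations. -/
def Occurs (δf : FunEnv) (Λ : Config) (ch : ℕ) : Prop :=
  (∃ p ∈ Λ.routines, ch ∈ p.1.chans ∨ ∃ x v, p.2.lookup x = some v ∧ ch ∈ v.chans) ∨
  ch ∈ Λ.chans ∨
  (∃ b n l g, Λ.chans.lookup b = some (n, l, g) ∧ ∃ v ∈ l, ch ∈ v.chans) ∨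
  (∃ f d, δf.lookup f = some d ∧ ch ∈ d.body.chans)

/-- `v` is a local channel. -/
def Val.IsLocal (δ : ChanStore) : Val → Prop
  | .int _ => False
  | .chan ch => ∃ n l, δ.lookup ch = some (n, l, false)

/-- Every variable of a Go-routine has a value in its local store. -/
def Config.VarsDeclared (Λ : Config) : Prop :=
  ∀ p ∈ Λ.routines, ∀ x ∈ p.1.vars, x ∈ p.2

/-- The name convention (local names differ from each other and from global names) for a
transition: a newly created channel occurs nowhere else, and the environment does not send the
name of a local channel. -/
def NameConvention (δf : FunEnv) (Λ : Config) (α : GAct) (Λ' : Config) : Prop :=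
  (∀ ch ∈ Λ'.chans, ch ∉ Λ.chans → ¬ Occurs δf Λ ch) ∧
  (∀ ch v, α = .r ch v → ¬ v.IsLocal Λ.chans)

/-! ### The encoding -/

open PiB

/-- The π-names: integers, channels, variables, functions, and infinitely many others. -/
inductive Name : Type
  | int (n : ℤ)
  | chan (ch : ℕ)
  | var (x : ℕ)
  | fn (f : ℕ)
  | aux (k : ℕ)
  deriving DecidableEq

def Val.name : Val → Name
  | .int n => .int n
  | .chan ch => .chan ch

/-- `c(xs).P` -/
abbrev inp (c : Name) (xs : List Name) (P : Proc Name) : Proc Name := .pre (.inp c xs) P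

/-- `c̄⟨ds⟩.P` -/
abbrev out (c : Name) (ds : List Name) (P : Proc Name) : Proc Name := .pre (.out c ds) P

/-! In the encoding functions the last argument `k` only serves to choose bound names: these are
`aux k`, `aux (k+1)`, …, so they differ from all names `aux j` with `j < k` that are in scope. -/

/-- `Var(x, v) = (νt)(t̄⟨v⟩ | !t(z).x(g,p).(p(y).t̄⟨y⟩ | ḡ⟨z⟩.t̄⟨z⟩))` -/
def encVar (x v : Name) (k : ℕ) : Proc Name :=
  let t := Name.aux k
  let z := Name.aux (k + 1)
  let g := Name.aux (k + 2)
  let p := Name.aux (k + 3)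
  let y := Name.aux (k + 4)
  .nu t (.par (out t [v] .zero)
    (.repl (inp t [z] (inp x [g, p]
      (.par (inp p [y] (out t [y] .zero)) (out g [z] (out t [z] .zero)))))))

/-- `⟦e⟧(r)` -/
def encExp : Exp → Name → ℕ → Proc Name
  | .val v, r, _ => out r [v.name] .zero
  | .var x, r, k =>
      let g := Name.aux k
      let p := Name.aux (k + 1)
      let z := Name.aux (k + 2)
      .nu g (.nu p (out (.var x) [g, p] (inp g [z] (out r [z] .zero))))
  | .recv e, r, k =>
      let r' := Name.aux k
      let y := Name.aux (k + 1)
      let z := Name.aux (k + 2)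
      .nu r' (.par (encExp e r' (k + 1)) (inp r' [y] (inp y [z] (out r [z] .zero))))
  | .make _ 0, r, k => .pre .tau (.nu (.aux k) (out r [.aux k] .zero))
  | .make _ (n + 1), r, k => .nuB (.aux k) n.succPNat (out r [.aux k] .zero)

/-- The non-fully evaluated expressions of a list, with their positions. -/
def pending (es : List Exp) : List (Exp × ℕ) :=
  es.zipIdx.filter fun p => match p.1 with
    | .val _ => false
    | _ => true

/-- `LR(e₁…eₙ, r)`: evaluates the non-fully evaluated expressions from left to right and returns
all values along `r`. The expression at position `i` (counted from 0) uses the names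
`rᵢ = aux (k+2i)`, `tᵢ = aux (k+2i+1)`, and its value is bound to `vᵢ = aux (k+2n+i)`. -/
def encLR (es : List Exp) (r : Name) (k : ℕ) : Proc Name :=
  let n := es.length
  let rr (i : ℕ) := Name.aux (k + 2 * i)
  let tt (i : ℕ) := Name.aux (k + 2 * i + 1)
  let vv (i : ℕ) := Name.aux (k + 2 * n + i)
  let result := out r (es.zipIdx.map fun p => match p.1 with
    | .val v => v.name
    | _ => vv p.2) .zero
  match pending es with
  | [] => result
  | (e, i) :: rest =>
      .nus (rr i :: rest.flatMap fun p => [tt p.2, rr p.2])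
        (.par (encExp e (rr i) (k + 3 * n))
          (.par
            (.prod (rest.map fun p => inp (tt p.2) [] (encExp p.1 (rr p.2) (k + 3 * n))))
            (inp (rr i) [vv i]
              (rest.foldr (fun p Q => out (tt p.2) [] (inp (rr p.2) [vv p.2] Q)) result))))

/-- `⟦x = e⟧(r)`, where `E` is the encoding of `e`. -/
def encAssign (x : ℕ) (E : Name → ℕ → Proc Name) (r : Name) (k : ℕ) : Proc Name :=
  let r' := Name.aux k
  let z := Name.aux (k + 1)
  let g := Name.aux (k + 2)
  let p := Name.aux (k + 3)
  .nu r' (.par (E r' (k + 1))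
    (inp r' [z] (.nu g (.nu p (out (.var x) [g, p] (out p [z] (out r [] .zero)))))))

/-- `⟦s₁; s₂⟧(r)`, where `S₁` and `S₂` are the encodings of `s₁` and `s₂`. -/
def encSeq (S₁ S₂ : Name → ℕ → Proc Name) (r : Name) (k : ℕ) : Proc Name :=
  let r' := Name.aux k
  .nu r' (.par (S₁ r' (k + 1)) (inp r' [] (S₂ r (k + 1))))

/-- All subexpressions of the communication operations of a select statement, in order. -/
def operandList {n : ℕ} (c : Fin n → Comm) : List Exp :=
  (List.ofFn c).flatMap Comm.operands

/-- The number of subexpressions that precede those of the `i`-th clause. -/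
def offset {n : ℕ} (c : Fin n → Comm) (i : Fin n) : ℕ :=
  (((List.ofFn c).take i).flatMap Comm.operands).length

/-- `⟦s⟧(r)` -/
def encStm : Stm → Name → ℕ → Proc Name
  | .nil, r, _ => out r [] .zero
  | .assign x e, r, k => encAssign x (encExp e) r k
  | .send e₁ e₂, r, k =>
      let r' := Name.aux k
      let y := Name.aux (k + 1)
      let z := Name.aux (k + 2)
      .nu r' (.par (encLR [e₁, e₂] r' (k + 1)) (inp r' [y, z] (out y [z] (out r [] .zero))))
  | .seq s₁ s₂, r, k => encSeq (encStm s₁) (encStm s₂) r k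
  | .go f es, r, k =>
      let r' := Name.aux k
      let ys := (List.range es.length).map fun j => Name.aux (k + 1 + j)
      .nu r' (.par (encLR es r' (k + 1)) (inp r' ys (out (.fn f) ys (out r [] .zero))))
  | .select n c s, r, k =>
      let es := operandList c
      let r' := Name.aux k
      let y (j : ℕ) := Name.aux (k + 1 + j)
      let v := Name.aux (k + 1 + es.length)
      let k' := k + 2 + es.length
      .nu r' (.par (encLR es r' (k + 1)) (inp r' ((List.range es.length).map y)
        (.sum n
          (fun i => match c i with
            | .recv _ _ => .inp (y (offset c i)) [v]
            | .send _ _ => .out (y (offset c i)) [y (offset c i + 1)])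
          (fun i => match c i with
            | .recv x _ => encSeq (encAssign x fun r _ => out r [v] .zero) (encStm (s i)) r k'
            | .send _ _ => encStm (s i) r k'))))

/-- `⟦func f(x₁…xₙ) {s}⟧` -/
def encFun (f : ℕ) (d : FuncDef) : Proc Name :=
  let n := d.params.length
  .repl (inp (.fn f) ((List.range n).map Name.aux)
    (.nus (d.params.map Name.var)
      (.par (.prod (d.params.zipIdx.map fun p => encVar (.var p.1) (.aux p.2) n))
        (.nu (.aux n) (encStm d.body (.aux n) (n + 1))))))

/-- `⟦σ⟧` -/
noncomputable def encStore (σ : Store) : Proc Name :=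
  .prod (σ.entries.toList.map fun p => encVar (.var p.1) p.2.name 0)

/-- `⟦δ_f⟧` -/
noncomputable def encFunEnv (δf : FunEnv) : Proc Name :=
  .prod (δf.entries.toList.map fun p => encFun p.1 p.2)

/-- The Go-routine `R_{s,σ} = (νx̃)((νr)⟦s⟧(r) | ⟦σ⟧)`. -/
noncomputable def encRoutine (p : Stm × Store) : Proc Name :=
  .nus (p.2.entries.toList.map fun q => Name.var q.1)
    (.par (.nu (.aux 0) (encStm p.1 (.aux 0) 1)) (encStore p.2))

/-- A value in a buffer: the names of local channels are marked with `ν`. -/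
def encEntry (δ : ChanStore) : Val → Obj Name
  | .int n => .free (.int n)
  | .chan ch => match δ.lookup ch with
    | some (_, _, false) => .priv (.chan ch)
    | _ => .free (.chan ch)

/-- The buffer store of a channel store: unbuffered channels are left out, and the names of local
channels in the buffers are marked. -/
def encChans (δ : ChanStore) : BufStore Name
  | .chan ch => match δ.lookup ch with
    | some (n + 1, l, _) => some (n.succPNat, l.map (encEntry δ))
    | _ => none
  | _ => none

/-- The names of the local channels. -/
noncomputable def localChans (δ : ChanStore) : List Name :=
  (δ.entries.toList.filter fun p => !p.2.2.2).map fun p => Name.chan p.1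

/-- `⟦Λ⟧ = (νc̃h)(νf̃)(R₁ | … | Rₙ | ⟦δ_f⟧), δ̇_c` -/
noncomputable def encConfig (δf : FunEnv) (Λ : Config) : Conf Name :=
  (.nus (localChans Λ.chans)
    (.nus (δf.entries.toList.map fun p => Name.fn p.1)
      (.par (.prod (Λ.routines.toList.map encRoutine)) (encFunEnv δf))),
   encChans Λ.chans)

/-- The `π`-action `α'` that corresponds to a global action `α`. -/
def GAct.enc : GAct → Act Name
  | .tau => .tau
  | .r ch v => .inp (.chan ch) [v.name]
  | .s ch v => .out (.chan ch) [.free v.name]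
  | .sNew ch ch' => .out (.chan ch) [.priv (.chan ch')]

/-- `P` becomes `Q` when one active component `(νp)p(y).t̄⟨y⟩` or `(νg)ḡ⟨z⟩.t̄⟨z⟩`, whose
unbuffered subject is private to it, is replaced by `0`. An access to a variable leaves such a
dead component behind: the branch of the cell `Var(x, v)` that was not used. -/
inductive DropsDead (B : BufStore Name) : Proc Name → Proc Name → Prop
  | put {p y t} : p ∉ B.dom → DropsDead B (.nu p (inp p [y] (out t [y] .zero))) .zero
  | get {g z t} : g ∉ B.dom → DropsDead B (.nu g (out g [z] (out t [z] .zero))) .zero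
  | nu {c P Q} : DropsDead B P Q → DropsDead B (.nu c P) (.nu c Q)
  | par {P Q R} : DropsDead B P Q → DropsDead B (.par P R) (.par Q R)

/-- The next step in the evaluation of the expression reads a variable. -/
def Exp.ReadsNext : Exp → Prop
  | .var _ => True
  | .recv e => e.ReadsNext
  | .val _ => False
  | .make _ _ => False

/-- The next step of a left-to-right evaluation of the list reads a variable. -/
def ReadsNext (es : List Exp) : Prop :=
  ∃ (vs : List Val) (e : Exp) (es' : List Exp), es = vs.map .val ++ e :: es' ∧ e.ReadsNext

/-- The next step in the execution of the statement reads or writes a variable. -/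
def Stm.AccessesNext : Stm → Prop
  | .nil => False
  | .assign _ e => (∃ v, e = .val v) ∨ e.ReadsNext
  | .send e₁ e₂ => Go.ReadsNext [e₁, e₂]
  | .seq s₁ s₂ => s₁.AccessesNext ∨ (s₁ = .nil ∧ s₂.AccessesNext)
  | .go _ es => Go.ReadsNext es
  | .select _ c _ => Go.ReadsNext (operandList c)

/-- The transition from `Λ` to `Λ'` is a silent step of one Go-routine that reads or writes one of
its variables. -/
def VarAccess (Λ Λ' : Config) : Prop :=
  ∃ Γ s s' σ σ' δ, Λ = ⟨(s, σ) ::ₘ Γ, δ⟩ ∧ Λ' = ⟨(s', σ') ::ₘ Γ, δ⟩ ∧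
    LStep s σ δ .tau s' σ' δ ∧ s.AccessesNext

/-- `C` is `D` up to structural congruence and one dead branch of a variable cell. -/
def UpToDeadBranch (C D : Conf Name) : Prop :=
  C.2 = D.2 ∧ ∃ P Q, SC C.2 C.1 P ∧ DropsDead C.2 P Q ∧ SC C.2 Q D.1

end Go

/-! The encoding is designed so that a Go step corresponds to one essential reduction of the
π-process, surrounded by internal communications that only pass values and signals along private
names. The proof isolates that reduction. A local step has a kind (`Kind`): a variable is read or
written, a channel is created, a value is received or sent, a function is called.
`LStep.exists_kind`, by induction on the local step, shows that the encoded statement performs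
internal communications (`Reds`), exposes a redex of this kind and replaces it by its residual
(`Foc`), and communicates internally until it is the encoding of the next statement. `Ev` is this
pattern.

The redex is then completed by its surroundings. A read or write meets the cell of its variable
inside the routine (`ev_cell_read`, `ev_cell_write`); a call meets a copy of the replicated
declaration (`Ev.soup_go`), and the instantiated body is recognised as a new routine
(`cl_funBody_subst`); a sender and a receiver on an unbuffered channel meet each other
(`Ev.soup_com`); the other redexes act on the buffer store or towards the environment. A cell
answers a request by offering both a read and a write branch. The unused one is guarded by a private
name and stays behind; the relation `Dead` follows it through contexts and is the source of the
exceptional alternative.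

The form of the argument is dictated by binding. The parallel rule forbids active restrictions, so
`Foc` brings a process into the shape `(ν as)(A | K)` with no active restriction in `K`, the names
`as` being as fresh as desired. Structural congruence is handled in the quotient `PClass`, a
commutative monoid under parallel composition. It is taken over the stores in which only integers
and channels occur, so all other names can be renamed, and their scopes moved, whatever the store.
The encoding picks bound names by numbering; `cl_map` shows that an injective renaming fixing the
free names is invisible in the quotient, so the numbering does not matter.

Local channels are treated last. A transition is first derived below all their restrictions, where
no buffer entry carries a mark (`store δ []`). The restrictions are then put back one at a time
(`step_nus_chans`), with one more if a channel was created (`Foc.step_make`) and one less if a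
channel was extruded (`step_open`). Finally, the congruences collected on the way are absorbed by
the essential step in the middle of the weak transition (`Ev.weakStep`), so that its end points are
the encodings themselves. -/

set_option linter.unusedSectionVars false

/-! ### Free names, bound names and substitution -/

namespace PiB

section
variable {N : Type}

@[simp] lemma Pre.subst_bound [DecidableEq N] (σ : N → N) (π : Pre N) :
    (π.subst σ).bound = π.bound := by
  cases π <;> rfl

lemma Pre.used_finite (π : Pre N) : π.used.Finite := by
  cases π with
  | inp c xs => exact Set.finite_singleton c
  | out c ds =>
    refine ((Set.finite_singleton c).union (List.finite_toSet ds)).subset ?_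
    intro a ha
    simpa [Pre.used] using ha
  | tau => exact Set.finite_empty

namespace Proc

lemma names_finite (P : Proc N) : P.names.Finite := by
  induction P with
  | sum n π P ih =>
    exact Set.finite_iUnion fun i =>
      ((Pre.used_finite _).union (List.finite_toSet _)).union (ih i)
  | par P Q ihP ihQ => exact ihP.union ihQ
  | nuB c n P ih => exact (Set.finite_singleton c).union ih
  | nu c P ih => exact (Set.finite_singleton c).union ih
  | repl P ih => exact ih

lemma freeNames_subset_names (P : Proc N) : P.freeNames ⊆ P.names := by
  induction P with
  | sum n π P ih =>
    refine Set.iUnion_mono fun i => ?_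
    rintro a (ha | ha)
    · exact Or.inl (Or.inl ha)
    · exact Or.inr (ih i ha.1)
  | par P Q ihP ihQ => exact Set.union_subset_union ihP ihQ
  | nuB c n P ih => exact fun a ha => Or.inr (ih ha.1)
  | nu c P ih => exact fun a ha => Or.inr (ih ha.1)
  | repl P ih => exact ih

lemma boundNames_subset_names (P : Proc N) : P.boundNames ⊆ P.names := by
  induction P with
  | sum n π P ih =>
    refine Set.iUnion_mono fun i => ?_
    rintro a (ha | ha)
    · exact Or.inl (Or.inr ha)
    · exact Or.inr (ih i ha)
  | par P Q ihP ihQ => exact Set.union_subset_union ihP ihQ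
  | nuB c n P ih => exact Set.union_subset_union le_rfl ih
  | nu c P ih => exact Set.union_subset_union le_rfl ih
  | repl P ih => exact ih

lemma mem_freeNames_sum {n : ℕ} {π : Fin n → Pre N} {P : Fin n → Proc N} {a : N} :
    a ∈ (sum n π P).freeNames ↔
      ∃ i, a ∈ (π i).used ∨ (a ∈ (P i).freeNames ∧ a ∉ (π i).bound) := by
  simp [freeNames]

lemma mem_boundNames_sum {n : ℕ} {π : Fin n → Pre N} {P : Fin n → Proc N} {a : N} :
    a ∈ (sum n π P).boundNames ↔ ∃ i, a ∈ (π i).bound ∨ a ∈ (P i).boundNames := by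
  simp [boundNames]

@[simp] lemma mem_freeNames_inp {c : N} {xs : List N} {P : Proc N} {a : N} :
    a ∈ (pre (.inp c xs) P).freeNames ↔ a = c ∨ (a ∈ P.freeNames ∧ a ∉ xs) := by
  simp [pre, mem_freeNames_sum, Pre.used, Pre.bound]

@[simp] lemma mem_freeNames_out {c : N} {ds : List N} {P : Proc N} {a : N} :
    a ∈ (pre (.out c ds) P).freeNames ↔ (a = c ∨ a ∈ ds) ∨ a ∈ P.freeNames := by
  simp [pre, mem_freeNames_sum, Pre.used, Pre.bound]

@[simp] lemma mem_freeNames_tau {P : Proc N} {a : N} :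
    a ∈ (pre .tau P).freeNames ↔ a ∈ P.freeNames := by
  simp [pre, mem_freeNames_sum, Pre.used, Pre.bound]

@[simp] lemma mem_freeNames_zero {a : N} : a ∈ (zero : Proc N).freeNames ↔ False := by
  simp [zero, mem_freeNames_sum]

@[simp] lemma mem_freeNames_par {P Q : Proc N} {a : N} :
    a ∈ (par P Q).freeNames ↔ a ∈ P.freeNames ∨ a ∈ Q.freeNames := Iff.rfl

@[simp] lemma mem_freeNames_nu {c : N} {P : Proc N} {a : N} :
    a ∈ (nu c P).freeNames ↔ a ∈ P.freeNames ∧ a ≠ c := Iff.rfl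

@[simp] lemma mem_freeNames_nuB {c : N} {n : ℕ+} {P : Proc N} {a : N} :
    a ∈ (nuB c n P).freeNames ↔ a ∈ P.freeNames ∧ a ≠ c := Iff.rfl

@[simp] lemma mem_freeNames_repl {P : Proc N} {a : N} :
    a ∈ (repl P).freeNames ↔ a ∈ P.freeNames := Iff.rfl

@[simp] lemma mem_freeNames_nus {cs : List N} {P : Proc N} {a : N} :
    a ∈ (nus cs P).freeNames ↔ a ∈ P.freeNames ∧ a ∉ cs := by
  induction cs with
  | nil => simp [nus]
  | cons c cs ih =>
    change a ∈ (nu c (nus cs P)).freeNames ↔ _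
    simp [ih]
    tauto

@[simp] lemma mem_freeNames_prod {Ps : List (Proc N)} {a : N} :
    a ∈ (prod Ps).freeNames ↔ ∃ P ∈ Ps, a ∈ P.freeNames := by
  induction Ps with
  | nil => simp [prod]
  | cons P Ps ih =>
    change a ∈ (par P (prod Ps)).freeNames ↔ _
    simp [ih]

@[simp] lemma mem_boundNames_inp {c : N} {xs : List N} {P : Proc N} {a : N} :
    a ∈ (pre (.inp c xs) P).boundNames ↔ a ∈ xs ∨ a ∈ P.boundNames := by
  simp [pre, mem_boundNames_sum, Pre.bound]

@[simp] lemma mem_boundNames_out {c : N} {ds : List N} {P : Proc N} {a : N} :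
    a ∈ (pre (.out c ds) P).boundNames ↔ a ∈ P.boundNames := by
  simp [pre, mem_boundNames_sum, Pre.bound]

@[simp] lemma mem_boundNames_zero {a : N} : a ∈ (zero : Proc N).boundNames ↔ False := by
  simp [zero, mem_boundNames_sum]

@[simp] lemma mem_boundNames_par {P Q : Proc N} {a : N} :
    a ∈ (par P Q).boundNames ↔ a ∈ P.boundNames ∨ a ∈ Q.boundNames := Iff.rfl

lemma nus_cons (c : N) (cs : List N) (P : Proc N) : nus (c :: cs) P = nu c (nus cs P) := rfl

@[simp] lemma nus_nil (P : Proc N) : nus [] P = P := rfl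

@[simp] lemma prod_nil : prod ([] : List (Proc N)) = zero := rfl

lemma prod_cons (P : Proc N) (Ps : List (Proc N)) : prod (P :: Ps) = par P (prod Ps) := rfl

end Proc

section Subst
variable [DecidableEq N]

lemma fixOn_of_mem {σ : N → N} {xs : List N} {a : N} (h : a ∈ xs) : fixOn σ xs a = a := by
  simp [fixOn, h]

lemma fixOn_of_notMem {σ : N → N} {xs : List N} {a : N} (h : a ∉ xs) : fixOn σ xs a = σ a := by
  simp [fixOn, h]

@[simp] lemma fixOn_nil (σ : N → N) : fixOn σ [] = σ := by
  funext a; simp [fixOn]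

lemma fixOn_eq_self {σ : N → N} {xs : List N} (h : ∀ x ∈ xs, σ x = x) : fixOn σ xs = σ := by
  funext a
  by_cases ha : a ∈ xs
  · rw [fixOn_of_mem ha, h a ha]
  · rw [fixOn_of_notMem ha]

@[simp] lemma ren_nil_left (ds : List N) (a : N) : ren [] ds a = a := by simp [ren]

@[simp] lemma ren_nil_right (xs : List N) (a : N) : ren xs [] a = a := by simp [ren]

lemma ren_cons (x : N) (xs : List N) (d : N) (ds : List N) (a : N) :
    ren (x :: xs) (d :: ds) a = if a = x then d else ren xs ds a := by
  unfold ren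
  by_cases h : a = x
  · simp [h]
  · have : (a == x) = false := by simpa using h
    simp [List.lookup, this, h]

lemma ren_of_notMem {xs ds : List N} {a : N} (h : a ∉ xs) : ren xs ds a = a := by
  induction xs generalizing ds with
  | nil => simp
  | cons x xs ih =>
    cases ds with
    | nil => simp
    | cons d ds =>
      simp only [List.mem_cons, not_or] at h
      rw [ren_cons, if_neg h.1, ih h.2]

lemma ren_mem {xs ds : List N} {a : N} (hl : ds.length = xs.length) (h : a ∈ xs) :
    ren xs ds a ∈ ds := by
  induction xs generalizing ds with
  | nil => simp at h
  | cons x xs ih =>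
    cases ds with
    | nil => simp at hl
    | cons d ds =>
      rw [ren_cons]
      split_ifs with hx
      · simp
      · exact List.mem_cons_of_mem _
          (ih (by simpa using hl) ((List.mem_cons.1 h).resolve_left hx))

lemma ren_map_right {xs ds : List N} {a : N} (g : N → N) (hl : ds.length = xs.length)
    (h : a ∈ xs) : ren xs (ds.map g) a = g (ren xs ds a) := by
  induction xs generalizing ds with
  | nil => simp at h
  | cons x xs ih =>
    cases ds with
    | nil => simp at hl
    | cons d ds =>
      rw [List.map_cons, ren_cons, ren_cons]
      split_ifs with hx
      · rfl
      · exact ih (by simpa using hl) ((List.mem_cons.1 h).resolve_left hx)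

lemma ren_map_of_mem {xs ds : List N} {a : N} (f : N → N) (hl : ds.length = xs.length)
    (hf : ∀ x ∈ xs, f a = f x → a = x) (h : a ∈ xs) :
    ren (xs.map f) ds (f a) = ren xs ds a := by
  induction xs generalizing ds with
  | nil => simp at h
  | cons x xs ih =>
    cases ds with
    | nil => simp at hl
    | cons d ds =>
      rw [List.map_cons, ren_cons, ren_cons]
      by_cases hx : a = x
      · simp [hx]
      · have hfx : f a ≠ f x := fun e => hx (hf x (by simp) e)
        rw [if_neg hx, if_neg hfx]
        exact ih (by simpa using hl) (fun y hy => hf y (List.mem_cons_of_mem _ hy))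
          ((List.mem_cons.1 h).resolve_left hx)

@[simp] lemma ren_singleton (x d a : N) : ren [x] [d] a = if a = x then d else a := by
  rw [ren_cons]; simp

/-- `ren` looks up the first occurrence of a name, so distinctness of `xs` is what makes position
`j` of `xs` answer with position `j` of `ds`. -/
lemma ren_getElem {xs ds : List N} (hn : xs.Nodup) (hl : ds.length = xs.length) {j : ℕ}
    (hj : j < xs.length) : ren xs ds xs[j] = ds[j] := by
  induction xs generalizing ds j with
  | nil => simp at hj
  | cons x xs ih =>
    cases ds with
    | nil => simp at hl
    | cons d ds =>
      rw [ren_cons]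
      rw [List.nodup_cons] at hn
      cases j with
      | zero => simp
      | succ j =>
        have hj' : j < xs.length := by simpa using hj
        have hne : xs[j] ≠ x := fun e => hn.1 (e ▸ List.getElem_mem hj')
        simp only [List.getElem_cons_succ]
        rw [if_neg hne]
        exact ih hn.2 (by simpa using hl) hj'

lemma ren_map_self {xs ds : List N} (hn : xs.Nodup) (hl : ds.length = xs.length) :
    xs.map (ren xs ds) = ds := by
  refine List.ext_getElem (by simp [hl]) fun j h₁ h₂ => ?_
  rw [List.getElem_map]
  exact ren_getElem hn hl (by simpa using h₁)

namespace Pre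

lemma subst_congr {π : Pre N} {σ τ : N → N} (h : ∀ a ∈ π.used, σ a = τ a) :
    π.subst σ = π.subst τ := by
  cases π with
  | inp c xs => simp only [subst]; rw [h c (by simp [used])]
  | out c ds =>
    simp only [subst]
    rw [h c (by simp [used]), List.map_congr_left fun a ha => h a (by simp [used, ha])]
  | tau => rfl

lemma subst_id (π : Pre N) : π.subst id = π := by
  cases π <;> simp [subst]

lemma subst_subst (π : Pre N) (σ τ : N → N) : (π.subst σ).subst τ = π.subst (τ ∘ σ) := by
  cases π <;> simp [subst]

lemma used_subst (π : Pre N) (σ : N → N) : (π.subst σ).used = σ '' π.used := by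
  cases π with
  | inp c xs => simp [subst, used]
  | out c ds =>
    ext a
    simp only [subst, used, List.mem_map, Set.mem_ofPred_eq, Set.mem_image]
    constructor
    · rintro (rfl | ⟨b, hb, rfl⟩)
      · exact ⟨c, Or.inl rfl, rfl⟩
      · exact ⟨b, Or.inr hb, rfl⟩
    · rintro ⟨b, rfl | hb, rfl⟩
      · exact Or.inl rfl
      · exact Or.inr ⟨b, hb, rfl⟩
  | tau => simp [subst, used]

end Pre

namespace Proc

lemma subst_congr {P : Proc N} {σ τ : N → N} (h : ∀ a ∈ P.freeNames, σ a = τ a) :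
    P.subst σ = P.subst τ := by
  have key : ∀ {Q : Proc N} {xs : List N} {σ τ : N → N},
      (∀ a ∈ Q.freeNames, a ∉ xs → σ a = τ a) →
      ∀ a ∈ Q.freeNames, fixOn σ xs a = fixOn τ xs a := by
    intro Q xs σ τ hQ a ha
    by_cases hx : a ∈ xs
    · rw [fixOn_of_mem hx, fixOn_of_mem hx]
    · rw [fixOn_of_notMem hx, fixOn_of_notMem hx, hQ a ha hx]
  induction P generalizing σ τ with
  | sum n π P ih =>
    simp only [subst]
    congr 1
    · funext i
      exact Pre.subst_congr fun a ha => h a (mem_freeNames_sum.2 ⟨i, Or.inl ha⟩)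
    · funext i
      exact ih i (key fun a ha hx => h a (mem_freeNames_sum.2 ⟨i, Or.inr ⟨ha, hx⟩⟩))
  | par P Q ihP ihQ =>
    simp only [subst]
    rw [ihP fun a ha => h a (Or.inl ha), ihQ fun a ha => h a (Or.inr ha)]
  | nuB c n P ih =>
    simp only [subst]
    rw [ih (key fun a ha hx => h a ⟨ha, by simpa using hx⟩)]
  | nu c P ih =>
    simp only [subst]
    rw [ih (key fun a ha hx => h a ⟨ha, by simpa using hx⟩)]
  | repl P ih =>
    simp only [subst]
    rw [ih h]

lemma subst_id (P : Proc N) : P.subst id = P := by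
  have key : ∀ xs : List N, fixOn id xs = id := fun xs => fixOn_eq_self fun _ _ => rfl
  induction P with
  | sum n π P ih =>
    simp only [subst, key, ih, Pre.subst_id]
  | par P Q ihP ihQ => simp only [subst, ihP, ihQ]
  | nuB c n P ih => simp only [subst, key, ih]
  | nu c P ih => simp only [subst, key, ih]
  | repl P ih => simp only [subst, ih]

lemma subst_eq_self {P : Proc N} {σ : N → N} (h : ∀ a ∈ P.freeNames, σ a = a) :
    P.subst σ = P := by
  rw [subst_congr (τ := id) h, subst_id]

/-- Since `Proc.subst` never renames a binder, substitutions compose only if `σ` does not produce a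
bound name. A name that `σ` fixes is harmless even if some other occurrence of it is bound. -/
lemma subst_subst {P : Proc N} {σ τ : N → N}
    (h : ∀ a ∈ P.freeNames, σ a = a ∨ σ a ∉ P.boundNames) :
    (P.subst σ).subst τ = P.subst (τ ∘ σ) := by
  -- Inputs and both new operators are the same case: a body `Q` below the bound names `xs`.
  have key : ∀ {Q : Proc N} {xs : List N} {σ τ : N → N},
      (∀ {σ τ : N → N}, (∀ a ∈ Q.freeNames, σ a = a ∨ σ a ∉ Q.boundNames) →
        (Q.subst σ).subst τ = Q.subst (τ ∘ σ)) →
      (∀ a ∈ Q.freeNames, a ∉ xs → σ a = a ∨ (σ a ∉ xs ∧ σ a ∉ Q.boundNames)) →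
      (Q.subst (fixOn σ xs)).subst (fixOn τ xs) = Q.subst (fixOn (τ ∘ σ) xs) := by
    intro Q xs σ τ ih hQ
    rw [ih]
    · refine subst_congr fun a ha => ?_
      by_cases hx : a ∈ xs
      · simp [fixOn_of_mem hx]
      · rw [fixOn_of_notMem hx, Function.comp_apply, fixOn_of_notMem hx, Function.comp_apply]
        rcases hQ a ha hx with h' | h'
        · rw [h', fixOn_of_notMem hx]
        · rw [fixOn_of_notMem h'.1]
    · intro a ha
      by_cases hx : a ∈ xs
      · exact Or.inl (fixOn_of_mem hx)
      · rw [fixOn_of_notMem hx]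
        exact (hQ a ha hx).imp_right And.right
  induction P generalizing σ τ with
  | sum n π P ih =>
    simp only [subst, Pre.subst_bound]
    congr 1
    · funext i
      exact Pre.subst_subst _ _ _
    · funext i
      refine key (ih i) fun a ha hx => ?_
      refine (h a (mem_freeNames_sum.2 ⟨i, Or.inr ⟨ha, hx⟩⟩)).imp_right fun hb => ?_
      exact ⟨fun hm => hb (mem_boundNames_sum.2 ⟨i, Or.inl hm⟩),
        fun hm => hb (mem_boundNames_sum.2 ⟨i, Or.inr hm⟩)⟩
  | par P Q ihP ihQ =>
    simp only [subst]
    rw [ihP fun a ha => (h a (Or.inl ha)).imp_right fun hb hm => hb (Or.inl hm),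
      ihQ fun a ha => (h a (Or.inr ha)).imp_right fun hb hm => hb (Or.inr hm)]
  | nuB c n P ih =>
    simp only [subst]
    rw [key ih fun a ha hx => (h a ⟨ha, by simpa using hx⟩).imp_right fun hb =>
      ⟨fun hm => hb (Or.inl (by simpa using hm)), fun hm => hb (Or.inr hm)⟩]
  | nu c P ih =>
    simp only [subst]
    rw [key ih fun a ha hx => (h a ⟨ha, by simpa using hx⟩).imp_right fun hb =>
      ⟨fun hm => hb (Or.inl (by simpa using hm)), fun hm => hb (Or.inr hm)⟩]
  | repl P ih =>
    simp only [subst]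
    rw [ih h]

lemma boundNames_subst (P : Proc N) (σ : N → N) : (P.subst σ).boundNames = P.boundNames := by
  induction P generalizing σ with
  | sum n π P ih => simp only [subst, boundNames, Pre.subst_bound, ih]
  | par P Q ihP ihQ => simp only [subst, boundNames, ihP, ihQ]
  | nuB c n P ih => simp only [subst, boundNames, ih]
  | nu c P ih => simp only [subst, boundNames, ih]
  | repl P ih => simp only [subst, boundNames, ih]

lemma exists_of_mem_freeNames_subst {P : Proc N} {σ : N → N} {a : N}
    (h : a ∈ (P.subst σ).freeNames) : ∃ b ∈ P.freeNames, σ b = a := by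
  have key : ∀ {Q : Proc N} {xs : List N} {σ : N → N} {a : N},
      (∃ b ∈ Q.freeNames, fixOn σ xs b = a) → a ∉ xs → ∃ b ∈ Q.freeNames, b ∉ xs ∧ σ b = a := by
    rintro Q xs σ a ⟨b, hb, hba⟩ ha
    by_cases hx : b ∈ xs
    · rw [fixOn_of_mem hx] at hba
      exact absurd (hba ▸ hx) ha
    · rw [fixOn_of_notMem hx] at hba
      exact ⟨b, hb, hx, hba⟩
  induction P generalizing σ a with
  | sum n π P ih =>
    simp only [subst] at h
    obtain ⟨i, hi | ⟨hi, hx⟩⟩ := mem_freeNames_sum.1 h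
    · rw [Pre.used_subst] at hi
      obtain ⟨b, hb, rfl⟩ := hi
      exact ⟨b, mem_freeNames_sum.2 ⟨i, Or.inl hb⟩, rfl⟩
    · rw [Pre.subst_bound] at hx
      obtain ⟨b, hb, hbx, rfl⟩ := key (ih i hi) hx
      exact ⟨b, mem_freeNames_sum.2 ⟨i, Or.inr ⟨hb, hbx⟩⟩, rfl⟩
  | par P Q ihP ihQ =>
    rcases h with h | h
    · obtain ⟨b, hb, e⟩ := ihP h
      exact ⟨b, Or.inl hb, e⟩
    · obtain ⟨b, hb, e⟩ := ihQ h
      exact ⟨b, Or.inr hb, e⟩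
  | nuB c n P ih =>
    obtain ⟨b, hb, hbx, rfl⟩ := key (ih h.1) (by simpa using h.2)
    exact ⟨b, ⟨hb, by simpa using hbx⟩, rfl⟩
  | nu c P ih =>
    obtain ⟨b, hb, hbx, rfl⟩ := key (ih h.1) (by simpa using h.2)
    exact ⟨b, ⟨hb, by simpa using hbx⟩, rfl⟩
  | repl P ih => exact ih h

lemma newGuarded_subst {P : Proc N} (σ : N → N) (h : P.NewGuarded) :
    (P.subst σ).NewGuarded := by
  induction P generalizing σ with
  | sum n π P ih => trivial
  | par P Q ihP ihQ => exact ⟨ihP σ h.1, ihQ σ h.2⟩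
  | nuB c n P ih => trivial
  | nu c P ih => exact h.elim
  | repl P ih => exact ih σ h

lemma subst_pre (σ : N → N) (π : Pre N) (P : Proc N) :
    (pre π P).subst σ = pre (π.subst σ) (P.subst (fixOn σ π.bound)) := rfl

@[simp] lemma subst_zero (σ : N → N) : (zero : Proc N).subst σ = zero := by
  simp only [zero, subst]
  congr 1 <;> funext i <;> exact i.elim0

lemma subst_nus (σ : N → N) (cs : List N) (P : Proc N) :
    (nus cs P).subst σ = nus cs (P.subst (fixOn σ cs)) := by
  induction cs generalizing σ with
  | nil => simp
  | cons c cs ih =>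
    rw [nus_cons, nus_cons, subst, ih]
    congr 3
    funext a
    by_cases h : a = c <;> by_cases h' : a ∈ cs <;> simp [fixOn, h, h']

/-- A fresh renaming of a free name commutes with the instantiation of an input. -/
lemma subst_ren_ren {Q : Proc N} {xs vs : List N} {c d : N} (hl : vs.length = xs.length)
    (hv : ∀ v ∈ vs, v ∉ Q.boundNames) (hdQ : d ∉ Q.names) (hdx : d ∉ xs) :
    (Q.subst (ren xs vs)).subst (ren [c] [d]) =
      (Q.subst (fixOn (ren [c] [d]) xs)).subst (ren xs (vs.map (ren [c] [d]))) := by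
  -- Each side becomes a single substitution. They agree on `xs`, where the values are renamed after
  -- or before being inserted, and elsewhere because `d` is not in `xs`.
  rw [subst_subst, subst_subst]
  · refine subst_congr fun a ha => ?_
    by_cases hx : a ∈ xs
    · rw [Function.comp_apply, Function.comp_apply, fixOn_of_mem hx, ren_map_right _ hl hx]
    · rw [Function.comp_apply, Function.comp_apply, fixOn_of_notMem hx, ren_of_notMem hx]
      refine (ren_of_notMem ?_).symm
      rw [ren_singleton]
      split_ifs <;> assumption
  · intro a ha
    by_cases hx : a ∈ xs
    · exact Or.inl (fixOn_of_mem hx)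
    · rw [fixOn_of_notMem hx, ren_singleton]
      split_ifs
      · exact Or.inr fun hb => hdQ (boundNames_subset_names _ hb)
      · exact Or.inl rfl
  · intro a ha
    by_cases hx : a ∈ xs
    · exact Or.inr (hv _ (ren_mem hl hx))
    · exact Or.inl (ren_of_notMem hx)

end Proc

end Subst

end

end PiB

/-! ### Renaming of free and binding occurrences together -/

namespace PiB

/-- Renaming of all occurrences of names, including the binding ones. -/
def Pre.map {N M : Type} (f : N → M) : Pre N → Pre M
  | .inp c xs => .inp (f c) (xs.map f)
  | .out c ds => .out (f c) (ds.map f)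
  | .tau => .tau

/-- Renaming of all occurrences of names, including the binding ones. -/
def Proc.map {N M : Type} (f : N → M) : Proc N → Proc M
  | .sum n π P => .sum n (fun i => (π i).map f) (fun i => (P i).map f)
  | .par P Q => .par (P.map f) (Q.map f)
  | .nuB c n P => .nuB (f c) n (P.map f)
  | .nu c P => .nu (f c) (P.map f)
  | .repl P => .repl (P.map f)

section
variable {N M : Type} (f : N → M)

@[simp] lemma Pre.map_bound (π : Pre N) : (π.map f).bound = π.bound.map f := by
  cases π <;> rfl

lemma Pre.map_used (π : Pre N) : (π.map f).used = f '' π.used := by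
  cases π with
  | inp c xs => simp [map, used]
  | out c ds =>
    ext a
    simp only [map, used, List.mem_map, Set.mem_ofPred_eq, Set.mem_image]
    constructor
    · rintro (rfl | ⟨b, hb, rfl⟩)
      · exact ⟨c, Or.inl rfl, rfl⟩
      · exact ⟨b, Or.inr hb, rfl⟩
    · rintro ⟨b, rfl | hb, rfl⟩
      · exact Or.inl rfl
      · exact Or.inr ⟨b, hb, rfl⟩
  | tau => simp [map, used]

lemma Proc.exists_of_mem_freeNames_map {P : Proc N} {a : M} (h : a ∈ (P.map f).freeNames) :
    ∃ b ∈ P.freeNames, f b = a := by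
  induction P generalizing a with
  | sum n π P ih =>
    simp only [map] at h
    obtain ⟨i, hi | ⟨hi, hx⟩⟩ := mem_freeNames_sum.1 h
    · rw [Pre.map_used] at hi
      obtain ⟨b, hb, rfl⟩ := hi
      exact ⟨b, mem_freeNames_sum.2 ⟨i, Or.inl hb⟩, rfl⟩
    · obtain ⟨b, hb, rfl⟩ := ih i hi
      refine ⟨b, mem_freeNames_sum.2 ⟨i, Or.inr ⟨hb, fun hm => hx ?_⟩⟩, rfl⟩
      rw [Pre.map_bound]
      exact List.mem_map_of_mem hm
  | par P Q ihP ihQ =>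
    rcases h with h | h
    · obtain ⟨b, hb, e⟩ := ihP h
      exact ⟨b, Or.inl hb, e⟩
    · obtain ⟨b, hb, e⟩ := ihQ h
      exact ⟨b, Or.inr hb, e⟩
  | nuB c n P ih =>
    obtain ⟨b, hb, rfl⟩ := ih h.1
    exact ⟨b, ⟨hb, fun e => h.2 (by rw [Set.mem_singleton_iff.1 e]; rfl)⟩, rfl⟩
  | nu c P ih =>
    obtain ⟨b, hb, rfl⟩ := ih h.1
    exact ⟨b, ⟨hb, fun e => h.2 (by rw [Set.mem_singleton_iff.1 e]; rfl)⟩, rfl⟩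
  | repl P ih => exact ih h

end

end PiB

/-! ### Structural congruence as equality in a commutative monoid, and α-conversion -/

namespace Go

open PiB

/-- Names that are neither values nor channels. -/
def Name.Internal : Name → Prop
  | .int _ => False
  | .chan _ => False
  | _ => True

@[simp] lemma Name.internal_int (n : ℤ) : (Name.int n).Internal ↔ False := Iff.rfl
@[simp] lemma Name.internal_chan (n : ℕ) : (Name.chan n).Internal ↔ False := Iff.rfl
@[simp] lemma Name.internal_aux (n : ℕ) : (Name.aux n).Internal := trivial
@[simp] lemma Name.internal_var (n : ℕ) : (Name.var n).Internal := trivial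
@[simp] lemma Name.internal_fn (n : ℕ) : (Name.fn n).Internal := trivial
@[simp] lemma Val.not_internal_name (v : Val) : ¬ v.name.Internal := by
  cases v <;> simp [Val.name]

/-- A whole tail of fresh indices is provided because several consecutive ones are needed at once,
for lists of bound names and for variable cells. -/
lemma exists_aux_bound {X : Set Name} (hX : X.Finite) : ∃ m, ∀ j, m ≤ j → Name.aux j ∉ X := by
  have hf : (Name.aux ⁻¹' X).Finite :=
    hX.preimage fun a _ b _ h => by simpa using h
  obtain ⟨m, hm⟩ := hf.bddAbove
  exact ⟨m + 1, fun j hj hx => by have := hm hx; omega⟩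

lemma exists_fresh {X : Set Name} (hX : X.Finite) : ∃ j, Name.aux j ∉ X := by
  obtain ⟨m, hm⟩ := exists_aux_bound hX
  exact ⟨m, hm m le_rfl⟩

lemma exists_fresh_list {X : Set Name} (hX : X.Finite) (n : ℕ) :
    ∃ zs : List Name, zs.length = n ∧ zs.Nodup ∧ ∀ z ∈ zs, z ∉ X := by
  obtain ⟨m, hm⟩ := exists_aux_bound hX
  refine ⟨(List.range n).map fun i => Name.aux (m + i), by simp, ?_, ?_⟩
  · refine List.Nodup.map ?_ List.nodup_range
    intro a b h
    simpa using h
  · intro z hz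
    obtain ⟨i, -, rfl⟩ := List.mem_map.1 hz
    exact hm _ (by omega)

/-- Buffer stores in which only values and channels occur. -/
def Good (B : BufStore Name) : Prop := ∀ a ∈ B.names, ¬ a.Internal

/-- Structural congruence with respect to all stores of values and channels. -/
instance congSetoid : Setoid (Proc Name) where
  r P Q := ∀ B, Good B → SC B P Q
  iseqv := ⟨fun _ _ _ => .refl _, fun h B hB => .symm (h B hB),
    fun h h' B hB => .trans (h B hB) (h' B hB)⟩

/-- Processes up to structural congruence. -/
def PClass : Type := Quotient congSetoid

/-- The class of a process. -/
def cl (P : Proc Name) : PClass := Quotient.mk _ P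

lemma cl_eq {P Q : Proc Name} : cl P = cl Q ↔ ∀ B, Good B → SC B P Q := Quotient.eq

namespace PClass

/-- With parallel composition as product, every rearrangement of components is an instance of
`ac_rfl` or of a permutation of factors. -/
instance : CommMonoid PClass where
  mul := Quotient.map₂ Proc.par fun _ _ h _ _ h' B hB => .par (h B hB) (h' B hB)
  one := cl .zero
  mul_assoc := by
    rintro ⟨P⟩ ⟨Q⟩ ⟨R⟩
    exact Quotient.sound fun B _ => .symm (.par_assoc P Q R)
  mul_comm := by
    rintro ⟨P⟩ ⟨Q⟩
    exact Quotient.sound fun B _ => .par_comm P Q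
  mul_one := by
    rintro ⟨P⟩
    exact Quotient.sound fun B _ => .par_zero P
  one_mul := by
    rintro ⟨P⟩
    exact Quotient.sound fun B _ => .trans (.par_comm _ _) (.par_zero P)

/-- Restriction. -/
def nu (c : Name) : PClass → PClass :=
  Quotient.map (Proc.nu c) fun _ _ h B hB => .nu (h B hB)

/-- Restriction of a list of names. -/
def nus (cs : List Name) (p : PClass) : PClass := cs.foldr nu p

@[simp] lemma nus_nil (p : PClass) : nus [] p = p := rfl

lemma nus_cons (c : Name) (cs : List Name) (p : PClass) : nus (c :: cs) p = nu c (nus cs p) := rfl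

lemma nus_append (cs ds : List Name) (p : PClass) : nus (cs ++ ds) p = nus cs (nus ds p) := by
  simp [nus]

lemma nu_comm (c d : Name) (p : PClass) : nu c (nu d p) = nu d (nu c p) := by
  induction p using Quotient.inductionOn with
  | _ P => exact Quotient.sound fun B _ => .nu_comm c d P

lemma nus_perm {cs ds : List Name} (h : cs.Perm ds) (p : PClass) : nus cs p = nus ds p := by
  induction h with
  | nil => rfl
  | cons c _ ih => rw [nus_cons, nus_cons, ih]
  | swap c d l => rw [nus_cons, nus_cons, nus_cons, nus_cons, nu_comm]
  | trans _ _ ih ih' => rw [ih, ih']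

end PClass

@[simp] lemma cl_zero : cl .zero = 1 := rfl

@[simp] lemma cl_par (P Q : Proc Name) : cl (.par P Q) = cl P * cl Q := rfl

@[simp] lemma cl_nu (c : Name) (P : Proc Name) : cl (.nu c P) = (cl P).nu c := rfl

@[simp] lemma cl_nus (cs : List Name) (P : Proc Name) : cl (.nus cs P) = (cl P).nus cs := by
  induction cs with
  | nil => rfl
  | cons c cs ih => rw [Proc.nus_cons, cl_nu, ih, PClass.nus_cons]

@[simp] lemma cl_prod (Ps : List (Proc Name)) : cl (.prod Ps) = (Ps.map cl).prod := by
  induction Ps with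
  | nil => rfl
  | cons P Ps ih => rw [Proc.prod_cons, cl_par, ih, List.map_cons, List.prod_cons]

lemma cl_repl (P : Proc Name) : cl (.repl P) = cl P * cl (.repl P) :=
  cl_eq.2 fun _ _ => .repl_unfold P

lemma Good.notMem_ln {B : BufStore Name} (hB : Good B) {c : Name} (hc : c.Internal) :
    c ∉ B.ln := fun h => hB c (Or.inr h) hc

lemma Good.notMem_gn {B : BufStore Name} (hB : Good B) {c : Name} (hc : c.Internal) :
    c ∉ B.gn := fun h => hB c (Or.inl (Or.inr h)) hc

lemma Good.notMem_dom {B : BufStore Name} (hB : Good B) {c : Name} (hc : c.Internal) :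
    c ∉ B.dom := fun h => hB c (Or.inl (Or.inl h)) hc

/-- Scope extension requires that `c` is not marked in the store, which holds in every good store
because `c` is internal. The second factor remains a process, since the other side condition speaks
of its free names. -/
lemma nu_mul {c : Name} (hc : c.Internal) (p : PClass) {Q : Proc Name} (hQ : c ∉ Q.freeNames) :
    PClass.nu c (p * cl Q) = PClass.nu c p * cl Q := by
  induction p using Quotient.inductionOn with
  | _ P => exact Quotient.sound fun B hB => .nu_par (hB.notMem_ln hc) hQ

lemma nus_mul {cs : List Name} (p : PClass) {Q : Proc Name}
    (hc : ∀ c ∈ cs, c.Internal ∧ c ∉ Q.freeNames) :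
    PClass.nus cs (p * cl Q) = PClass.nus cs p * cl Q := by
  induction cs with
  | nil => rfl
  | cons c cs ih =>
    rw [PClass.nus_cons, ih fun d hd => hc d (List.mem_cons_of_mem _ hd),
      nu_mul (hc c (by simp)).1 _ (hc c (by simp)).2, PClass.nus_cons]

/-- Scope extension with `0` as first component leaves the restriction around `0`, where it
disappears. -/
lemma nu_cl_of_notMem {c : Name} (hc : c.Internal) {P : Proc Name} (hP : c ∉ P.freeNames) :
    PClass.nu c (cl P) = cl P := by
  have h1 : PClass.nu c 1 = 1 := Quotient.sound fun B hB => .nu_zero (hB.notMem_ln hc)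
  rw [← one_mul (cl P), nu_mul hc _ hP, h1]

lemma nus_cl_of_notMem {cs : List Name} {P : Proc Name}
    (hc : ∀ c ∈ cs, c.Internal ∧ c ∉ P.freeNames) : PClass.nus cs (cl P) = cl P := by
  induction cs with
  | nil => rfl
  | cons c cs ih =>
    rw [PClass.nus_cons, ih fun d hd => hc d (List.mem_cons_of_mem _ hd),
      nu_cl_of_notMem (hc c (by simp)).1 (hc c (by simp)).2]

lemma cl_nu_alpha {c d : Name} (hc : c.Internal) (hd : d.Internal) {P : Proc Name}
    (hP : d ∉ P.names) : cl (.nu c P) = cl (.nu d (P.subst (ren [c] [d]))) :=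
  cl_eq.2 fun _ hB => .alpha_nu (fun h => hB _ h hc) (fun h => hB _ h hd) hP

lemma cl_nuB_alpha {c d : Name} {n : ℕ+} (hc : c.Internal) (hd : d.Internal) {P : Proc Name}
    (hP : d ∉ P.names) : cl (.nuB c n P) = cl (.nuB d n (P.subst (ren [c] [d]))) :=
  cl_eq.2 fun _ hB => .alpha_nuB (fun h => hB _ h hc) (fun h => hB _ h hd) hP

lemma cl_nuB {c : Name} {n : ℕ+} {P Q : Proc Name} (h : cl P = cl Q) :
    cl (.nuB c n P) = cl (.nuB c n Q) :=
  cl_eq.2 fun B hB => .nuB (cl_eq.1 h B hB)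

lemma cl_repl_congr {P Q : Proc Name} (h : cl P = cl Q) : cl (.repl P) = cl (.repl Q) :=
  cl_eq.2 fun B hB => .repl (cl_eq.1 h B hB)

lemma cl_sum {n : ℕ} {π : Fin n → Pre Name} {P Q : Fin n → Proc Name}
    (h : ∀ i, cl (P i) = cl (Q i)) : cl (.sum n π P) = cl (.sum n π Q) :=
  cl_eq.2 fun B hB => .sum fun i => cl_eq.1 (h i) B hB

/-- A summand changes by renaming of its bound names only. -/
def AlphaSummand (π : Pre Name) (P : Proc Name) (π' : Pre Name) (P' : Proc Name) : Prop :=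
  (π' = π ∧ P' = P) ∨ ∃ c xs ys, π = .inp c xs ∧ ys.length = xs.length ∧ xs.Nodup ∧ ys.Nodup ∧
    (∀ y ∈ ys, y ∉ P.names) ∧ π' = .inp c ys ∧ P' = P.subst (ren xs ys)

lemma cl_sum_alpha {n : ℕ} {π π' : Fin n → Pre Name} {P P' : Fin n → Proc Name}
    (h : ∀ i, AlphaSummand (π i) (P i) (π' i) (P' i)) :
    cl (.sum n π P) = cl (.sum n π' P') := by
  -- The congruence renames the binder of one summand at a time; `piecewise` interpolates between
  -- the two sums along the set of summands already renamed.
  have key : ∀ s : Finset (Fin n),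
      cl (.sum n π P) = cl (.sum n (s.piecewise π' π) (s.piecewise P' P)) := by
    intro s
    induction s using Finset.induction_on with
    | empty => simp
    | insert i s hi ih =>
      rw [ih, Finset.piecewise_insert, Finset.piecewise_insert]
      have e₁ : s.piecewise π' π i = π i := Finset.piecewise_eq_of_notMem _ _ _ hi
      have e₂ : s.piecewise P' P i = P i := Finset.piecewise_eq_of_notMem _ _ _ hi
      rcases h i with ⟨h₁, h₂⟩ | ⟨c, xs, ys, hπ, hl, hx, hy, hf, hπ', hP'⟩
      · rw [h₁, h₂, ← e₁, ← e₂, Function.update_eq_self, Function.update_eq_self]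
      · rw [hπ', hP', ← e₂]
        exact cl_eq.2 fun B _ => .alpha_inp i (e₁.trans hπ) hl hx hy (by rwa [e₂])
  simpa using key Finset.univ

/-- The binders are internal names, and the names bound by one input are distinct. -/
def WF : Proc Name → Prop
  | .sum _ π P => ∀ i, (π i).bound.Nodup ∧ (∀ x ∈ (π i).bound, x.Internal) ∧ WF (P i)
  | .par P Q => WF P ∧ WF Q
  | .nuB c _ P => c.Internal ∧ WF P
  | .nu c P => c.Internal ∧ WF P
  | .repl P => WF P

@[simp] lemma wf_zero : WF .zero := fun i => i.elim0
@[simp] lemma wf_par {P Q : Proc Name} : WF (.par P Q) ↔ WF P ∧ WF Q := Iff.rfl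
@[simp] lemma wf_nu {c : Name} {P : Proc Name} : WF (.nu c P) ↔ c.Internal ∧ WF P := Iff.rfl
@[simp] lemma wf_nuB {c : Name} {n : ℕ+} {P : Proc Name} :
    WF (.nuB c n P) ↔ c.Internal ∧ WF P := Iff.rfl
@[simp] lemma wf_repl {P : Proc Name} : WF (.repl P) ↔ WF P := Iff.rfl
@[simp] lemma wf_inp {c : Name} {xs : List Name} {P : Proc Name} :
    WF (.pre (.inp c xs) P) ↔ xs.Nodup ∧ (∀ x ∈ xs, x.Internal) ∧ WF P := by
  simp [Proc.pre, WF, Pre.bound]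
@[simp] lemma wf_out {c : Name} {ds : List Name} {P : Proc Name} :
    WF (.pre (.out c ds) P) ↔ WF P := by
  simp [Proc.pre, WF, Pre.bound]
@[simp] lemma wf_tau {P : Proc Name} : WF (.pre .tau P) ↔ WF P := by
  simp [Proc.pre, WF, Pre.bound]
@[simp] lemma wf_nus {cs : List Name} {P : Proc Name} :
    WF (.nus cs P) ↔ (∀ c ∈ cs, c.Internal) ∧ WF P := by
  induction cs with
  | nil => simp
  | cons c cs ih => rw [Proc.nus_cons, wf_nu, ih]; simp [and_assoc]
@[simp] lemma wf_prod {Ps : List (Proc Name)} : WF (.prod Ps) ↔ ∀ P ∈ Ps, WF P := by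
  induction Ps with
  | nil => simp
  | cons P Ps ih => rw [Proc.prod_cons, wf_par, ih]; simp

/-- Values are not internal, so instantiating an input of a well-formed process by values captures
nothing. -/
lemma WF.internal_of_mem_boundNames {P : Proc Name} (h : WF P) {a : Name}
    (ha : a ∈ P.boundNames) : a.Internal := by
  induction P with
  | sum n π P ih =>
    obtain ⟨i, hi | hi⟩ := Proc.mem_boundNames_sum.1 ha
    · exact (h i).2.1 a hi
    · exact ih i (h i).2.2 hi
  | par P Q ihP ihQ => exact ha.elim (ihP h.1) (ihQ h.2)
  | nuB c n P ih => exact ha.elim (fun e => Set.mem_singleton_iff.1 e ▸ h.1) (ih h.2)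
  | nu c P ih => exact ha.elim (fun e => Set.mem_singleton_iff.1 e ▸ h.1) (ih h.2)
  | repl P ih => exact ih h ha

/-- The hypotheses under which `P.map f`, followed by `σ`, is a renaming of the bound names of
`P`, followed by `τ`. -/
structure MapSubst (f σ τ : Name → Name) (P : Proc Name) : Prop where
  wf : WF P
  internal : ∀ a : Name, a.Internal → (f a).Internal
  inj : Set.InjOn f P.names
  eq : ∀ a ∈ P.freeNames, σ (f a) = τ a
  left : ∀ a ∈ P.freeNames, σ (f a) = f a ∨ σ (f a) ∉ (P.map f).boundNames
  right : ∀ a ∈ P.freeNames, τ a = a ∨ τ a ∉ P.boundNames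

/-- The induction step of `cl_map_subst` at a binder. Once both sides rename their bound names to
the same fresh `zs`, each is one composite substitution, and freshness of `zs` makes it
capture-free, so the induction hypothesis applies. -/
lemma cl_map_subst_binder {f σ τ : Name → Name} {P : Proc Name}
    (ih : ∀ σ τ, MapSubst f σ τ P → cl ((P.map f).subst σ) = cl (P.subst τ))
    (hwf : WF P) (hI : ∀ a : Name, a.Internal → (f a).Internal)
    {xs zs : List Name} (hinj : Set.InjOn f ({a | a ∈ xs} ∪ P.names))
    (heq : ∀ a ∈ P.freeNames, a ∉ xs → σ (f a) = τ a)
    (hleft : ∀ a ∈ P.freeNames, a ∉ xs →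
      σ (f a) = f a ∨ (σ (f a) ∉ xs.map f ∧ σ (f a) ∉ (P.map f).boundNames))
    (hright : ∀ a ∈ P.freeNames, a ∉ xs → τ a = a ∨ (τ a ∉ xs ∧ τ a ∉ P.boundNames))
    (hl : zs.length = xs.length)
    (hz : ∀ z ∈ zs, z ∉ P.names ∧ z ∉ (P.map f).names) :
    cl (((P.map f).subst (fixOn σ (xs.map f))).subst (ren (xs.map f) zs)) =
      cl ((P.subst (fixOn τ xs)).subst (ren xs zs)) := by
  have hfx : ∀ a ∈ P.freeNames, ∀ x ∈ xs, f a = f x → a = x := fun a ha x hx e =>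
    hinj (Or.inr (Proc.freeNames_subset_names _ ha)) (Or.inl hx) e
  have hfm : ∀ a ∈ P.freeNames, a ∉ xs → f a ∉ xs.map f := by
    intro a ha hx hm
    obtain ⟨x, hxx, e⟩ := List.mem_map.1 hm
    exact hx (hfx a ha x hxx e.symm ▸ hxx)
  have hs : ∀ a ∈ P.freeNames, a ∉ xs → σ (f a) ∉ xs.map f := by
    intro a ha hx
    rcases hleft a ha hx with h | h
    · rw [h]; exact hfm a ha hx
    · exact h.1
  have ht : ∀ a ∈ P.freeNames, a ∉ xs → τ a ∉ xs := by
    intro a ha hx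
    rcases hright a ha hx with h | h
    · rwa [h]
    · exact h.1
  -- These four facts compute the composites: bound names go to `zs` on both sides, the others to `σ
  -- (f a)` and to `τ a`.
  have e₁ : ∀ a ∈ P.freeNames, a ∈ xs →
      (ren (xs.map f) zs ∘ fixOn σ (xs.map f)) (f a) = ren xs zs a := by
    intro a ha hx
    rw [Function.comp_apply, fixOn_of_mem (List.mem_map_of_mem hx),
      ren_map_of_mem f hl (hfx a ha) hx]
  have e₂ : ∀ a ∈ P.freeNames, a ∉ xs →
      (ren (xs.map f) zs ∘ fixOn σ (xs.map f)) (f a) = σ (f a) := by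
    intro a ha hx
    rw [Function.comp_apply, fixOn_of_notMem (hfm a ha hx), ren_of_notMem (hs a ha hx)]
  have e₃ : ∀ a ∈ P.freeNames, a ∈ xs → (ren xs zs ∘ fixOn τ xs) a = ren xs zs a := by
    intro a ha hx
    rw [Function.comp_apply, fixOn_of_mem hx]
  have e₄ : ∀ a ∈ P.freeNames, a ∉ xs → (ren xs zs ∘ fixOn τ xs) a = τ a := by
    intro a ha hx
    rw [Function.comp_apply, fixOn_of_notMem hx, ren_of_notMem (ht a ha hx)]
  rw [Proc.subst_subst, Proc.subst_subst]
  · refine ih _ _ ⟨hwf, hI, hinj.mono Set.subset_union_right, ?_, ?_, ?_⟩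
    · intro a ha
      by_cases hx : a ∈ xs
      · rw [e₁ a ha hx, e₃ a ha hx]
      · rw [e₂ a ha hx, e₄ a ha hx, heq a ha hx]
    · intro a ha
      by_cases hx : a ∈ xs
      · rw [e₁ a ha hx]
        exact Or.inr fun hb => (hz _ (ren_mem hl hx)).2 (Proc.boundNames_subset_names _ hb)
      · rw [e₂ a ha hx]
        exact (hleft a ha hx).imp_right And.right
    · intro a ha
      by_cases hx : a ∈ xs
      · rw [e₃ a ha hx]
        exact Or.inr fun hb => (hz _ (ren_mem hl hx)).1 (Proc.boundNames_subset_names _ hb)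
      · rw [e₄ a ha hx]
        exact (hright a ha hx).imp_right And.right
  · intro a ha
    by_cases hx : a ∈ xs
    · exact Or.inl (fixOn_of_mem hx)
    · rw [fixOn_of_notMem hx]
      exact (hright a ha hx).imp_right And.right
  · intro b hb
    obtain ⟨a, ha, rfl⟩ := Proc.exists_of_mem_freeNames_map f hb
    by_cases hx : a ∈ xs
    · exact Or.inl (fixOn_of_mem (List.mem_map_of_mem hx))
    · rw [fixOn_of_notMem (hfm a ha hx)]
      exact (hleft a ha hx).imp_right And.right

/-- The substitutions are there for the sake of the induction: passing a binder by α-conversion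
leaves a substitution on the body, so the statement for `map` alone is not inductive. -/
lemma cl_map_subst {P : Proc Name} {f σ τ : Name → Name} (h : MapSubst f σ τ P) :
    cl ((P.map f).subst σ) = cl (P.subst τ) := by
  induction P generalizing σ τ with
  | sum n π P ih =>
    -- Both sides are α-converted, summand by summand, to sums with the same prefixes; the bodies
    -- are then congruent by induction.
    have key : ∀ i, ∃ π' P₁ P₂,
        AlphaSummand (((π i).map f).subst σ)
          (((P i).map f).subst (fixOn σ ((π i).map f).bound)) π' P₁ ∧
        AlphaSummand ((π i).subst τ) ((P i).subst (fixOn τ (π i).bound)) π' P₂ ∧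
        cl P₁ = cl P₂ := by
      intro i
      have hfn : ∀ a ∈ (P i).freeNames, a ∉ (π i).bound → a ∈ (Proc.sum n π P).freeNames :=
        fun a ha hx => Proc.mem_freeNames_sum.2 ⟨i, Or.inr ⟨ha, hx⟩⟩
      have hbd : ∀ {a}, a ∉ (Proc.sum n π P).boundNames →
          a ∉ (π i).bound ∧ a ∉ (P i).boundNames := fun ha =>
        ⟨fun hm => ha (Proc.mem_boundNames_sum.2 ⟨i, Or.inl hm⟩),
          fun hm => ha (Proc.mem_boundNames_sum.2 ⟨i, Or.inr hm⟩)⟩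
      have hbd' : ∀ {a}, a ∉ ((Proc.sum n π P).map f).boundNames →
          a ∉ (π i).bound.map f ∧ a ∉ ((P i).map f).boundNames := fun ha =>
        ⟨fun hm => ha (Proc.mem_boundNames_sum.2 ⟨i, Or.inl (by simpa using hm)⟩),
          fun hm => ha (Proc.mem_boundNames_sum.2 ⟨i, Or.inr hm⟩)⟩
      have hsub : ∀ a, a ∈ (π i).used ∨ a ∈ (π i).bound ∨ a ∈ (P i).names →
          a ∈ (Proc.sum n π P).names := by
        intro a ha
        refine Set.mem_iUnion.2 ⟨i, ?_⟩
        rcases ha with h | h | h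
        · exact Or.inl (Or.inl h)
        · exact Or.inl (Or.inr h)
        · exact Or.inr h
      have hfu : ∀ a ∈ (π i).used, σ (f a) = τ a := fun a ha =>
        h.eq a (Proc.mem_freeNames_sum.2 ⟨i, Or.inl ha⟩)
      have hfin := (((((P i).names_finite).union ((P i).map f).names_finite).union
        (((P i).map f).subst (fixOn σ ((π i).map f).bound)).names_finite).union
        ((P i).subst (fixOn τ (π i).bound)).names_finite)
      obtain ⟨zs, hzl, hzn, hz⟩ := exists_fresh_list hfin (π i).bound.length
      have hcl := cl_map_subst_binder (fun σ τ => ih i) (h.wf i).2.2 h.internal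
        (xs := (π i).bound) (zs := zs) (σ := σ) (τ := τ)
        (h.inj.mono fun a ha => hsub a (ha.elim (fun h => Or.inr (Or.inl h))
          fun h => Or.inr (Or.inr h)))
        (fun a ha hx => h.eq a (hfn a ha hx))
        (fun a ha hx => (h.left a (hfn a ha hx)).imp_right hbd')
        (fun a ha hx => (h.right a (hfn a ha hx)).imp_right hbd)
        hzl (fun z hz' => ⟨fun hm => hz z hz' (Or.inl (Or.inl (Or.inl hm))),
          fun hm => hz z hz' (Or.inl (Or.inl (Or.inr hm)))⟩)
      have hnd := (h.wf i).1
      have hnd' : ((π i).bound.map f).Nodup := by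
        refine List.Nodup.map_on ?_ hnd
        intro x hx y hy e
        exact h.inj (hsub x (Or.inr (Or.inl hx))) (hsub y (Or.inr (Or.inl hy))) e
      cases hπ : π i with
      | inp c xs =>
        rw [hπ] at hcl hzl hnd hnd' hz hfu
        refine ⟨.inp (τ c) zs, _, _, Or.inr ⟨τ c, xs.map f, zs, ?_, ?_, hnd', hzn, ?_, rfl, rfl⟩,
          Or.inr ⟨τ c, xs, zs, rfl, hzl, hnd, hzn, ?_, rfl, rfl⟩, hcl⟩
        · simp only [Pre.map, Pre.subst]
          rw [hfu c (by simp [Pre.used])]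
        · simpa [Pre.bound] using hzl
        · exact fun y hy hm => hz y hy (Or.inl (Or.inr hm))
        · exact fun y hy hm => hz y hy (Or.inr hm)
      | out c ds =>
        rw [hπ] at hcl hzl hfu
        -- An output binds nothing, so there is nothing to rename.
        have : zs = [] := by simpa [Pre.bound] using hzl
        subst this
        have hid : ∀ Q : Proc Name, Q.subst (ren [] []) = Q := fun Q =>
          Proc.subst_eq_self fun a _ => ren_nil_left _ _
        refine ⟨_, _, _, Or.inl ⟨rfl, rfl⟩, Or.inl ⟨?_, rfl⟩, ?_⟩
        · simp only [Pre.map, Pre.subst, List.map_map]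
          rw [hfu c (by simp [Pre.used])]
          congr 1
          exact List.map_congr_left fun a ha => hfu a (by simp [Pre.used, ha])
        · simpa [Pre.bound, Pre.map, hid] using hcl
      | tau =>
        rw [hπ] at hcl hzl
        have : zs = [] := by simpa [Pre.bound] using hzl
        subst this
        have hid : ∀ Q : Proc Name, Q.subst (ren [] []) = Q := fun Q =>
          Proc.subst_eq_self fun a _ => ren_nil_left _ _
        exact ⟨_, _, _, Or.inl ⟨rfl, rfl⟩, Or.inl ⟨rfl, rfl⟩, by
          simpa [Pre.bound, Pre.map, hid] using hcl⟩
    choose π' P₁ P₂ h₁ h₂ h₃ using key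
    simp only [Proc.map, Proc.subst]
    rw [cl_sum_alpha h₁, cl_sum_alpha h₂]
    exact cl_sum h₃
  | par P Q ihP ihQ =>
    have hl : MapSubst f σ τ P := ⟨h.wf.1, h.internal, h.inj.mono Set.subset_union_left,
      fun a ha => h.eq a (Or.inl ha),
      fun a ha => (h.left a (Or.inl ha)).imp_right fun hb hm => hb (Or.inl hm),
      fun a ha => (h.right a (Or.inl ha)).imp_right fun hb hm => hb (Or.inl hm)⟩
    have hr : MapSubst f σ τ Q := ⟨h.wf.2, h.internal, h.inj.mono Set.subset_union_right,
      fun a ha => h.eq a (Or.inr ha),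
      fun a ha => (h.left a (Or.inr ha)).imp_right fun hb hm => hb (Or.inr hm),
      fun a ha => (h.right a (Or.inr ha)).imp_right fun hb hm => hb (Or.inr hm)⟩
    simp only [Proc.map, Proc.subst, cl_par, ihP hl, ihQ hr]
  | nuB c n P ih =>
    obtain ⟨d, hd⟩ := exists_fresh ((((P.names_finite).union (P.map f).names_finite).union
        ((P.map f).subst (fixOn σ [f c])).names_finite).union
        (P.subst (fixOn τ [c])).names_finite)
    simp only [Set.mem_union, not_or] at hd
    have hcl := cl_map_subst_binder (fun σ τ => ih) h.wf.2 h.internal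
      (xs := [c]) (zs := [.aux d]) (σ := σ) (τ := τ)
      (by refine h.inj.mono ?_; rintro a (ha | ha)
          · exact Or.inl (by simpa using ha)
          · exact Or.inr ha)
      (fun a ha hx => h.eq a ⟨ha, by simpa using hx⟩)
      (fun a ha hx => (h.left a ⟨ha, by simpa using hx⟩).imp_right fun hb =>
        ⟨fun hm => hb (Or.inl (by simpa using hm)), fun hm => hb (Or.inr hm)⟩)
      (fun a ha hx => (h.right a ⟨ha, by simpa using hx⟩).imp_right fun hb =>
        ⟨fun hm => hb (Or.inl (by simpa using hm)), fun hm => hb (Or.inr hm)⟩)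
      rfl (by simp [hd])
    simp only [Proc.map, Proc.subst]
    rw [cl_nuB_alpha (h.internal c h.wf.1) (Name.internal_aux d) hd.1.2,
      cl_nuB_alpha h.wf.1 (Name.internal_aux d) hd.2]
    exact cl_nuB hcl
  | nu c P ih =>
    obtain ⟨d, hd⟩ := exists_fresh ((((P.names_finite).union (P.map f).names_finite).union
        ((P.map f).subst (fixOn σ [f c])).names_finite).union
        (P.subst (fixOn τ [c])).names_finite)
    simp only [Set.mem_union, not_or] at hd
    have hcl := cl_map_subst_binder (fun σ τ => ih) h.wf.2 h.internal
      (xs := [c]) (zs := [.aux d]) (σ := σ) (τ := τ)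
      (by refine h.inj.mono ?_; rintro a (ha | ha)
          · exact Or.inl (by simpa using ha)
          · exact Or.inr ha)
      (fun a ha hx => h.eq a ⟨ha, by simpa using hx⟩)
      (fun a ha hx => (h.left a ⟨ha, by simpa using hx⟩).imp_right fun hb =>
        ⟨fun hm => hb (Or.inl (by simpa using hm)), fun hm => hb (Or.inr hm)⟩)
      (fun a ha hx => (h.right a ⟨ha, by simpa using hx⟩).imp_right fun hb =>
        ⟨fun hm => hb (Or.inl (by simpa using hm)), fun hm => hb (Or.inr hm)⟩)
      rfl (by simp [hd])
    simp only [Proc.map, Proc.subst]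
    rw [cl_nu_alpha (h.internal c h.wf.1) (Name.internal_aux d) hd.1.2,
      cl_nu_alpha h.wf.1 (Name.internal_aux d) hd.2]
    rw [cl_nu, cl_nu]
    exact congrArg _ hcl
  | repl P ih =>
    exact cl_repl_congr (ih ⟨h.wf, h.internal, h.inj, h.eq, h.left, h.right⟩)

/-- An injective renaming that fixes the free names only renames bound names. -/
theorem cl_map {P : Proc Name} {f : Name → Name} (hP : WF P)
    (hI : ∀ a : Name, a.Internal → (f a).Internal) (hf : Set.InjOn f P.names)
    (hfix : ∀ a ∈ P.freeNames, f a = a) : cl (P.map f) = cl P := by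
  have := cl_map_subst (σ := id) (τ := id) (P := P) (f := f)
    ⟨hP, hI, hf, hfix, fun _ _ => Or.inl rfl, fun _ _ => Or.inl rfl⟩
  rwa [Proc.subst_id, Proc.subst_id] at this

end Go

/-! ### Exposing redexes below restrictions -/

namespace Go

open PiB

/-- The active restrictions bind internal names, and none is directly below a replication. -/
def Normal : Proc Name → Prop
  | .sum _ _ _ => True
  | .par P Q => Normal P ∧ Normal Q
  | .nuB _ _ _ => True
  | .nu c P => c.Internal ∧ Normal P
  | .repl P => P.NewGuarded

@[simp] lemma normal_pre {π : Pre Name} {P : Proc Name} : Normal (.pre π P) := trivial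
@[simp] lemma normal_zero : Normal .zero := trivial
@[simp] lemma normal_sum {n : ℕ} {π : Fin n → Pre Name} {P : Fin n → Proc Name} :
    Normal (.sum n π P) := trivial
@[simp] lemma normal_nuB {c : Name} {n : ℕ+} {P : Proc Name} : Normal (.nuB c n P) := trivial
@[simp] lemma normal_par {P Q : Proc Name} : Normal (.par P Q) ↔ Normal P ∧ Normal Q := Iff.rfl
@[simp] lemma normal_nu {c : Name} {P : Proc Name} :
    Normal (.nu c P) ↔ c.Internal ∧ Normal P := Iff.rfl
@[simp] lemma normal_repl {P : Proc Name} : Normal (.repl P) ↔ P.NewGuarded := Iff.rfl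
@[simp] lemma normal_nus {cs : List Name} {P : Proc Name} :
    Normal (.nus cs P) ↔ (∀ c ∈ cs, c.Internal) ∧ Normal P := by
  induction cs with
  | nil => simp
  | cons c cs ih => rw [Proc.nus_cons, normal_nu, ih]; simp [and_assoc]
@[simp] lemma normal_prod {Ps : List (Proc Name)} : Normal (.prod Ps) ↔ ∀ P ∈ Ps, Normal P := by
  induction Ps with
  | nil => simp
  | cons P Ps ih => rw [Proc.prod_cons, normal_par, ih]; simp

@[simp] lemma newGuarded_pre {π : Pre Name} {P : Proc Name} : (Proc.pre π P).NewGuarded := trivial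
@[simp] lemma newGuarded_zero : (Proc.zero : Proc Name).NewGuarded := trivial

lemma Normal.subst {P : Proc Name} (h : Normal P) (σ : Name → Name) : Normal (P.subst σ) := by
  induction P generalizing σ with
  | sum n π P ih => trivial
  | par P Q ihP ihQ => exact ⟨ihP h.1 σ, ihQ h.2 σ⟩
  | nuB c n P ih => trivial
  | nu c P ih => exact ⟨h.1, ih h.2 _⟩
  | repl P ih => exact Proc.newGuarded_subst _ h

/-- The active restrictions of a normal process can be moved to the outside under fresh names. -/
lemma Normal.exists_nus {P : Proc Name} (h : Normal P) {X : Set Name} (hX : X.Finite) :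
    ∃ bs P₀, (∀ b ∈ bs, b.Internal ∧ b ∉ X) ∧ P₀.NewGuarded ∧ cl P = cl (.nus bs P₀) ∧
      ∀ a ∈ P₀.freeNames, a ∈ P.freeNames ∨ a ∈ bs := by
  induction P generalizing X with
  | sum n π P ih => exact ⟨[], .sum n π P, by simp, trivial, rfl, fun a ha => Or.inl ha⟩
  | par P Q ihP ihQ =>
    -- The names `bs` avoid `Q`, and then `cs` avoid `P₀`, so that both scopes can be extended over
    -- the other component.
    obtain ⟨bs, P₀, hbs, hP₀, eP, fP⟩ := ihP h.1 (hX.union Q.names_finite)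
    obtain ⟨cs, Q₀, hcs, hQ₀, eQ, fQ⟩ := ihQ h.2 (hX.union P₀.names_finite)
    refine ⟨bs ++ cs, .par P₀ Q₀, ?_, ⟨hP₀, hQ₀⟩, ?_, ?_⟩
    · intro b hb
      rcases List.mem_append.1 hb with hb | hb
      · exact ⟨(hbs b hb).1, fun hx => (hbs b hb).2 (Or.inl hx)⟩
      · exact ⟨(hcs b hb).1, fun hx => (hcs b hb).2 (Or.inl hx)⟩
    · rw [cl_par, eP, cl_nus, ← nus_mul, eQ, cl_nus, cl_nus, PClass.nus_append, cl_par,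
        mul_comm (cl P₀) (cl Q₀), nus_mul, mul_comm]
      · exact fun c hc => ⟨(hcs c hc).1, fun hf =>
          (hcs c hc).2 (Or.inr (Proc.freeNames_subset_names _ hf))⟩
      · exact fun c hc => ⟨(hbs c hc).1, fun hf =>
          (hbs c hc).2 (Or.inr (Proc.freeNames_subset_names _ hf))⟩
    · rintro a (ha | ha)
      · rcases fP a ha with h | h
        · exact Or.inl (Or.inl h)
        · exact Or.inr (by simp [h])
      · rcases fQ a ha with h | h
        · exact Or.inl (Or.inr h)
        · exact Or.inr (by simp [h])
  | nuB c n P ih => exact ⟨[], .nuB c n P, by simp, trivial, rfl, fun a ha => Or.inl ha⟩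
  | nu c P ih =>
    obtain ⟨bs, P₀, hbs, hP₀, eP, fP⟩ := ih h.2 (hX.union (Set.finite_singleton c))
    obtain ⟨d, hd⟩ := exists_fresh (hX.union (Proc.nus bs P₀).names_finite)
    simp only [Set.mem_union, not_or] at hd
    refine ⟨.aux d :: bs, P₀.subst (fixOn (ren [c] [.aux d]) bs), ?_,
      Proc.newGuarded_subst _ hP₀, ?_, ?_⟩
    · intro b hb
      rcases List.mem_cons.1 hb with rfl | hb
      · exact ⟨trivial, hd.1⟩
      · exact ⟨(hbs b hb).1, fun hx => (hbs b hb).2 (Or.inl hx)⟩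
    · rw [cl_nu, eP, ← cl_nu, cl_nu_alpha h.1 (Name.internal_aux d) hd.2, Proc.subst_nus,
        ← Proc.nus_cons]
    · intro a ha
      obtain ⟨b, hb, rfl⟩ := Proc.exists_of_mem_freeNames_subst ha
      by_cases hbb : b ∈ bs
      · rw [fixOn_of_mem hbb]
        exact Or.inr (List.mem_cons_of_mem _ hbb)
      · rw [fixOn_of_notMem hbb, ren_singleton]
        split_ifs with e
        · exact Or.inr (by simp)
        · exact Or.inl ⟨(fP b hb).resolve_right hbb, e⟩
  | repl P ih => exact ⟨[], .repl P, by simp, h, rfl, fun a ha => Or.inl ha⟩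

/-- Relations between a redex and its residual. -/
abbrev Redex : Type := Proc Name → Proc Name → Prop

/-- `P` exposes a redex `A` under restrictions, `P'` is the same with its residual `A'`, and the
channels in `W` are not free in the context. The restricted names avoid any given finite set. -/
def Foc (W : Set ℕ) (ρ : Redex) (P P' : Proc Name) : Prop :=
  ∀ X : Set Name, X.Finite → ∃ as A A' K, (∀ a ∈ as, a.Internal ∧ a ∉ X) ∧ K.NewGuarded ∧
    (∀ w ∈ W, Name.chan w ∉ K.freeNames) ∧ ρ A A' ∧
    cl P = cl (.nus as (.par A K)) ∧ cl P' = cl (.nus as (.par A' K))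

/-- The relation is preserved when the name `c` is replaced by a fresh name. -/
def Stable (ρ : Redex) (c : Name) : Prop :=
  ∀ A A', ρ A A' → ∃ Y : Set Name, Y.Finite ∧ ∀ d, Name.aux d ∉ Y →
    ρ (A.subst (ren [c] [.aux d])) (A'.subst (ren [c] [.aux d]))

namespace Foc

variable {W : Set ℕ} {ρ ρ' : Redex} {P P' Q Q' R R' : Proc Name}

lemma base (h : ρ P P') : Foc W ρ P P' := fun _ _ =>
  ⟨[], P, P', .zero, by simp, trivial, by simp, h, by simp, by simp⟩

lemma congr (h : Foc W ρ P P') (e : cl Q = cl P) (e' : cl Q' = cl P') : Foc W ρ Q Q' := by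
  intro X hX
  obtain ⟨as, A, A', K, h₁, h₂, h₃, h₄, h₅, h₆⟩ := h X hX
  exact ⟨as, A, A', K, h₁, h₂, h₃, h₄, e.trans h₅, e'.trans h₆⟩

/-- The name `c` may lie in the set that is to be avoided, so it is replaced by a fresh one, and
`Stable` says that the redex survives this. The names `as` are chosen different from `c`, hence the
substitution passes them unchanged. -/
lemma nu (h : Foc W ρ P P') {c : Name} (hc : c.Internal) (hρ : Stable ρ c) :
    Foc W ρ (.nu c P) (.nu c P') := by
  intro X hX
  obtain ⟨as, A, A', K, h₁, h₂, h₃, h₄, h₅, h₆⟩ := h _ (hX.union (Set.finite_singleton c))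
  obtain ⟨Y, hY, hst⟩ := hρ A A' h₄
  obtain ⟨d, hd⟩ := exists_fresh (((hX.union hY).union (Proc.nus as (.par A K)).names_finite).union
    (Proc.nus as (.par A' K)).names_finite)
  simp only [Set.mem_union, not_or] at hd
  have hfix : fixOn (ren [c] [Name.aux d]) as = ren [c] [.aux d] := by
    refine fixOn_eq_self fun a ha => ren_of_notMem ?_
    rw [List.mem_singleton]
    rintro rfl
    exact (h₁ a ha).2 (Or.inr rfl)
  refine ⟨.aux d :: as, A.subst (ren [c] [.aux d]), A'.subst (ren [c] [.aux d]),
    K.subst (ren [c] [.aux d]), ?_, Proc.newGuarded_subst _ h₂, ?_, hst d hd.1.1.2, ?_, ?_⟩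
  · intro a ha
    rcases List.mem_cons.1 ha with rfl | ha
    · exact ⟨trivial, hd.1.1.1⟩
    · exact ⟨(h₁ a ha).1, fun hx => (h₁ a ha).2 (Or.inl hx)⟩
  · intro w hw hf
    obtain ⟨b, hb, e⟩ := Proc.exists_of_mem_freeNames_subst hf
    rw [ren_singleton] at e
    split_ifs at e
    exact h₃ w hw (e ▸ hb)
  · rw [cl_nu, h₅, ← cl_nu, cl_nu_alpha hc (Name.internal_aux d) hd.1.2, Proc.subst_nus, hfix,
      ← Proc.nus_cons, Proc.subst]
  · rw [cl_nu, h₆, ← cl_nu, cl_nu_alpha hc (Name.internal_aux d) hd.2, Proc.subst_nus, hfix,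
      ← Proc.nus_cons, Proc.subst]

lemma nus (h : Foc W ρ P P') {cs : List Name} (hc : ∀ c ∈ cs, c.Internal ∧ Stable ρ c) :
    Foc W ρ (.nus cs P) (.nus cs P') := by
  induction cs with
  | nil => exact h
  | cons c cs ih =>
    exact (ih fun d hd => hc d (List.mem_cons_of_mem _ hd)).nu (hc c (by simp)).1
      (hc c (by simp)).2

/-- The context of a redex must have no active restriction, so those of `R` are pulled to the front
and only the remaining part of `R` joins `K`. The names `as` avoid `R` and the names `bs` avoid the
redex, its residual and `K`, so no scope extension captures anything. -/
lemma par (h : Foc W ρ P P') (hR : Normal R) (hW : ∀ w ∈ W, Name.chan w ∉ R.freeNames) :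
    Foc W ρ (.par P R) (.par P' R) := by
  intro X hX
  obtain ⟨as, A, A', K, h₁, h₂, h₃, h₄, h₅, h₆⟩ := h _ (hX.union R.names_finite)
  obtain ⟨bs, R₀, hbs, hR₀, eR, fR⟩ := hR.exists_nus
    (hX.union ((Proc.par A K).names_finite.union (Proc.par A' K).names_finite))
  have key : ∀ P A, cl P = cl (.nus as (.par A K)) →
      (∀ b ∈ bs, b ∉ (Proc.par A K).names) →
      cl (.par P R) = cl (.nus (as ++ bs) (.par A (.par K R₀))) := by
    intro P A h hb
    rw [cl_par, h, cl_nus, ← nus_mul, eR, cl_nus, cl_nus, PClass.nus_append, cl_par, cl_par,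
      cl_par, mul_comm _ (PClass.nus bs _), ← cl_par A K, ← nus_mul, cl_par]
    · congr 2
      ac_rfl
    · exact fun c hc => ⟨(hbs c hc).1, fun hf => hb c hc (Proc.freeNames_subset_names _ hf)⟩
    · exact fun c hc => ⟨(h₁ c hc).1, fun hf =>
        (h₁ c hc).2 (Or.inr (Proc.freeNames_subset_names _ hf))⟩
  refine ⟨as ++ bs, A, A', .par K R₀, ?_, ⟨h₂, hR₀⟩, ?_, h₄, ?_, ?_⟩
  · intro b hb
    rcases List.mem_append.1 hb with hb | hb
    · exact ⟨(h₁ b hb).1, fun hx => (h₁ b hb).2 (Or.inl hx)⟩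
    · exact ⟨(hbs b hb).1, fun hx => (hbs b hb).2 (Or.inl hx)⟩
  · rintro w hw (hf | hf)
    · exact h₃ w hw hf
    · rcases fR _ hf with hf | hf
      · exact hW w hw hf
      · exact (hbs _ hf).1
  · exact key P A h₅ fun b hb hm => (hbs b hb).2 (Or.inr (Or.inl hm))
  · exact key P' A' h₆ fun b hb hm => (hbs b hb).2 (Or.inr (Or.inr hm))

/-- The redex may be joined with a parallel component. -/
lemma join (h : Foc W ρ P P') (hρ : ∀ A A', ρ A A' → ρ' (.par A R) (.par A' R')) :
    Foc W ρ' (.par P R) (.par P' R') := by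
  intro X hX
  obtain ⟨as, A, A', K, h₁, h₂, h₃, h₄, h₅, h₆⟩ :=
    h _ (hX.union (R.names_finite.union R'.names_finite))
  refine ⟨as, .par A R, .par A' R', K, ?_, h₂, h₃, hρ _ _ h₄, ?_, ?_⟩
  · exact fun a ha => ⟨(h₁ a ha).1, fun hx => (h₁ a ha).2 (Or.inl hx)⟩
  · rw [cl_par, h₅, cl_nus, ← nus_mul, cl_nus]
    · congr 1
      simp only [cl_par]
      ac_rfl
    · exact fun c hc => ⟨(h₁ c hc).1, fun hf =>
        (h₁ c hc).2 (Or.inr (Or.inl (Proc.freeNames_subset_names _ hf)))⟩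
  · rw [cl_par, h₆, cl_nus, ← nus_mul, cl_nus]
    · congr 1
      simp only [cl_par]
      ac_rfl
    · exact fun c hc => ⟨(h₁ c hc).1, fun hf =>
        (h₁ c hc).2 (Or.inr (Or.inr (Proc.freeNames_subset_names _ hf)))⟩

/-- Serves to bring two redexes together: exposing the first one leads to a process in which the
second one is still to be exposed. -/
lemma flatten (h : Foc W (Foc W ρ) P P') : Foc W ρ P P' := by
  intro X hX
  obtain ⟨as, B, B', K, h₁, h₂, h₃, h₄, h₅, h₆⟩ := h X hX
  obtain ⟨bs, A, A', L, g₁, g₂, g₃, g₄, g₅, g₆⟩ := h₄ _ (hX.union K.names_finite)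
  have key : ∀ P B A, cl P = cl (.nus as (.par B K)) → cl B = cl (.nus bs (.par A L)) →
      cl P = cl (.nus (as ++ bs) (.par A (.par L K))) := by
    intro P B A h g
    rw [h, cl_nus, cl_par, g, cl_nus, ← nus_mul, cl_nus, PClass.nus_append]
    · congr 2
      simp only [cl_par]
      ac_rfl
    · exact fun c hc => ⟨(g₁ c hc).1, fun hf =>
        (g₁ c hc).2 (Or.inr (Proc.freeNames_subset_names _ hf))⟩
  refine ⟨as ++ bs, A, A', .par L K, ?_, ⟨g₂, h₂⟩, ?_, g₄, key _ _ _ h₅ g₅, key _ _ _ h₆ g₆⟩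
  · intro b hb
    rcases List.mem_append.1 hb with hb | hb
    · exact h₁ b hb
    · exact ⟨(g₁ b hb).1, fun hx => (g₁ b hb).2 (Or.inl hx)⟩
  · rintro w hw (hf | hf)
    · exact g₃ w hw hf
    · exact h₃ w hw hf

end Foc

/-- A communication over an internal name. -/
def Sync (A A' : Proc Name) : Prop :=
  ∃ a vs xs P Q, a.Internal ∧ vs.length = xs.length ∧ (∀ v ∈ vs, v ∉ Q.boundNames) ∧
    A = .par (out a vs P) (inp a xs Q) ∧ A' = .par P (Q.subst (ren xs vs))

/-- A new name that avoids `xs` and all names of the receiver can be introduced before or after the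
input is instantiated, with the same result. -/
lemma Sync.stable (c : Name) : Stable Sync c := by
  rintro A A' ⟨a, vs, xs, P, Q, ha, hl, hv, rfl, rfl⟩
  refine ⟨_, (List.finite_toSet xs).union Q.names_finite, ?_⟩
  intro d hd
  simp only [Set.mem_union, not_or] at hd
  refine ⟨ren [c] [.aux d] a, vs.map (ren [c] [.aux d]), xs, P.subst (ren [c] [.aux d]),
    Q.subst (fixOn (ren [c] [.aux d]) xs), ?_, by simpa using hl, ?_, ?_, ?_⟩
  · rw [ren_singleton]
    split_ifs
    · trivial
    · exact ha
  · intro v hv'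
    obtain ⟨w, hw, rfl⟩ := List.mem_map.1 hv'
    rw [Proc.boundNames_subst, ren_singleton]
    split_ifs
    · exact fun hb => hd.2 (Proc.boundNames_subset_names _ hb)
    · exact hv w hw
  · simp only [Proc.subst, Proc.subst_pre, Pre.subst, Pre.bound, fixOn_nil]
  · simp only [Proc.subst]
    rw [Proc.subst_ren_ren hl hv hd.2 hd.1]

/-- Any number of communications over internal names. -/
inductive Reds : Proc Name → Proc Name → Prop
  | refl {P Q} : cl P = cl Q → Reds P Q
  | step {P Q R} : Foc ∅ Sync P Q → Reds Q R → Reds P R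

namespace Reds

variable {P Q R : Proc Name}

lemma trans (h : Reds P Q) (h' : Reds Q R) : Reds P R := by
  induction h with
  | refl e =>
    cases h' with
    | refl e' => exact .refl (e.trans e')
    | step f r => exact .step (f.congr e rfl) r
  | step f _ ih => exact .step f (ih h')

lemma of_foc (h : Foc ∅ Sync P Q) : Reds P Q := .step h (.refl rfl)

lemma nu (h : Reds P Q) {c : Name} (hc : c.Internal) : Reds (.nu c P) (.nu c Q) := by
  induction h with
  | refl e => exact .refl (by rw [cl_nu, cl_nu, e])
  | step f _ ih => exact .step (f.nu hc (Sync.stable c)) ih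

lemma nus (h : Reds P Q) {cs : List Name} (hc : ∀ c ∈ cs, c.Internal) :
    Reds (.nus cs P) (.nus cs Q) := by
  induction cs with
  | nil => exact h
  | cons c cs ih =>
    exact (ih fun d hd => hc d (List.mem_cons_of_mem _ hd)).nu (hc c (by simp))

lemma par (h : Reds P Q) (hR : Normal R) : Reds (.par P R) (.par Q R) := by
  induction h with
  | refl e => exact .refl (by rw [cl_par, cl_par, e])
  | step f _ ih => exact .step (f.par hR (by simp)) ih

end Reds

/-- Internal communications, then the redex, then internal communications. -/
def Ev (W : Set ℕ) (ρ : Redex) (P P' : Proc Name) : Prop :=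
  ∃ P₁ P₂, Reds P P₁ ∧ Foc W ρ P₁ P₂ ∧ Reds P₂ P'

namespace Ev

variable {W : Set ℕ} {ρ ρ' : Redex} {P P' Q Q' R R' : Proc Name}

lemma base (h : ρ P P') : Ev W ρ P P' := ⟨_, _, .refl rfl, .base h, .refl rfl⟩

lemma of_foc (h : Foc W ρ P P') : Ev W ρ P P' := ⟨_, _, .refl rfl, h, .refl rfl⟩

lemma before (h : Ev W ρ P P') (hQ : Reds Q P) : Ev W ρ Q P' := by
  obtain ⟨P₁, P₂, h₁, h₂, h₃⟩ := h
  exact ⟨P₁, P₂, hQ.trans h₁, h₂, h₃⟩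

lemma after (h : Ev W ρ P P') (hQ : Reds P' Q) : Ev W ρ P Q := by
  obtain ⟨P₁, P₂, h₁, h₂, h₃⟩ := h
  exact ⟨P₁, P₂, h₁, h₂, h₃.trans hQ⟩

lemma nu (h : Ev W ρ P P') {c : Name} (hc : c.Internal) (hρ : Stable ρ c) :
    Ev W ρ (.nu c P) (.nu c P') := by
  obtain ⟨P₁, P₂, h₁, h₂, h₃⟩ := h
  exact ⟨_, _, h₁.nu hc, h₂.nu hc hρ, h₃.nu hc⟩

lemma nus (h : Ev W ρ P P') {cs : List Name} (hc : ∀ c ∈ cs, c.Internal ∧ Stable ρ c) :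
    Ev W ρ (.nus cs P) (.nus cs P') := by
  obtain ⟨P₁, P₂, h₁, h₂, h₃⟩ := h
  exact ⟨_, _, h₁.nus fun c h => (hc c h).1, h₂.nus hc, h₃.nus fun c h => (hc c h).1⟩

lemma par (h : Ev W ρ P P') (hR : Normal R) (hW : ∀ w ∈ W, Name.chan w ∉ R.freeNames) :
    Ev W ρ (.par P R) (.par P' R) := by
  obtain ⟨P₁, P₂, h₁, h₂, h₃⟩ := h
  exact ⟨_, _, h₁.par hR, h₂.par hR hW, h₃.par hR⟩

lemma join (h : Ev W ρ P P') (hR : Normal R) (hR' : Normal R')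
    (hρ : ∀ A A', ρ A A' → ρ' (.par A R) (.par A' R')) : Ev W ρ' (.par P R) (.par P' R') := by
  obtain ⟨P₁, P₂, h₁, h₂, h₃⟩ := h
  exact ⟨_, _, h₁.par hR, h₂.join hρ, h₃.par hR'⟩

end Ev

end Go

/-! ### Syntactic properties of the encoding -/

namespace PiB.Proc

variable {N M : Type} (f : N → M)

lemma map_pre (π : Pre N) (P : Proc N) : (pre π P).map f = pre (π.map f) (P.map f) := rfl

@[simp] lemma map_zero : (zero : Proc N).map f = zero := by
  simp only [zero, map]
  congr 1 <;> funext i <;> exact i.elim0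

lemma map_nus (cs : List N) (P : Proc N) : (nus cs P).map f = nus (cs.map f) (P.map f) := by
  induction cs with
  | nil => rfl
  | cons c cs ih => simp only [nus_cons, map, ih, List.map_cons]

lemma map_prod (Ps : List (Proc N)) : (prod Ps).map f = prod (Ps.map (map f)) := by
  induction Ps with
  | nil => simp
  | cons P Ps ih => simp only [prod_cons, map, ih, List.map_cons]

end PiB.Proc

namespace Go

open PiB

/-- Not an auxiliary name; variables and channels only from the given sets. -/
def Allowed (D C : Set ℕ) : Name → Prop
  | .int _ => True
  | .chan ch => ch ∈ C
  | .var x => x ∈ D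
  | .fn _ => True
  | .aux _ => False

lemma Allowed.mono {D C D' C' : Set ℕ} {a : Name} (h : Allowed D C a) (hD : D ⊆ D')
    (hC : C ⊆ C') : Allowed D' C' a := by
  cases a with
  | int n => trivial
  | chan ch => exact hC h
  | var x => exact hD h
  | fn f => trivial
  | aux k => exact h.elim

@[simp] lemma allowed_aux {D C : Set ℕ} {k : ℕ} : Allowed D C (.aux k) ↔ False := Iff.rfl
@[simp] lemma allowed_fn {D C : Set ℕ} {k : ℕ} : Allowed D C (.fn k) ↔ True := Iff.rfl
@[simp] lemma allowed_var {D C : Set ℕ} {k : ℕ} : Allowed D C (.var k) ↔ k ∈ D := Iff.rfl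
@[simp] lemma allowed_chan {D C : Set ℕ} {k : ℕ} : Allowed D C (.chan k) ↔ k ∈ C := Iff.rfl

lemma allowed_name (D : Set ℕ) (v : Val) : Allowed D v.chans v.name := by
  cases v with
  | int n => trivial
  | chan ch => exact rfl

@[simp] lemma Val.name_ne_aux (v : Val) (k : ℕ) : v.name ≠ .aux k := by
  cases v <;> simp [Val.name]

/-! ### The structure of the encoding of lists -/

/-- Not a value. -/
def Exp.Pending (e : Exp) : Prop := ∀ v, e ≠ .val v

/-- The final output of the encoding of a list. -/
def lrResult (es : List Exp) (r : Name) (k : ℕ) : Proc Name :=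
  out r (es.zipIdx.map fun p => match p.1 with
    | .val v => v.name
    | _ => .aux (k + 2 * es.length + p.2)) .zero

/-- The sequential part of the encoding of a list. -/
def lrChain (k n : ℕ) (rest : List (Exp × ℕ)) (Z : Proc Name) : Proc Name :=
  rest.foldr (fun p Q => out (.aux (k + 2 * p.2 + 1)) []
    (inp (.aux (k + 2 * p.2)) [.aux (k + 2 * n + p.2)] Q)) Z

/-- The guarded expressions in the encoding of a list. -/
def lrGuarded (k n : ℕ) (rest : List (Exp × ℕ)) : List (Proc Name) :=
  rest.map fun p => inp (.aux (k + 2 * p.2 + 1)) [] (encExp p.1 (.aux (k + 2 * p.2)) (k + 3 * n))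

/-- The names restricted for the guarded expressions in the encoding of a list. -/
def lrNames (k : ℕ) (rest : List (Exp × ℕ)) : List Name :=
  rest.flatMap fun p => [.aux (k + 2 * p.2 + 1), .aux (k + 2 * p.2)]

/-- The component of the encoding of a list that is parallel to the active expression. -/
def lrCtx (k n i : ℕ) (rest : List (Exp × ℕ)) (Z : Proc Name) : Proc Name :=
  .par (.prod (lrGuarded k n rest))
    (inp (.aux (k + 2 * i)) [.aux (k + 2 * n + i)] (lrChain k n rest Z))

lemma encLR_of_nil {es : List Exp} (h : pending es = []) (r : Name) (k : ℕ) :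
    encLR es r k = lrResult es r k := by
  unfold encLR
  rw [h]
  rfl

lemma encLR_of_cons {es : List Exp} {e : Exp} {i : ℕ} {rest : List (Exp × ℕ)}
    (h : pending es = (e, i) :: rest) (r : Name) (k : ℕ) :
    encLR es r k = .nus (.aux (k + 2 * i) :: lrNames k rest)
      (.par (encExp e (.aux (k + 2 * i)) (k + 3 * es.length))
        (lrCtx k es.length i rest (lrResult es r k))) := by
  unfold encLR
  rw [h]
  rfl

lemma mem_pending {es : List Exp} {p : Exp × ℕ} :
    p ∈ pending es ↔ p ∈ es.zipIdx ∧ p.1.Pending := by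
  unfold pending
  rw [List.mem_filter]
  refine and_congr_right fun _ => ?_
  rcases p with ⟨e, i⟩
  cases e <;> simp [Exp.Pending]

lemma lrChain_cons (k n : ℕ) (p : Exp × ℕ) (rest : List (Exp × ℕ)) (Z : Proc Name) :
    lrChain k n (p :: rest) Z = out (.aux (k + 2 * p.2 + 1)) []
      (inp (.aux (k + 2 * p.2)) [.aux (k + 2 * n + p.2)] (lrChain k n rest Z)) := rfl

lemma lrGuarded_cons (k n : ℕ) (p : Exp × ℕ) (rest : List (Exp × ℕ)) :
    lrGuarded k n (p :: rest) = inp (.aux (k + 2 * p.2 + 1)) []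
      (encExp p.1 (.aux (k + 2 * p.2)) (k + 3 * n)) :: lrGuarded k n rest := rfl

lemma lrNames_cons (k : ℕ) (p : Exp × ℕ) (rest : List (Exp × ℕ)) :
    lrNames k (p :: rest) = .aux (k + 2 * p.2 + 1) :: .aux (k + 2 * p.2) :: lrNames k rest := rfl

lemma mem_lrNames {k : ℕ} {rest : List (Exp × ℕ)} {a : Name} :
    a ∈ lrNames k rest ↔ ∃ p ∈ rest, a = .aux (k + 2 * p.2 + 1) ∨ a = .aux (k + 2 * p.2) := by
  simp [lrNames]

/-- The values received along the chain are bound there, so apart from the names of the protocol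
only the other names of `Z` remain free. -/
lemma mem_freeNames_lrChain {k n : ℕ} {rest : List (Exp × ℕ)} {Z : Proc Name} {a : Name}
    (h : a ∈ (lrChain k n rest Z).freeNames) :
    a ∈ lrNames k rest ∨ (a ∈ Z.freeNames ∧ ∀ p ∈ rest, a ≠ .aux (k + 2 * n + p.2)) := by
  induction rest with
  | nil => exact Or.inr ⟨h, by simp⟩
  | cons p rest ih =>
    rw [lrChain_cons] at h
    rw [lrNames_cons]
    simp only [Proc.mem_freeNames_out, Proc.mem_freeNames_inp, List.not_mem_nil, or_false,
      List.mem_singleton] at h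
    rcases h with h | h | ⟨h, h'⟩
    · simp [h]
    · simp [h]
    · rcases ih h with h | ⟨h, h''⟩
      · exact Or.inl (by simp [h])
      · refine Or.inr ⟨h, fun q hq => ?_⟩
        rcases List.mem_cons.1 hq with rfl | hq
        · exact h'
        · exact h'' q hq

/-! ### Free names of encodings -/

/-- `Allowed` contains no auxiliary name, so all of these except possibly the result name are bound.
This makes their numbering immaterial and allows spent restrictions to be discarded. -/
lemma mem_freeNames_encExp {e : Exp} {r : Name} {k : ℕ} {a : Name}
    (h : a ∈ (encExp e r k).freeNames) : a = r ∨ Allowed e.vars e.chans a := by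
  induction e generalizing r k with
  | var x =>
    simp [encExp] at h
    rcases h.1.1 with ((h' | h' | h') | h')
    · exact Or.inr (by simp [h', Exp.vars])
    · exact absurd h' h.2
    · exact absurd h' h.1.2
    · rcases h' with h' | h'
      · exact absurd h' h.2
      · exact Or.inl (h'.1.resolve_right h'.2)
  | val v =>
    simp [encExp] at h
    rcases h with h | h
    · exact Or.inl h
    · exact Or.inr (h ▸ allowed_name _ v)
  | make t n =>
    cases n with
    | zero =>
      simp [encExp] at h
      exact Or.inl (h.1.resolve_right h.2)
    | succ n =>
      simp [encExp] at h
      exact Or.inl (h.1.resolve_right h.2)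
  | recv e ih =>
    simp [encExp] at h
    rcases h with ⟨h | h | h, h'⟩
    · exact Or.inr ((ih h).resolve_left h')
    · exact absurd h h'
    · rcases h.1 with h₁ | h₁
      · exact absurd h₁ h.2
      · exact Or.inl (h₁.1.resolve_right h₁.2)

/-- Variables of a list of expressions. -/
def varsOf (es : List Exp) : Set ℕ := {x | ∃ e ∈ es, x ∈ e.vars}

/-- Channels of a list of expressions. -/
def chansOf (es : List Exp) : Set ℕ := {x | ∃ e ∈ es, x ∈ e.chans}

lemma mem_freeNames_lrResult {es : List Exp} {r : Name} {k : ℕ} {a : Name}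
    (h : a ∈ (lrResult es r k).freeNames) : a = r ∨ Allowed (varsOf es) (chansOf es) a ∨
      ∃ p ∈ pending es, a = .aux (k + 2 * es.length + p.2) := by
  simp only [lrResult, Proc.mem_freeNames_out, List.mem_map, Proc.mem_freeNames_zero,
    or_false] at h
  rcases h with h | ⟨⟨e, i⟩, hp, h⟩
  · exact Or.inl h
  · have he : e ∈ es := (List.mem_zipIdx' hp).2 ▸ List.getElem_mem _
    by_cases hv : ∃ v, e = .val v
    · obtain ⟨v, rfl⟩ := hv
      refine Or.inr (Or.inl ?_)
      rw [← h]
      exact (allowed_name (varsOf es) v).mono le_rfl fun c hc => ⟨_, he, hc⟩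
    · refine Or.inr (Or.inr ⟨(e, i), mem_pending.2 ⟨hp, fun v hv' => hv ⟨v, hv'⟩⟩, ?_⟩)
      cases e with
      | val v => exact absurd ⟨v, rfl⟩ hv
      | var x => exact h.symm
      | make t n => exact h.symm
      | recv e => exact h.symm

lemma mem_freeNames_lrGuarded {k n : ℕ} {rest : List (Exp × ℕ)} {P : Proc Name} {a : Name}
    (hP : P ∈ lrGuarded k n rest) (h : a ∈ P.freeNames) :
    a ∈ lrNames k rest ∨ ∃ p ∈ rest, Allowed p.1.vars p.1.chans a := by
  obtain ⟨p, hp, rfl⟩ := List.mem_map.1 hP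
  simp only [Proc.mem_freeNames_inp, List.not_mem_nil, not_false_eq_true, and_true] at h
  rcases h with h | h
  · exact Or.inl (mem_lrNames.2 ⟨p, hp, Or.inl h⟩)
  · rcases mem_freeNames_encExp h with h | h
    · exact Or.inl (mem_lrNames.2 ⟨p, hp, Or.inr h⟩)
    · exact Or.inr ⟨p, hp, h⟩

lemma mem_freeNames_lrCtx {k i : ℕ} {es : List Exp} {e : Exp} {rest : List (Exp × ℕ)}
    (hp : pending es = (e, i) :: rest) {r a : Name}
    (h : a ∈ (lrCtx k es.length i rest (lrResult es r k)).freeNames) :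
    a = .aux (k + 2 * i) ∨ a ∈ lrNames k rest ∨ a = r ∨ Allowed (varsOf es) (chansOf es) a := by
  have hmem : ∀ p ∈ rest, p.1 ∈ es := fun p hpr =>
    (List.mem_zipIdx' (mem_pending.1 (hp ▸ List.mem_cons_of_mem _ hpr)).1).2 ▸
      List.getElem_mem _
  simp only [lrCtx, Proc.mem_freeNames_par, Proc.mem_freeNames_prod, Proc.mem_freeNames_inp,
    List.mem_singleton] at h
  rcases h with ⟨P, hP, h⟩ | h | ⟨h, hne⟩
  · rcases mem_freeNames_lrGuarded hP h with h | ⟨p, hpr, h⟩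
    · exact Or.inr (Or.inl h)
    · exact Or.inr (Or.inr (Or.inr (h.mono (fun x hx => ⟨_, hmem p hpr, hx⟩)
        fun x hx => ⟨_, hmem p hpr, hx⟩)))
  · exact Or.inl h
  · rcases mem_freeNames_lrChain h with h | ⟨h, h'⟩
    · exact Or.inr (Or.inl h)
    · rcases mem_freeNames_lrResult h with h | h | ⟨p, hpp, h⟩
      · exact Or.inr (Or.inr (Or.inl h))
      · exact Or.inr (Or.inr (Or.inr h))
      · rw [hp] at hpp
        rcases List.mem_cons.1 hpp with rfl | hpp
        · exact absurd h hne
        · exact absurd h (h' p hpp)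

lemma mem_freeNames_encLR {es : List Exp} {r : Name} {k : ℕ} {a : Name}
    (h : a ∈ (encLR es r k).freeNames) : a = r ∨ Allowed (varsOf es) (chansOf es) a := by
  cases hp : pending es with
  | nil =>
    rw [encLR_of_nil hp] at h
    rcases mem_freeNames_lrResult h with h | h | ⟨p, hpp, h⟩
    · exact Or.inl h
    · exact Or.inr h
    · simp [hp] at hpp
  | cons p rest =>
    obtain ⟨e, i⟩ := p
    rw [encLR_of_cons hp] at h
    simp only [Proc.mem_freeNames_nus, Proc.mem_freeNames_par, List.mem_cons, not_or] at h
    have he : e ∈ es :=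
      (List.mem_zipIdx' (mem_pending.1 (hp ▸ List.mem_cons_self : (e, i) ∈ pending es)).1).2 ▸
        List.getElem_mem _
    rcases h with ⟨h | h, h₁, h₂⟩
    · exact Or.inr (((mem_freeNames_encExp h).resolve_left h₁).mono (fun x hx => ⟨_, he, hx⟩)
        fun x hx => ⟨_, he, hx⟩)
    · exact ((mem_freeNames_lrCtx hp h).resolve_left h₁).resolve_left h₂

lemma mem_freeNames_encAssign {x : ℕ} {E : Name → ℕ → Proc Name} {r a : Name} {k : ℕ}
    (h : a ∈ (encAssign x E r k).freeNames) :
    a = r ∨ a = .var x ∨ (a ∈ (E (.aux k) (k + 1)).freeNames ∧ a ≠ .aux k) := by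
  simp only [encAssign, Proc.mem_freeNames_nu, Proc.mem_freeNames_par, Proc.mem_freeNames_inp,
    Proc.mem_freeNames_out, Proc.mem_freeNames_zero, List.mem_cons, List.not_mem_nil] at h
  tauto

lemma mem_freeNames_encSeq {S₁ S₂ : Name → ℕ → Proc Name} {r a : Name} {k : ℕ}
    (h : a ∈ (encSeq S₁ S₂ r k).freeNames) :
    (a ∈ (S₁ (.aux k) (k + 1)).freeNames ∧ a ≠ .aux k) ∨ a ∈ (S₂ r (k + 1)).freeNames := by
  simp only [encSeq, Proc.mem_freeNames_nu, Proc.mem_freeNames_par, Proc.mem_freeNames_inp] at h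
  tauto

lemma length_flatMap_take_add_le {α : Type} (g : α → List Exp) (l : List α) (i : ℕ) (hi : i < l.length) :
    ((l.take i).flatMap g).length + (g l[i]).length ≤ (l.flatMap g).length := by
  conv_rhs => rw [← List.take_append_drop i l, List.flatMap_append, List.length_append,
    List.drop_eq_getElem_cons hi, List.flatMap_cons, List.length_append]
  omega

/-- Ensures that the operand names used by a clause lie in the range bound by the input in front of
the choice. -/
lemma offset_add_le {n : ℕ} (c : Fin n → Comm) (i : Fin n) :
    offset c i + (c i).operands.length ≤ (operandList c).length := by
  have := length_flatMap_take_add_le Comm.operands (List.ofFn c) i (by simp)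
  simpa [offset, operandList] using this

lemma mem_freeNames_encStm {s : Stm} {r : Name} {k : ℕ} {a : Name}
    (h : a ∈ (encStm s r k).freeNames) : a = r ∨ Allowed s.vars s.chans a := by
  induction s generalizing r k with
  | nil =>
    simp [encStm] at h
    exact Or.inl h
  | assign x e =>
    rcases mem_freeNames_encAssign h with h | h | ⟨h, h'⟩
    · exact Or.inl h
    · exact Or.inr (by simp [h, Stm.vars])
    · exact Or.inr (((mem_freeNames_encExp h).resolve_left h').mono
        (fun y hy => Or.inr hy) le_rfl)
  | send e₁ e₂ =>
    simp only [encStm, Proc.mem_freeNames_nu, Proc.mem_freeNames_par, Proc.mem_freeNames_inp,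
      Proc.mem_freeNames_out, Proc.mem_freeNames_zero, List.mem_cons, List.not_mem_nil] at h
    rcases h with ⟨h | h, h'⟩
    · refine Or.inr (((mem_freeNames_encLR h).resolve_left h').mono ?_ ?_)
      · rintro y ⟨e, he, hy⟩
        simp only [List.mem_cons, List.not_mem_nil, or_false] at he
        rcases he with rfl | rfl
        · exact Or.inl hy
        · exact Or.inr hy
      · rintro y ⟨e, he, hy⟩
        simp only [List.mem_cons, List.not_mem_nil, or_false] at he
        rcases he with rfl | rfl
        · exact Or.inl hy
        · exact Or.inr hy
    · left; tauto
  | seq s₁ s₂ ih₁ ih₂ =>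
    rcases mem_freeNames_encSeq h with ⟨h, h'⟩ | h
    · exact Or.inr (((ih₁ h).resolve_left h').mono (fun y hy => Or.inl hy) fun y hy => Or.inl hy)
    · exact (ih₂ h).imp_right fun h => h.mono (fun y hy => Or.inr hy) fun y hy => Or.inr hy
  | go f es =>
    simp only [encStm, Proc.mem_freeNames_nu, Proc.mem_freeNames_par, Proc.mem_freeNames_inp,
      Proc.mem_freeNames_out, Proc.mem_freeNames_zero, List.not_mem_nil] at h
    rcases h with ⟨h | h, h'⟩
    · exact Or.inr ((mem_freeNames_encLR h).resolve_left h')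
    · rcases h with h | ⟨(h | h) | h, h''⟩
      · exact absurd h h'
      · exact Or.inr (by simp [h])
      · exact absurd h h''
      · left; tauto
  | select n c s ih =>
    simp only [encStm, Proc.mem_freeNames_nu, Proc.mem_freeNames_par, Proc.mem_freeNames_inp,
      Proc.mem_freeNames_sum] at h
    have hv : ∀ i, (c i).vars ⊆ (Stm.select n c s).vars := fun i x hx =>
      Set.mem_iUnion.2 ⟨i, Or.inl hx⟩
    have hsv : ∀ i, (s i).vars ⊆ (Stm.select n c s).vars := fun i x hx =>
      Set.mem_iUnion.2 ⟨i, Or.inr hx⟩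
    have hsc : ∀ i, (s i).chans ⊆ (Stm.select n c s).chans := fun i x hx =>
      Set.mem_iUnion.2 ⟨i, Or.inr hx⟩
    have hcc : ∀ i, (c i).chans ⊆ (Stm.select n c s).chans := fun i x hx =>
      Set.mem_iUnion.2 ⟨i, Or.inl hx⟩
    rcases h with ⟨h | h | ⟨⟨i, h⟩, hy⟩, h'⟩
    · refine Or.inr (((mem_freeNames_encLR h).resolve_left h').mono ?_ ?_)
      · rintro y ⟨e, he, hy⟩
        simp only [operandList, List.mem_flatMap, List.mem_ofFn] at he
        obtain ⟨_, ⟨i, rfl⟩, he⟩ := he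
        refine hv i ?_
        cases hci : c i with
        | recv x e' =>
          simp only [hci, Comm.operands, List.mem_singleton] at he
          exact Or.inr (he ▸ hy)
        | send e₁ e₂ =>
          simp only [hci, Comm.operands, List.mem_cons, List.not_mem_nil, or_false] at he
          rcases he with rfl | rfl
          · exact Or.inl hy
          · exact Or.inr hy
      · rintro y ⟨e, he, hy⟩
        simp only [operandList, List.mem_flatMap, List.mem_ofFn] at he
        obtain ⟨_, ⟨i, rfl⟩, he⟩ := he
        refine hcc i ?_
        cases hci : c i with
        | recv x e' =>
          simp only [hci, Comm.operands, List.mem_singleton] at he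
          exact he ▸ hy
        | send e₁ e₂ =>
          simp only [hci, Comm.operands, List.mem_cons, List.not_mem_nil, or_false] at he
          rcases he with rfl | rfl
          · exact Or.inl hy
          · exact Or.inr hy
    · exact absurd h h'
    · have hoff := offset_add_le c i
      cases hci : c i with
      | recv x e' =>
        simp only [hci, Pre.used, Pre.bound, Set.mem_singleton_iff, List.mem_singleton] at h
        simp only [hci, Comm.operands, List.length_singleton] at hoff
        rcases h with h | ⟨h, h''⟩
        · exact absurd (List.mem_map.2 ⟨offset c i, List.mem_range.2 (by omega), h.symm⟩) hy
        · rcases mem_freeNames_encSeq h with ⟨h, h₁⟩ | h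
          · rcases mem_freeNames_encAssign h with h | h | ⟨h, h₂⟩
            · exact absurd h h₁
            · exact Or.inr (h ▸ hv i (by simp [hci, Comm.vars]))
            · simp at h
              tauto
          · exact (ih i h).imp_right fun h => h.mono (hsv i) (hsc i)
      | send e₁ e₂ =>
        simp only [hci, Pre.used, Pre.bound, Set.mem_ofPred_eq, List.mem_singleton,
          List.not_mem_nil, not_false_eq_true, and_true] at h
        simp only [hci, Comm.operands, List.length_cons, List.length_nil] at hoff
        rcases h with (h | h) | h
        · exact absurd (List.mem_map.2 ⟨offset c i, List.mem_range.2 (by omega), h.symm⟩) hy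
        · exact absurd (List.mem_map.2 ⟨offset c i + 1, List.mem_range.2 (by omega), h.symm⟩) hy
        · exact (ih i h).imp_right fun h => h.mono (hsv i) (hsc i)

end Go

namespace Go

open PiB

/-! ### Encodings are well-formed -/

@[simp] lemma wf_encExp (e : Exp) (r : Name) (k : ℕ) : WF (encExp e r k) := by
  induction e generalizing r k with
  | var x => simp [encExp]
  | val v => simp [encExp]
  | make t n => cases n <;> simp [encExp]
  | recv e ih => simp [encExp, ih]

lemma wf_lrChain {k n : ℕ} {rest : List (Exp × ℕ)} {Z : Proc Name} (hZ : WF Z) :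
    WF (lrChain k n rest Z) := by
  induction rest with
  | nil => exact hZ
  | cons p rest ih => rw [lrChain_cons]; simp [ih]

lemma internal_of_mem_lrNames {k : ℕ} {rest : List (Exp × ℕ)} {a : Name}
    (h : a ∈ lrNames k rest) : a.Internal := by
  obtain ⟨p, -, rfl | rfl⟩ := mem_lrNames.1 h <;> trivial

@[simp] lemma wf_encLR (es : List Exp) (r : Name) (k : ℕ) : WF (encLR es r k) := by
  have hR : WF (lrResult es r k) := by simp [lrResult]
  cases hp : pending es with
  | nil => rwa [encLR_of_nil hp]
  | cons p rest =>
    obtain ⟨e, i⟩ := p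
    rw [encLR_of_cons hp]
    simp only [wf_nus, wf_par, wf_encExp, lrCtx, wf_prod, wf_inp, true_and]
    refine ⟨?_, ?_, by simp, by simp, wf_lrChain hR⟩
    · intro c hc
      rcases List.mem_cons.1 hc with rfl | hc
      · trivial
      · exact internal_of_mem_lrNames hc
    · intro P hP
      obtain ⟨q, -, rfl⟩ := List.mem_map.1 hP
      simp

lemma wf_encAssign {x : ℕ} {E : Name → ℕ → Proc Name} {r : Name} {k : ℕ}
    (hE : WF (E (.aux k) (k + 1))) : WF (encAssign x E r k) := by
  simp [encAssign, hE]

lemma wf_encSeq {S₁ S₂ : Name → ℕ → Proc Name} {r : Name} {k : ℕ}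
    (h₁ : WF (S₁ (.aux k) (k + 1))) (h₂ : WF (S₂ r (k + 1))) : WF (encSeq S₁ S₂ r k) := by
  simp [encSeq, h₁, h₂]

lemma nodup_auxs (k n : ℕ) : ((List.range n).map fun j => Name.aux (k + j)).Nodup :=
  List.Nodup.map (fun a b h => by simpa using h) List.nodup_range

@[simp] lemma wf_encStm (s : Stm) (r : Name) (k : ℕ) : WF (encStm s r k) := by
  induction s generalizing r k with
  | nil => simp [encStm]
  | assign x e => exact wf_encAssign (by simp)
  | send e₁ e₂ => simp [encStm]
  | seq s₁ s₂ ih₁ ih₂ => exact wf_encSeq (ih₁ _ _) (ih₂ _ _)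
  | go f es =>
    simp only [encStm, wf_nu, wf_par, wf_encLR, wf_inp, wf_out, wf_zero, true_and, and_true]
    exact ⟨trivial, nodup_auxs _ _, by simp⟩
  | select n c s ih =>
    simp only [encStm, wf_nu, wf_par, wf_encLR, wf_inp, true_and]
    refine ⟨trivial, nodup_auxs _ _, by simp, fun i => ?_⟩
    cases hci : c i with
    | recv x e => simpa [hci, Pre.bound] using wf_encSeq (wf_encAssign (by simp)) (ih i _ _)
    | send e₁ e₂ => simpa [hci, Pre.bound] using ih i _ _

lemma wf_encVar (x v : Name) (k : ℕ) : WF (encVar x v k) := by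
  simp [encVar]

/-! ### Encodings are normal -/

@[simp] lemma normal_encExp (e : Exp) (r : Name) (k : ℕ) : Normal (encExp e r k) := by
  induction e generalizing r k with
  | var x => simp [encExp]
  | val v => simp [encExp]
  | make t n => cases n <;> simp [encExp]
  | recv e ih => simp [encExp, ih]

@[simp] lemma normal_lrCtx (k n i : ℕ) (rest : List (Exp × ℕ)) (Z : Proc Name) :
    Normal (lrCtx k n i rest Z) := by
  simp only [lrCtx, normal_par, normal_prod, normal_pre, and_true]
  intro P hP
  obtain ⟨q, -, rfl⟩ := List.mem_map.1 hP
  simp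

@[simp] lemma normal_encLR (es : List Exp) (r : Name) (k : ℕ) : Normal (encLR es r k) := by
  cases hp : pending es with
  | nil => rw [encLR_of_nil hp]; simp [lrResult]
  | cons p rest =>
    obtain ⟨e, i⟩ := p
    rw [encLR_of_cons hp]
    simp only [normal_nus, normal_par, normal_encExp, normal_lrCtx, and_true]
    intro c hc
    rcases List.mem_cons.1 hc with rfl | hc
    · trivial
    · exact internal_of_mem_lrNames hc

@[simp] lemma normal_encStm (s : Stm) (r : Name) (k : ℕ) : Normal (encStm s r k) := by
  induction s generalizing r k with
  | nil => simp [encStm]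
  | assign x e => simp [encStm, encAssign]
  | send e₁ e₂ => simp [encStm]
  | seq s₁ s₂ ih₁ ih₂ => simp [encStm, encSeq, ih₁]
  | go f es => simp [encStm]
  | select n c s ih => simp [encStm]

@[simp] lemma normal_encVar (x v : Name) (k : ℕ) : Normal (encVar x v k) := by
  simp [encVar]

@[simp] lemma normal_encStore (σ : Store) : Normal (encStore σ) := by
  simp only [encStore, normal_prod, List.mem_map]
  rintro P ⟨p, -, rfl⟩
  simp

@[simp] lemma normal_encRoutine (p : Stm × Store) : Normal (encRoutine p) := by
  simp only [encRoutine, normal_nus, normal_par, normal_nu, normal_encStm, normal_encStore,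
    List.mem_map, and_true]
  refine ⟨?_, trivial⟩
  rintro c ⟨q, -, rfl⟩
  trivial

@[simp] lemma normal_encFunEnv (δf : FunEnv) : Normal (encFunEnv δf) := by
  simp only [encFunEnv, normal_prod, List.mem_map]
  rintro P ⟨p, -, rfl⟩
  simp [encFun]

/-! ### Independence of the choice of bound names -/

/-- `f` shifts the auxiliary names from `k` on by `d` and fixes all names that are not
auxiliary. -/
structure ShiftFrom (f : Name → Name) (k d : ℕ) : Prop where
  aux : ∀ j, k ≤ j → f (.aux j) = .aux (j + d)
  int : ∀ n, f (.int n) = .int n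
  chan : ∀ n, f (.chan n) = .chan n
  var : ∀ n, f (.var n) = .var n
  fn : ∀ n, f (.fn n) = .fn n

namespace ShiftFrom

variable {f : Name → Name} {k d : ℕ}

lemma mono (h : ShiftFrom f k d) {k' : ℕ} (hk : k ≤ k') : ShiftFrom f k' d :=
  ⟨fun j hj => h.aux j (hk.trans hj), h.int, h.chan, h.var, h.fn⟩

lemma name (h : ShiftFrom f k d) (v : Val) : f v.name = v.name := by
  cases v with
  | int n => exact h.int n
  | chan c => exact h.chan c

lemma aux' (h : ShiftFrom f k d) {j j' : ℕ} (hj : k ≤ j) (e : j + d = j') :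
    f (.aux j) = .aux j' := by
  rw [h.aux j hj, e]

lemma map_auxs (h : ShiftFrom f k d) {m : ℕ} (hm : k ≤ m) (n : ℕ) :
    ((List.range n).map fun j => Name.aux (m + j)).map f =
      (List.range n).map fun j => Name.aux (m + d + j) := by
  rw [List.map_map]
  exact List.map_congr_left fun j _ => h.aux' (by omega) (by omega)

lemma encVar (h : ShiftFrom f k d) (x : ℕ) (v : Val) :
    (encVar (.var x) v.name k).map f = Go.encVar (.var x) v.name (k + d) := by
  simp only [Go.encVar, Proc.map, Proc.map_pre, Pre.map, List.map_cons, List.map_nil,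
    Proc.map_zero, h.var, h.name]
  simp only [h.aux' le_rfl rfl, h.aux' (j := k + 1) (j' := k + d + 1) (by omega) (by omega),
    h.aux' (j := k + 2) (j' := k + d + 2) (by omega) (by omega),
    h.aux' (j := k + 3) (j' := k + d + 3) (by omega) (by omega),
    h.aux' (j := k + 4) (j' := k + d + 4) (by omega) (by omega)]

/-- Each bound name is `aux (k + c)` with an offset `c` that does not depend on `k`, so shifting
commutes with the encoding. Subexpressions are numbered from a larger index, where the assumption on
`f` is weaker. -/
lemma encExp (h : ShiftFrom f k d) (e : Exp) (r : Name) :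
    (encExp e r k).map f = Go.encExp e (f r) (k + d) := by
  induction e generalizing r k with
  | var x =>
    simp only [Go.encExp, Proc.map, Proc.map_pre, Pre.map, List.map_cons, List.map_nil,
      Proc.map_zero, h.var]
    simp only [h.aux' le_rfl rfl, h.aux' (j := k + 1) (j' := k + d + 1) (by omega) (by omega),
      h.aux' (j := k + 2) (j' := k + d + 2) (by omega) (by omega)]
  | val v =>
    simp only [Go.encExp, Proc.map_pre, Pre.map, List.map_cons, List.map_nil,
      Proc.map_zero, h.name]
  | make t n =>
    cases n <;>
    simp only [Go.encExp, Proc.map, Proc.map_pre, Pre.map, List.map_cons, List.map_nil,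
      Proc.map_zero, h.aux' le_rfl rfl]
  | recv e ih =>
    simp only [Go.encExp, Proc.map, Proc.map_pre, Pre.map, List.map_cons, List.map_nil,
      Proc.map_zero, ih (h.mono (Nat.le_succ k))]
    simp only [h.aux' le_rfl rfl, h.aux' (j := k + 1) (j' := k + d + 1) (by omega) (by omega),
      h.aux' (j := k + 2) (j' := k + d + 2) (by omega) (by omega),
      Nat.add_right_comm k 1 d]

lemma lrChain (h : ShiftFrom f k d) (n : ℕ) (rest : List (Exp × ℕ)) (Z : Proc Name) :
    (lrChain k n rest Z).map f = Go.lrChain (k + d) n rest (Z.map f) := by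
  induction rest with
  | nil => rfl
  | cons p rest ih =>
    simp only [lrChain_cons, Proc.map_pre, Pre.map, ih, List.map_cons, List.map_nil]
    rw [h.aux' (j := k + 2 * p.2 + 1) (j' := k + d + 2 * p.2 + 1) (by omega) (by omega),
      h.aux' (j := k + 2 * p.2) (j' := k + d + 2 * p.2) (by omega) (by omega),
      h.aux' (j := k + 2 * n + p.2) (j' := k + d + 2 * n + p.2) (by omega) (by omega)]

lemma lrResult (h : ShiftFrom f k d) (es : List Exp) (r : Name) :
    (lrResult es r k).map f = Go.lrResult es (f r) (k + d) := by
  simp only [Go.lrResult, Proc.map_pre, Pre.map, Proc.map_zero, List.map_map]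
  congr 2
  refine List.map_congr_left fun p _ => ?_
  have := h.aux' (j := k + 2 * es.length + p.2) (j' := k + d + 2 * es.length + p.2)
    (by omega) (by omega)
  rcases p with ⟨e, i⟩
  cases e with
  | val v => exact h.name v
  | var x => exact this
  | make t n => exact this
  | recv e => exact this

lemma lrNames (h : ShiftFrom f k d) (rest : List (Exp × ℕ)) :
    (lrNames k rest).map f = Go.lrNames (k + d) rest := by
  induction rest with
  | nil => rfl
  | cons p rest ih =>
    rw [lrNames_cons, lrNames_cons, List.map_cons, List.map_cons, ih,
      h.aux' (j := k + 2 * p.2 + 1) (j' := k + d + 2 * p.2 + 1) (by omega) (by omega),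
      h.aux' (j := k + 2 * p.2) (j' := k + d + 2 * p.2) (by omega) (by omega)]

lemma encLR (h : ShiftFrom f k d) (es : List Exp) (r : Name) :
    (encLR es r k).map f = Go.encLR es (f r) (k + d) := by
  cases hp : pending es with
  | nil => rw [encLR_of_nil hp, encLR_of_nil hp, h.lrResult]
  | cons p rest =>
    obtain ⟨e, i⟩ := p
    have h3 : k + d + 3 * es.length = k + 3 * es.length + d := by omega
    rw [encLR_of_cons hp, encLR_of_cons hp, Proc.map_nus, List.map_cons, h.lrNames,
      h.aux' (j := k + 2 * i) (j' := k + d + 2 * i) (by omega) (by omega)]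
    simp only [Proc.map, lrCtx, Proc.map_pre, Pre.map, List.map_cons, List.map_nil, h.lrChain,
      h.lrResult, (h.mono (Nat.le_add_right k (3 * es.length))).encExp, Proc.map_prod, h3]
    rw [h.aux' (j := k + 2 * i) (j' := k + d + 2 * i) (by omega) (by omega),
      h.aux' (j := k + 2 * es.length + i) (j' := k + d + 2 * es.length + i) (by omega) (by omega)]
    congr 4
    simp only [lrGuarded, List.map_map]
    refine List.map_congr_left fun p _ => ?_
    simp only [Function.comp_apply, Proc.map_pre, Pre.map, List.map_nil,
      (h.mono (Nat.le_add_right k (3 * es.length))).encExp]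
    rw [h.aux' (j := k + 2 * p.2 + 1) (j' := k + d + 2 * p.2 + 1) (by omega) (by omega),
      h.aux' (j := k + 2 * p.2) (j' := k + d + 2 * p.2) (by omega) (by omega), h3]

lemma encAssign (h : ShiftFrom f k d) {x : ℕ} {E E' : Name → ℕ → Proc Name}
    (hE : (E (.aux k) (k + 1)).map f = E' (.aux (k + d)) (k + d + 1)) (r : Name) :
    (encAssign x E r k).map f = Go.encAssign x E' (f r) (k + d) := by
  simp only [Go.encAssign, Proc.map, Proc.map_pre, Pre.map, List.map_cons, List.map_nil,
    Proc.map_zero, h.var, hE]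
  simp only [h.aux' le_rfl rfl, h.aux' (j := k + 1) (j' := k + d + 1) (by omega) (by omega),
    h.aux' (j := k + 2) (j' := k + d + 2) (by omega) (by omega),
    h.aux' (j := k + 3) (j' := k + d + 3) (by omega) (by omega)]

lemma encSeq (h : ShiftFrom f k d) {S₁ S₂ S₁' S₂' : Name → ℕ → Proc Name} {r : Name}
    (h₁ : (S₁ (.aux k) (k + 1)).map f = S₁' (.aux (k + d)) (k + d + 1))
    (h₂ : (S₂ r (k + 1)).map f = S₂' (f r) (k + d + 1)) :
    (encSeq S₁ S₂ r k).map f = Go.encSeq S₁' S₂' (f r) (k + d) := by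
  simp only [Go.encSeq, Proc.map, Proc.map_pre, Pre.map, List.map_nil, h₁, h₂, h.aux' le_rfl rfl]

lemma encStm (h : ShiftFrom f k d) (s : Stm) (r : Name) :
    (encStm s r k).map f = Go.encStm s (f r) (k + d) := by
  induction s generalizing r k with
  | nil => simp [Go.encStm, Proc.map_pre, Pre.map]
  | assign x e =>
    refine h.encAssign ?_ r
    rw [(h.mono (Nat.le_succ k)).encExp, h.aux' le_rfl rfl, Nat.add_right_comm]
  | send e₁ e₂ =>
    simp only [Go.encStm, Proc.map, Proc.map_pre, Pre.map, List.map_cons, List.map_nil,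
      Proc.map_zero, (h.mono (Nat.le_succ k)).encLR]
    simp only [h.aux' le_rfl rfl, h.aux' (j := k + 1) (j' := k + d + 1) (by omega) (by omega),
      h.aux' (j := k + 2) (j' := k + d + 2) (by omega) (by omega), Nat.add_right_comm k 1 d]
  | seq s₁ s₂ ih₁ ih₂ =>
    refine h.encSeq ?_ ?_
    · rw [ih₁ (h.mono (Nat.le_succ k)), h.aux' le_rfl rfl, Nat.add_right_comm]
    · rw [ih₂ (h.mono (Nat.le_succ k)), Nat.add_right_comm]
  | go g es =>
    simp only [Go.encStm, Proc.map, Proc.map_pre, Pre.map, List.map_nil, h.fn,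
      Proc.map_zero, (h.mono (Nat.le_succ k)).encLR, h.map_auxs (Nat.le_succ k)]
    simp only [h.aux' le_rfl rfl, Nat.add_right_comm k 1 d]
  | select n c s ih =>
    simp only [Go.encStm, Proc.map, Proc.map_pre, Pre.map,
      (h.mono (Nat.le_succ k)).encLR, h.map_auxs (Nat.le_succ k)]
    simp only [h.aux' le_rfl rfl, Nat.add_right_comm k 1 d]
    congr 4
    · funext i
      have hoff := offset_add_le c i
      cases hci : c i with
      | recv x e =>
        simp only [List.map_cons, List.map_nil]
        rw [h.aux' (j := k + 1 + offset c i) (j' := k + d + 1 + offset c i) (by omega) (by omega),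
          h.aux' (j := k + 1 + (operandList c).length)
            (j' := k + d + 1 + (operandList c).length) (by omega) (by omega)]
      | send e₁ e₂ =>
        simp only [List.map_cons, List.map_nil]
        rw [h.aux' (j := k + 1 + offset c i) (j' := k + d + 1 + offset c i) (by omega) (by omega),
          h.aux' (j := k + 1 + (offset c i + 1))
            (j' := k + d + 1 + (offset c i + 1)) (by omega) (by omega)]
    · funext i
      have hk : k + d + 2 + (operandList c).length = k + 2 + (operandList c).length + d := by omega
      have h' := h.mono (k' := k + 2 + (operandList c).length) (by omega)
      cases hci : c i with
      | recv x e =>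
        simp only [hk]
        refine h'.encSeq ?_ ?_
        · have hA := (h'.mono (Nat.le_add_right _ 1)).encAssign (x := x)
            (E := fun r _ => out r [.aux (k + 1 + (operandList c).length)] .zero)
            (E' := fun r _ => out r [.aux (k + d + 1 + (operandList c).length)] .zero) (by
              simp only [Proc.map_pre, Pre.map, List.map_cons, List.map_nil, Proc.map_zero]
              rw [h.aux' (j := k + 1 + (operandList c).length)
                (j' := k + d + 1 + (operandList c).length) (by omega) (by omega),
                h'.aux (k + 2 + (operandList c).length + 1) (by omega)])
            (.aux (k + 2 + (operandList c).length))
          rw [hA, h'.aux' le_rfl rfl, Nat.add_right_comm _ 1 d]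
        · rw [ih i (h'.mono (Nat.le_add_right _ 1)), Nat.add_right_comm _ 1 d]
      | send e₁ e₂ =>
        simp only [hk]
        exact ih i h' r

end ShiftFrom

/-- Shifts the auxiliary names from `k` on by `d`. -/
def shift (k d : ℕ) : Name → Name
  | .aux j => if k ≤ j then .aux (j + d) else .aux j
  | a => a

lemma shiftFrom_shift (k d : ℕ) : ShiftFrom (shift k d) k d :=
  ⟨fun j hj => by simp [shift, hj], fun _ => rfl, fun _ => rfl, fun _ => rfl, fun _ => rfl⟩

lemma shift_internal (k d : ℕ) (a : Name) (h : a.Internal) : (shift k d a).Internal := by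
  cases a with
  | aux j => simp only [shift]; split_ifs <;> trivial
  | int n => exact h
  | chan n => exact h
  | var n => exact h
  | fn n => exact h

lemma shift_injective (k d : ℕ) : Function.Injective (shift k d) := by
  intro a b h
  cases a with
  | aux i =>
    cases b with
    | aux j =>
      simp only [shift] at h
      split_ifs at h <;> simp only [Name.aux.injEq] at h ⊢ <;> omega
    | int n => simp only [shift] at h; split_ifs at h
    | chan n => simp only [shift] at h; split_ifs at h
    | var n => simp only [shift] at h; split_ifs at h
    | fn n => simp only [shift] at h; split_ifs at h
  | int n => cases b <;> simp only [shift] at h ⊢ <;> first | exact h | split_ifs at h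
  | chan n => cases b <;> simp only [shift] at h ⊢ <;> first | exact h | split_ifs at h
  | var n => cases b <;> simp only [shift] at h ⊢ <;> first | exact h | split_ifs at h
  | fn n => cases b <;> simp only [shift] at h ⊢ <;> first | exact h | split_ifs at h

lemma shift_eq_self {k d : ℕ} {a : Name} (h : ∀ j, a = .aux j → j < k) : shift k d a = a := by
  cases a with
  | aux j =>
    have := h j rfl
    simp only [shift]
    rw [if_neg (by omega)]
  | int n => rfl
  | chan n => rfl
  | var n => rfl
  | fn n => rfl

lemma cl_map_shift {P : Proc Name} {k d : ℕ} (hP : WF P)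
    (h : ∀ j, Name.aux j ∈ P.freeNames → j < k) : cl (P.map (shift k d)) = cl P :=
  cl_map hP (shift_internal k d) (shift_injective k d).injOn fun _ ha =>
    shift_eq_self fun j e => h j (e ▸ ha)

/-- The name `r` is not among the auxiliary names from `k` on. -/
def Below (k : ℕ) (r : Name) : Prop := ∀ j, r = .aux j → j < k

lemma below_aux {k j : ℕ} (h : j < k) : Below k (.aux j) := by
  rintro i e
  simp only [Name.aux.injEq] at e
  omega

lemma Below.ne {k j : ℕ} {r : Name} (h : Below k r) (hj : k ≤ j) : r ≠ .aux j := by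
  rintro rfl
  have := h j rfl
  omega

/-- The only auxiliary name that can be free is the result name, and `Below k r` keeps it under the
range that is shifted. -/
lemma cl_encStm_add (s : Stm) {r : Name} {k : ℕ} (hr : Below k r) (d : ℕ) :
    cl (encStm s r (k + d)) = cl (encStm s r k) := by
  have := cl_map_shift (P := encStm s r k) (k := k) (d := d) (by simp) (by
    intro j hj
    rcases mem_freeNames_encStm hj with h | h
    · exact hr j h.symm
    · exact h.elim)
  rwa [(shiftFrom_shift k d).encStm, shift_eq_self hr] at this

lemma cl_encStm (s : Stm) {r : Name} {k k' : ℕ} (hr : Below k r) (hk : k ≤ k') :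
    cl (encStm s r k') = cl (encStm s r k) := by
  obtain ⟨d, rfl⟩ := Nat.exists_eq_add_of_le hk
  exact cl_encStm_add s hr d

/-- With the result name bound as well, no auxiliary name is free and everything can be shifted from
0. This identifies the body of a function, numbered after the formal parameters, with the statement
of a routine. -/
lemma cl_nu_encStm (s : Stm) (k : ℕ) :
    cl (.nu (.aux k) (encStm s (.aux k) (k + 1))) = cl (.nu (.aux 0) (encStm s (.aux 0) 1)) := by
  have h := shiftFrom_shift 0 k
  have := cl_map_shift (P := .nu (.aux 0) (encStm s (.aux 0) 1)) (k := 0) (d := k) (by simp) (by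
    rintro j ⟨hj, hj'⟩
    rcases mem_freeNames_encStm hj with h | h
    · exact absurd h hj'
    · exact h.elim)
  rwa [Proc.map, (h.mono (Nat.zero_le 1)).encStm, h.aux' (j' := k) le_rfl (by omega),
    Nat.add_comm 1 k] at this

lemma mem_freeNames_encVar {x v a : Name} {k : ℕ} (h : a ∈ (encVar x v k).freeNames) :
    a = x ∨ a = v := by
  simp only [encVar, Proc.mem_freeNames_nu, Proc.mem_freeNames_par, Proc.mem_freeNames_inp,
    Proc.mem_freeNames_repl, Proc.mem_freeNames_out, Proc.mem_freeNames_zero, List.mem_cons,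
    List.not_mem_nil] at h
  tauto

lemma cl_encVar (x : ℕ) (v : Val) (k : ℕ) :
    cl (encVar (.var x) v.name k) = cl (encVar (.var x) v.name 0) := by
  have h := shiftFrom_shift 0 k
  have := cl_map_shift (P := encVar (.var x) v.name 0) (k := 0) (d := k) (wf_encVar _ _ _) (by
    intro j hj
    rcases mem_freeNames_encVar hj with h | h
    · simp at h
    · exact absurd h.symm (by simp))
  rwa [h.encVar, Nat.zero_add] at this

end Go

/-! ### Elementary steps and their redexes -/

namespace Go

open PiB

/-- The kinds of elementary steps of a Go-routine. -/
inductive Kind : Type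
  | read (x : ℕ) (v : Val)
  | write (x : ℕ) (v : Val)
  | make (n ch : ℕ)
  | recv (ch : ℕ) (v : Val)
  | send (ch : ℕ) (v : Val)
  | go (f : ℕ) (vs : List Val)

/-- A request to store the value `v` in the variable `x`. -/
def writeRequest (x : ℕ) (v r : Name) (k : ℕ) : Proc Name :=
  .nu (.aux k) (.nu (.aux (k + 1))
    (out (.var x) [.aux k, .aux (k + 1)] (out (.aux (k + 1)) [v] (out r [] .zero))))

namespace Kind

/-- The redexes for an elementary step, and their residuals. -/
def redex : Kind → Redex
  | .read x v => fun A A' => ∃ r k, r.Internal ∧ r ≠ .aux k ∧ r ≠ .aux (k + 1) ∧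
      r ≠ .aux (k + 2) ∧ A = encExp (.var x) r k ∧ A' = out r [v.name] .zero
  | .write x v => fun A A' => ∃ r k, r.Internal ∧ r ≠ .aux k ∧ r ≠ .aux (k + 1) ∧
      A = writeRequest x v.name r k ∧ A' = out r [] .zero
  | .make n ch => fun A A' => ∃ r k t, r.Internal ∧ r ≠ .aux k ∧
      A = encExp (.make t n) r k ∧ A' = out r [.chan ch] .zero
  | .recv ch v => fun A A' => ∃ n π P, ∃ j : Fin n, ∃ z, A = .sum n π P ∧
      π j = .inp (.chan ch) [z] ∧ v.name ∉ (P j).boundNames ∧ Normal (P j) ∧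
      A' = (P j).subst (ren [z] [v.name])
  | .send ch v => fun A A' => ∃ n π P, ∃ j : Fin n, A = .sum n π P ∧
      π j = .out (.chan ch) [v.name] ∧ Normal (P j) ∧ A' = P j
  | .go f vs => fun A A' => A = out (.fn f) (vs.map Val.name) A'

/-- The step does not use the internal name `c`. -/
def Avoids (c : Name) : Kind → Prop
  | .read x _ => c ≠ .var x
  | .write x _ => c ≠ .var x
  | .go f _ => c ≠ .fn f
  | _ => True

@[simp] lemma avoids_aux (κ : Kind) (k : ℕ) : κ.Avoids (.aux k) := by
  cases κ <;> simp [Avoids]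

lemma subst_encExp_var {σ : Name → Name} {x k : ℕ} {r : Name} (hx : σ (.var x) = .var x)
    (h₀ : r ≠ .aux k) (h₁ : r ≠ .aux (k + 1)) (h₂ : r ≠ .aux (k + 2)) :
    (encExp (.var x) r k).subst σ = encExp (.var x) (σ r) k := by
  simp [encExp, Proc.subst, Proc.subst_pre, Pre.subst, Pre.bound, fixOn, h₀, h₁, h₂, hx]

lemma subst_writeRequest {σ : Name → Name} {x k : ℕ} {v r : Name} (hx : σ (.var x) = .var x)
    (hv : σ v = v) (h₀ : r ≠ .aux k) (h₁ : r ≠ .aux (k + 1)) :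
    (writeRequest x v r k).subst σ = writeRequest x v (σ r) k := by
  simp [writeRequest, Proc.subst, Proc.subst_pre, Pre.subst, Pre.bound, fixOn, h₀, h₁, hx, hv]

lemma subst_encExp_make {σ : Name → Name} {t : Ty} {n k : ℕ} {r : Name} (h₀ : r ≠ .aux k) :
    (encExp (.make t n) r k).subst σ = encExp (.make t n) (σ r) k := by
  cases n <;>
  simp [encExp, Proc.subst, Proc.subst_pre, Pre.subst, Pre.bound, fixOn, h₀]

lemma ren_of_not_internal {c d a : Name} (hc : c.Internal) (ha : ¬ a.Internal) :
    ren [c] [d] a = a := by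
  rw [ren_singleton, if_neg]
  rintro rfl
  exact ha hc

lemma internal_ren {c : Name} {d : ℕ} {a : Name} (ha : a.Internal) :
    (ren [c] [.aux d] a).Internal := by
  rw [ren_singleton]
  split_ifs
  · trivial
  · exact ha

/-- The names that fix the kind of a redex are values and channels, which are not internal, and the
variables and functions excluded by `Avoids`. What the renaming can touch is the reply name, the
continuation and the other summands, about which a redex says little; the fresh name must only miss
the binders involved. -/
lemma stable (κ : Kind) {c : Name} (hc : c.Internal) (hκ : κ.Avoids c) : Stable κ.redex c := by
  have hne : ∀ {r b : Name} {d : ℕ}, r ≠ b → Name.aux d ≠ b → ren [c] [.aux d] r ≠ b := by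
    intro r b d h h'
    rw [ren_singleton]
    split_ifs
    · exact h'
    · exact h
  cases κ with
  | read x v =>
    rintro A A' ⟨r, k, hr, h₀, h₁, h₂, rfl, rfl⟩
    refine ⟨{.aux k, .aux (k + 1), .aux (k + 2)}, Set.toFinite _, fun d hd => ?_⟩
    simp only [Set.mem_insert_iff, Set.mem_singleton_iff, not_or] at hd
    refine ⟨ren [c] [.aux d] r, k, internal_ren hr, hne h₀ hd.1, hne h₁ hd.2.1, hne h₂ hd.2.2,
      ?_, ?_⟩
    · exact subst_encExp_var (ren_of_notMem (by simpa using Ne.symm hκ)) h₀ h₁ h₂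
    · simp only [Proc.subst_pre, Pre.subst, List.map_cons, List.map_nil, Proc.subst_zero,
        ren_of_not_internal hc v.not_internal_name]
  | write x v =>
    rintro A A' ⟨r, k, hr, h₀, h₁, rfl, rfl⟩
    refine ⟨{.aux k, .aux (k + 1)}, Set.toFinite _, fun d hd => ?_⟩
    simp only [Set.mem_insert_iff, Set.mem_singleton_iff, not_or] at hd
    refine ⟨ren [c] [.aux d] r, k, internal_ren hr, hne h₀ hd.1, hne h₁ hd.2, ?_, ?_⟩
    · exact subst_writeRequest (ren_of_notMem (by simpa using Ne.symm hκ))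
        (ren_of_not_internal hc v.not_internal_name) h₀ h₁
    · simp only [Proc.subst_pre, Pre.subst, List.map_nil, Proc.subst_zero]
  | make n ch =>
    rintro A A' ⟨r, k, t, hr, h₀, rfl, rfl⟩
    refine ⟨{.aux k}, Set.toFinite _, fun d hd => ?_⟩
    simp only [Set.mem_singleton_iff] at hd
    refine ⟨ren [c] [.aux d] r, k, t, internal_ren hr, hne h₀ hd, subst_encExp_make h₀, ?_⟩
    simp only [Proc.subst_pre, Pre.subst, List.map_cons, List.map_nil, Proc.subst_zero,
      ren_of_not_internal hc (a := .chan ch) (by simp)]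
  | recv ch v =>
    rintro A A' ⟨n, π, P, j, z, rfl, hπ, hv, hP, rfl⟩
    refine ⟨_, (Set.finite_singleton z).union (P j).names_finite, fun d hd => ?_⟩
    simp only [Set.mem_union, Set.mem_singleton_iff, not_or] at hd
    refine ⟨n, _, _, j, z, rfl, ?_, ?_, hP.subst _, ?_⟩
    · simp only [hπ, Pre.subst, ren_of_not_internal hc (a := .chan ch) (by simp)]
    · rwa [Proc.boundNames_subst]
    · have := Proc.subst_ren_ren (Q := P j) (xs := [z]) (vs := [v.name]) (c := c) (d := .aux d)
        rfl (by simpa using hv) hd.2 (by simpa using hd.1)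
      simpa only [hπ, Pre.bound, List.map_cons, List.map_nil,
        ren_of_not_internal hc v.not_internal_name] using this
  | send ch v =>
    rintro A A' ⟨n, π, P, j, rfl, hπ, hP, rfl⟩
    refine ⟨∅, Set.finite_empty, fun d _ => ⟨n, _, _, j, rfl, ?_, hP.subst _, ?_⟩⟩
    · simp only [hπ, Pre.subst, ren_of_not_internal hc (a := .chan ch) (by simp), List.map_cons,
        List.map_nil, ren_of_not_internal hc v.not_internal_name]
    · simp [hπ, Pre.bound]
  | go f vs =>
    rintro A A' h
    obtain rfl : A = _ := h
    refine ⟨∅, Set.finite_empty, fun d _ => ?_⟩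
    simp only [redex, Proc.subst_pre, Pre.subst, Pre.bound, fixOn_nil]
    rw [ren_of_notMem (by simpa using Ne.symm hκ), List.map_map]
    congr 2
    exact List.map_congr_left fun v _ => ren_of_not_internal hc v.not_internal_name

/-- The effect of an elementary step on the local store, the label and the channel store. -/
def Effect (σ : Store) (δ : ChanStore) (α : LAct) (σ' : Store) (δ' : ChanStore) : Kind → Prop
  | .read x v => σ.lookup x = some v ∧ α = .tau ∧ σ' = σ ∧ δ' = δ
  | .write x v => α = .tau ∧ σ' = σ.insert x v ∧ δ' = δ
  | .make n ch => ch ∉ δ ∧ α = .tau ∧ σ' = σ ∧ δ' = δ.insert ch (n, [], false)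
  | .recv ch v => σ' = σ ∧
      ((∃ g, δ.lookup ch = some (0, [], g) ∧ α = .r ch v ∧ δ' = δ) ∨
        ∃ n l g, δ.lookup ch = some (n + 1, v :: l, g) ∧ α = .tau ∧
          δ' = δ.insert ch (n + 1, l, g))
  | .send ch v => σ' = σ ∧
      ((∃ g, δ.lookup ch = some (0, [], g) ∧ α = .s ch v ∧ δ' = δ) ∨
        ∃ n l g, δ.lookup ch = some (n + 1, l, g) ∧ l.length < n + 1 ∧ α = .tau ∧
          δ' = δ.insert ch (n + 1, l ++ [v], g))
  | .go f vs => α = .g f vs ∧ σ' = σ ∧ δ' = δ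

/-- The step reads or writes a variable. -/
def Accesses : Kind → Prop
  | .read _ _ => True
  | .write _ _ => True
  | _ => False

end Kind

/-! ### Administrative communications -/

lemma Reds.comm {a : Name} {vs xs : List Name} {P Q : Proc Name} (ha : a.Internal)
    (hl : vs.length = xs.length) (hv : ∀ v ∈ vs, v ∉ Q.boundNames) :
    Reds (.par (out a vs P) (inp a xs Q)) (.par P (Q.subst (ren xs vs))) :=
  .of_foc (.base ⟨a, vs, xs, P, Q, ha, hl, hv, rfl, rfl⟩)

lemma Reds.congr {P P' Q Q' : Proc Name} (h : Reds P Q) (e : cl P' = cl P) (e' : cl Q' = cl Q) :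
    Reds P' Q' :=
  (Reds.refl e).trans (h.trans (.refl e'.symm))

/-- Substituting values introduces no internal name. Hence the private name along which values were
passed can be dropped afterwards. -/
lemma not_mem_freeNames_subst_ren {a : Name} (ha : a.Internal) {xs : List Name} {vs : List Val}
    (hl : vs.length = xs.length) {Q : Proc Name} (hQ : a ∉ Q.freeNames) :
    a ∉ (Q.subst (ren xs (vs.map Val.name))).freeNames := by
  intro h
  obtain ⟨b, hb, e⟩ := Proc.exists_of_mem_freeNames_subst h
  by_cases hx : b ∈ xs
  · have := ren_mem (ds := vs.map Val.name) (by simpa using hl) hx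
    rw [e] at this
    obtain ⟨v, -, rfl⟩ := List.mem_map.1 this
    exact v.not_internal_name ha
  · rw [ren_of_notMem hx] at e
    exact hQ (e ▸ hb)

/-- Values are passed on along a private name. -/
lemma Reds.pass {a : Name} {vs : List Val} {xs : List Name} {Q : Proc Name} (ha : a.Internal)
    (hl : vs.length = xs.length) (hwf : WF Q) (hQ : a ∉ Q.freeNames) :
    Reds (.nu a (.par (out a (vs.map Val.name) .zero) (inp a xs Q)))
      (Q.subst (ren xs (vs.map Val.name))) := by
  have hv : ∀ v ∈ vs.map Val.name, v ∉ Q.boundNames := by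
    intro v hv hb
    obtain ⟨w, -, rfl⟩ := List.mem_map.1 hv
    exact w.not_internal_name (hwf.internal_of_mem_boundNames hb)
  refine ((Reds.comm ha (by simpa using hl) hv).nu ha).trans (.refl ?_)
  rw [cl_nu, cl_par, cl_zero, one_mul,
    nu_cl_of_notMem ha (not_mem_freeNames_subst_ren ha hl hQ)]

/-! ### Expressions -/

lemma EStep.pending {σ : Store} {e e' : Exp} {δ δ' : ChanStore} {α : LAct}
    (h : EStep σ e δ α e' δ') : e.Pending := by
  intro v hv
  subst hv
  cases h

lemma reds_recv (ch : ℕ) {r : Name} {k : ℕ} (hr : Below k r) :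
    Reds (encExp (.recv (.val (.chan ch))) r k)
      (inp (.chan ch) [.aux (k + 2)] (out r [.aux (k + 2)] .zero)) := by
  have h := Reds.pass (a := .aux k) (vs := [.chan ch]) (xs := [.aux (k + 1)])
    (Q := inp (.aux (k + 1)) [.aux (k + 2)] (out r [.aux (k + 2)] .zero)) trivial rfl (by simp)
    (by simp [(hr.ne le_rfl).symm])
  refine h.trans (.refl ?_)
  simp [Proc.subst_pre, Pre.subst, Pre.bound, fixOn, Val.name, hr.ne (Nat.le_succ k),
    (hr.ne (Nat.le_add_right k 2))]

lemma redex_recv {W : Set ℕ} (ch : ℕ) (v : Val) {r : Name} {z : ℕ} (hr : r ≠ .aux z) :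
    Ev W (Kind.recv ch v).redex (inp (.chan ch) [.aux z] (out r [.aux z] .zero))
      (out r [v.name] .zero) := by
  refine .base ⟨1, _, _, 0, .aux z, rfl, rfl, by simp, normal_pre, ?_⟩
  simp [Proc.subst_pre, Pre.subst, Pre.bound, hr]

/-- The kind of a step of an expression, and the corresponding behaviour of its encoding. -/
lemma EStep.exists_kind {σ : Store} {e e' : Exp} {δ δ' : ChanStore} {α : LAct}
    (h : EStep σ e δ α e' δ') :
    ∃ κ : Kind, κ.Effect σ δ α σ δ' ∧ (κ.Accesses → e.ReadsNext) ∧ (∀ x v, κ ≠ .write x v) ∧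
      ∀ W r k, Name.Internal r → Below k r →
        Ev W κ.redex (encExp e r k) (encExp e' r k) := by
  induction h with
  | @var x v δ hx =>
    refine ⟨.read x v, ⟨hx, rfl, rfl, rfl⟩, fun _ => trivial, by simp, fun W r k hi hr => ?_⟩
    exact .base ⟨r, k, hi, hr.ne le_rfl, hr.ne (by omega), hr.ne (by omega), rfl, rfl⟩
  | @mak t n ch δ hch =>
    refine ⟨.make n ch, ⟨hch, rfl, rfl, rfl⟩, fun h => h.elim, by simp, fun W r k hi hr => ?_⟩
    exact .base ⟨r, k, t, hi, hr.ne le_rfl, rfl, rfl⟩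
  | @rvE e e' δ δ' α h ih =>
    obtain ⟨κ, h₁, h₂, h₃, h₄⟩ := ih
    refine ⟨κ, h₁, h₂, h₃, fun W r k hi hr => ?_⟩
    -- The waiting receiver has only internal free names, so no channel of `W` occurs in it.
    refine ((h₄ W (.aux k) (k + 1) trivial (below_aux (by omega))).par ?_ ?_).nu trivial
      (κ.stable trivial (by simp))
    · simp
    · intro w _ hw
      simp only [Proc.mem_freeNames_inp, Proc.mem_freeNames_out, Proc.mem_freeNames_zero,
        List.mem_singleton, reduceCtorEq, or_false, false_or] at hw
      rw [← hw.1.1] at hi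
      exact hi
  | @rvU ch v g δ hch =>
    refine ⟨.recv ch v, ⟨rfl, Or.inl ⟨g, hch, rfl, rfl⟩⟩, fun h => h.elim, by simp,
      fun W r k hi hr => ?_⟩
    exact (redex_recv ch v (hr.ne (by omega))).before (reds_recv ch hr)
  | @rvB ch n v l g δ hch hn =>
    obtain ⟨m, rfl⟩ := Nat.exists_eq_succ_of_ne_zero hn.ne'
    refine ⟨.recv ch v, ⟨rfl, Or.inr ⟨m, l, g, hch, rfl, rfl⟩⟩, fun h => h.elim, by simp,
      fun W r k hi hr => ?_⟩
    exact (redex_recv ch v (hr.ne (by omega))).before (reds_recv ch hr)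

end Go

namespace Go

open PiB

/-! ### Lists of expressions -/

/-- The non-values of a list, with their positions counted from `m`. -/
def pendingFrom (m : ℕ) (es : List Exp) : List (Exp × ℕ) :=
  (es.zipIdx m).filter fun p => match p.1 with
    | .val _ => false
    | _ => true

lemma mem_pendingFrom {m : ℕ} {es : List Exp} {p : Exp × ℕ} (h : p ∈ pendingFrom m es) :
    m ≤ p.2 ∧ p.2 < m + es.length := by
  have := List.mem_zipIdx (List.mem_filter.1 h).1
  omega

lemma pendingFrom_vals (m : ℕ) (vs : List Val) : pendingFrom m (vs.map Exp.val) = [] := by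
  unfold pendingFrom
  rw [List.filter_eq_nil_iff]
  rintro ⟨e, i⟩ h
  obtain ⟨-, -, he⟩ := List.mem_zipIdx h
  simp only [List.getElem_map] at he
  simp [he]

lemma pendingFrom_append (m : ℕ) (es es' : List Exp) :
    pendingFrom m (es ++ es') = pendingFrom m es ++ pendingFrom (m + es.length) es' := by
  unfold pendingFrom
  rw [List.zipIdx_append, List.filter_append]

lemma pendingFrom_cons_val (m : ℕ) (v : Val) (es : List Exp) :
    pendingFrom m (.val v :: es) = pendingFrom (m + 1) es := by
  simp [pendingFrom]

lemma pendingFrom_cons (m : ℕ) {e : Exp} (he : e.Pending) (es : List Exp) :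
    pendingFrom m (e :: es) = (e, m) :: pendingFrom (m + 1) es := by
  cases e with
  | val v => exact absurd rfl (he v)
  | var x => simp [pendingFrom]
  | make t n => simp [pendingFrom]
  | recv e => simp [pendingFrom]

lemma pending_eq (es : List Exp) : pending es = pendingFrom 0 es := rfl

lemma pending_split {e : Exp} (he : e.Pending) (vs : List Val) (es : List Exp) :
    pending (vs.map Exp.val ++ e :: es) = (e, vs.length) :: pendingFrom (vs.length + 1) es := by
  rw [pending_eq, pendingFrom_append, pendingFrom_vals, List.nil_append, pendingFrom_cons _ he]
  simp

lemma pending_split_val (v : Val) (vs : List Val) (es : List Exp) :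
    pending (vs.map Exp.val ++ .val v :: es) = pendingFrom (vs.length + 1) es := by
  rw [pending_eq, pendingFrom_append, pendingFrom_vals, List.nil_append, pendingFrom_cons_val]
  simp

/-- The name that stands for an expression in the result of the encoding of a list. -/
def slot (m : ℕ) (p : Exp × ℕ) : Name :=
  match p.1 with
  | .val v => v.name
  | _ => .aux (m + p.2)

lemma slot_pending {m i : ℕ} {e : Exp} (he : e.Pending) : slot m (e, i) = .aux (m + i) := by
  cases e with
  | val v => exact absurd rfl (he v)
  | var x => rfl
  | make t n => rfl
  | recv e => rfl

lemma lrResult_eq (es : List Exp) (r : Name) (k : ℕ) :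
    lrResult es r k = out r (es.zipIdx.map (slot (k + 2 * es.length))) .zero := rfl

lemma zipIdx_split (vs : List Val) (e : Exp) (es : List Exp) :
    (vs.map Exp.val ++ e :: es).zipIdx =
      (vs.map Exp.val).zipIdx ++ (e, vs.length) :: es.zipIdx (vs.length + 1) := by
  rw [List.zipIdx_append, List.zipIdx_cons]
  simp

/-- A pending expression enters the final output only through its position. -/
lemma lrResult_pending {e e' : Exp} (he : e.Pending) (he' : e'.Pending) (vs : List Val)
    (es : List Exp) (r : Name) (k : ℕ) :
    lrResult (vs.map Exp.val ++ e :: es) r k = lrResult (vs.map Exp.val ++ e' :: es) r k := by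
  rw [lrResult_eq, lrResult_eq, zipIdx_split, zipIdx_split]
  simp [slot_pending he, slot_pending he']

/-- The received value fills the slot at position `vs.length`. Earlier slots are values already, and
later ones are values or auxiliary names with a larger index. -/
lemma lrResult_subst {e : Exp} (he : e.Pending) (v : Val) (vs : List Val)
    (es : List Exp) {r : Name} {k : ℕ} (hr : Below k r) :
    (lrResult (vs.map Exp.val ++ e :: es) r k).subst
      (ren [.aux (k + 2 * (vs.map Exp.val ++ e :: es).length + vs.length)] [v.name]) =
    lrResult (vs.map Exp.val ++ .val v :: es) r k := by
  have hlen : (vs.map Exp.val ++ .val v :: es).length = (vs.map Exp.val ++ e :: es).length := by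
    simp
  rw [lrResult_eq, lrResult_eq, hlen]
  generalize hm : k + 2 * (vs.map Exp.val ++ e :: es).length = m
  have hrm : r ≠ .aux (m + vs.length) := hr.ne (by omega)
  simp only [Proc.subst_pre, Pre.subst, Proc.subst_zero, zipIdx_split, List.map_append,
    List.map_cons, slot_pending he, List.map_map]
  rw [ren_of_notMem (by simpa using hrm)]
  congr 2
  congr 1
  · refine List.map_congr_left fun p hp => ?_
    obtain ⟨e₁, i⟩ := p
    obtain ⟨-, -, h⟩ := List.mem_zipIdx hp
    simp only [List.getElem_map] at h
    obtain ⟨w, rfl⟩ : ∃ w, e₁ = .val w := ⟨_, h⟩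
    simp [slot]
  · congr 1
    · simp [slot]
    · refine List.map_congr_left fun p hp => ?_
      obtain ⟨e₁, i⟩ := p
      obtain ⟨hi, -, -⟩ := List.mem_zipIdx hp
      rw [Function.comp_apply, ren_of_notMem]
      rw [List.mem_singleton]
      cases e₁ with
      | val w => simp [slot]
      | var x => simp only [slot, Name.aux.injEq]; omega
      | make t n => simp only [slot, Name.aux.injEq]; omega
      | recv e => simp only [slot, Name.aux.injEq]; omega

/-- The name of a received value is used only at the very end, in `Z`. Its index `k + 2 * n + i` is
larger than those of all protocol names, because positions are below `n`. -/
lemma lrChain_subst {k n i : ℕ} {rest : List (Exp × ℕ)}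
    (h : ∀ p ∈ rest, p.2 < n ∧ p.2 ≠ i) (v : Name) (Z : Proc Name) :
    (lrChain k n rest Z).subst (ren [.aux (k + 2 * n + i)] [v]) =
      lrChain k n rest (Z.subst (ren [.aux (k + 2 * n + i)] [v])) := by
  induction rest with
  | nil => rfl
  | cons p rest ih =>
    have hp := h p (by simp)
    rw [lrChain_cons, lrChain_cons, ← ih fun q hq => h q (List.mem_cons_of_mem _ hq)]
    simp only [Proc.subst_pre, Pre.subst, Pre.bound, List.map_nil, fixOn_nil]
    rw [ren_of_notMem (a := Name.aux (k + 2 * p.2 + 1)), ren_of_notMem (a := Name.aux (k + 2 * p.2)),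
      fixOn_eq_self]
    · intro x hx
      rw [List.mem_singleton] at hx
      subst hx
      refine ren_of_notMem ?_
      simp only [List.mem_singleton, Name.aux.injEq]
      omega
    · simp only [List.mem_singleton, Name.aux.injEq]
      omega
    · simp only [List.mem_singleton, Name.aux.injEq]
      omega

lemma encLR_vals (vs : List Val) (r : Name) (k : ℕ) :
    encLR (vs.map Exp.val) r k = out r (vs.map Val.name) .zero := by
  have h : ∀ m, (vs.map Exp.val).zipIdx.map (slot m) = vs.map Val.name := fun m =>
    List.ext_getElem (by simp) fun i h₁ h₂ => by simp [slot]
  rw [encLR_of_nil (by rw [pending_eq, pendingFrom_vals]), lrResult_eq, h]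

/-- When the active expression of a list has returned a value, the next one is started. -/
lemma reds_lr_advance {e : Exp} (he : e.Pending) (v : Val) (vs : List Val) (es : List Exp)
    {r : Name} {k : ℕ} (hr : Below k r) :
    Reds (.nus (.aux (k + 2 * vs.length) :: lrNames k (pendingFrom (vs.length + 1) es))
        (.par (out (.aux (k + 2 * vs.length)) [v.name] .zero)
          (lrCtx k (vs.map Exp.val ++ e :: es).length vs.length (pendingFrom (vs.length + 1) es)
            (lrResult (vs.map Exp.val ++ e :: es) r k))))
      (encLR (vs.map Exp.val ++ .val v :: es) r k) := by
  have hpend := pending_split_val v vs es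
  have hlen : (vs.map Exp.val ++ .val v :: es).length = (vs.map Exp.val ++ e :: es).length := by
    simp
  have hrest : ∀ p ∈ pendingFrom (vs.length + 1) es,
      p.2 < (vs.map Exp.val ++ e :: es).length ∧ p.2 ≠ vs.length := by
    intro p hp
    have := mem_pendingFrom hp
    simp only [List.length_append, List.length_map, List.length_cons]
    omega
  have hsub := lrResult_subst he v vs es hr
  generalize (vs.map Exp.val ++ e :: es).length = n at *
  have hwf : WF (lrResult (vs.map Exp.val ++ e :: es) r k) := by simp [lrResult]
  generalize lrResult (vs.map Exp.val ++ e :: es) r k = Z at *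
  generalize pendingFrom (vs.length + 1) es = rest at *
  have hint : ∀ c ∈ Name.aux (k + 2 * vs.length) :: lrNames k rest, c.Internal := by
    intro c hc
    rcases List.mem_cons.1 hc with rfl | hc
    · trivial
    · exact internal_of_mem_lrNames hc
  have h₁ : Reds (.par (out (.aux (k + 2 * vs.length)) [v.name] .zero)
      (inp (.aux (k + 2 * vs.length)) [.aux (k + 2 * n + vs.length)] (lrChain k n rest Z)))
      (.par .zero (lrChain k n rest (lrResult (vs.map Exp.val ++ .val v :: es) r k))) := by
    have := Reds.comm (a := Name.aux (k + 2 * vs.length)) (vs := [v.name])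
      (xs := [.aux (k + 2 * n + vs.length)]) (P := .zero) (Q := lrChain k n rest Z) trivial rfl
      (by
        intro w hw hb
        rw [List.mem_singleton] at hw
        exact v.not_internal_name (hw ▸ (wf_lrChain hwf).internal_of_mem_boundNames hb))
    rwa [lrChain_subst hrest, hsub] at this
  have hG : Normal (.prod (lrGuarded k n rest)) := by
    rw [normal_prod]
    intro P hP
    obtain ⟨q, -, rfl⟩ := List.mem_map.1 hP
    simp
  have h₂ := (h₁.par hG).nus hint
  refine (Reds.congr h₂ (by simp only [cl_nus, lrCtx, cl_par]; congr 1; ac_rfl) rfl).trans ?_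
  -- No auxiliary name from `k` on is free in the target, so restrictions of names whose
  -- communication is over may be added to it or removed from it.
  have hfn : ∀ j, Name.aux j ∉ (encLR (vs.map Exp.val ++ .val v :: es) r k).freeNames ∨
      j < k := by
    intro j
    by_contra! h
    rcases mem_freeNames_encLR h.1 with h' | h'
    · exact hr.ne h.2 h'.symm
    · exact h'.elim
  cases rest with
  | nil =>
    refine .refl ?_
    rw [← encLR_of_nil hpend]
    simp only [lrNames, lrChain, lrGuarded, List.foldr_nil, List.flatMap_nil, List.map_nil,
      Proc.nus_cons, Proc.nus_nil, Proc.prod_nil, cl_nu, cl_par, cl_zero, one_mul, mul_one]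
    exact nu_cl_of_notMem (Name.internal_aux _) ((hfn _).resolve_right (by omega))
  | cons p rest =>
    obtain ⟨e₂, i₂⟩ := p
    -- The chain now begins with the trigger of the next pending expression, which removes the guard
    -- in front of it.
    have h₃ : Reds (.par
        (out (.aux (k + 2 * i₂ + 1)) [] (inp (.aux (k + 2 * i₂)) [.aux (k + 2 * n + i₂)]
          (lrChain k n rest (lrResult (vs.map Exp.val ++ .val v :: es) r k))))
        (inp (.aux (k + 2 * i₂ + 1)) [] (encExp e₂ (.aux (k + 2 * i₂)) (k + 3 * n))))
        (.par (inp (.aux (k + 2 * i₂)) [.aux (k + 2 * n + i₂)]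
          (lrChain k n rest (lrResult (vs.map Exp.val ++ .val v :: es) r k)))
          (encExp e₂ (.aux (k + 2 * i₂)) (k + 3 * n))) := by
      have := Reds.comm (a := .aux (k + 2 * i₂ + 1)) (vs := []) (xs := [])
        (P := inp (.aux (k + 2 * i₂)) [.aux (k + 2 * n + i₂)]
          (lrChain k n rest (lrResult (vs.map Exp.val ++ .val v :: es) r k)))
        (Q := encExp e₂ (.aux (k + 2 * i₂)) (k + 3 * n)) trivial rfl (by simp)
      rwa [Proc.subst_eq_self (σ := ren [] []) fun a _ => ren_nil_left _ _] at this
    have hG' : Normal (.prod (lrGuarded k n rest)) := by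
      rw [lrGuarded_cons, Proc.prod_cons, normal_par] at hG
      exact hG.2
    refine ((h₃.par hG').nus hint).congr ?_ ?_
    · simp only [cl_nus, lrChain_cons, lrGuarded_cons, Proc.prod_cons, cl_par, cl_zero, one_mul]
      congr 1
      ac_rfl
    · have e₁ := encLR_of_cons hpend r k
      rw [hlen] at e₁
      -- The two names used up by these communications reappear on the side of the target as vacuous
      -- restrictions.
      have e₂ := nus_cl_of_notMem (P := encLR (vs.map Exp.val ++ .val v :: es) r k)
        (cs := [.aux (k + 2 * vs.length), .aux (k + 2 * i₂ + 1)]) (by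
          intro c hc
          simp only [List.mem_cons, List.not_mem_nil, or_false] at hc
          rcases hc with rfl | rfl
          · exact ⟨trivial, (hfn _).resolve_right (by omega)⟩
          · exact ⟨trivial, (hfn _).resolve_right (by omega)⟩)
      rw [← e₂, e₁, cl_nus, ← PClass.nus_append, cl_nus, lrNames_cons]
      simp only [lrCtx, cl_par, List.cons_append, List.nil_append]
      congr 1
      ac_rfl

/-- If the active expression remains pending, the encoding of the list keeps its shape and the step
takes place in context. If it becomes a value, `reds_lr_advance` adds the communications that start
the next expression. -/
lemma Ev.encLR {W : Set ℕ} {κ : Kind} {e e' : Exp} (he : e.Pending) (vs : List Val)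
    (es : List Exp) {r : Name} {k : ℕ} (hi : r.Internal) (hr : Below k r)
    (h : ∀ r k, Name.Internal r → Below k r → Ev W κ.redex (encExp e r k) (encExp e' r k))
    (hW : ∀ w ∈ W, w ∉ chansOf (vs.map Exp.val ++ e :: es)) :
    Ev W κ.redex (encLR (vs.map Exp.val ++ e :: es) r k)
      (Go.encLR (vs.map Exp.val ++ e' :: es) r k) := by
  have hp := pending_split he vs es
  have hint : ∀ c ∈ Name.aux (k + 2 * vs.length) :: lrNames k (pendingFrom (vs.length + 1) es),
      c.Internal ∧ Stable κ.redex c := by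
    intro c hc
    have : ∃ j, c = .aux j := by
      rcases List.mem_cons.1 hc with rfl | hc
      · exact ⟨_, rfl⟩
      · obtain ⟨p, -, rfl | rfl⟩ := mem_lrNames.1 hc
        · exact ⟨_, rfl⟩
        · exact ⟨_, rfl⟩
    obtain ⟨j, rfl⟩ := this
    exact ⟨trivial, κ.stable trivial (by simp)⟩
  have hev := ((h (.aux (k + 2 * vs.length)) (k + 3 * (vs.map Exp.val ++ e :: es).length) trivial
    (below_aux (by simp only [List.length_append, List.length_map, List.length_cons]; omega))).par
    (R := lrCtx k (vs.map Exp.val ++ e :: es).length vs.length (pendingFrom (vs.length + 1) es)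
      (lrResult (vs.map Exp.val ++ e :: es) r k)) (by simp) (by
      intro w hw hf
      rcases mem_freeNames_lrCtx hp hf with h | h | h | h
      · simp at h
      · obtain ⟨p, -, h | h⟩ := mem_lrNames.1 h <;> simp at h
      · exact absurd (h ▸ hi) (by simp)
      · exact hW w hw h)).nus hint
  rw [encLR_of_cons hp]
  by_cases hv : ∃ v, e' = .val v
  · obtain ⟨v, rfl⟩ := hv
    exact hev.after (reds_lr_advance he v vs es hr)
  · have he' : e'.Pending := fun v h => hv ⟨v, h⟩
    have hlen : (vs.map Exp.val ++ e' :: es).length = (vs.map Exp.val ++ e :: es).length := by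
      simp
    rw [encLR_of_cons (pending_split he' vs es), hlen, lrResult_pending he' he]
    exact hev

end Go

namespace Go

open PiB

/-! ### Select statements -/

/-- The prefixes of the encoding of a select statement. -/
def selPre {n : ℕ} (c : Fin n → Comm) (k : ℕ) (i : Fin n) : Pre Name :=
  match c i with
  | .recv _ _ => .inp (.aux (k + 1 + offset c i)) [.aux (k + 1 + (operandList c).length)]
  | .send _ _ => .out (.aux (k + 1 + offset c i)) [.aux (k + 1 + (offset c i + 1))]

/-- The continuations of the encoding of a select statement. -/
def selCont {n : ℕ} (c : Fin n → Comm) (s : Fin n → Stm) (r : Name) (k : ℕ) (i : Fin n) :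
    Proc Name :=
  match c i with
  | .recv x _ => encSeq (encAssign x fun r _ =>
      out r [.aux (k + 1 + (operandList c).length)] .zero) (encStm (s i)) r
      (k + 2 + (operandList c).length)
  | .send _ _ => encStm (s i) r (k + 2 + (operandList c).length)

lemma encStm_select {n : ℕ} (c : Fin n → Comm) (s : Fin n → Stm) (r : Name) (k : ℕ) :
    encStm (.select n c s) r k = .nu (.aux k) (.par (encLR (operandList c) (.aux k) (k + 1))
      (inp (.aux k) ((List.range (operandList c).length).map fun j => .aux (k + 1 + j))
        (.sum n (selPre c k) (selCont c s r k)))) := by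
  rw [encStm]
  rfl

lemma normal_selCont {n : ℕ} (c : Fin n → Comm) (s : Fin n → Stm) (r : Name) (k : ℕ) (i : Fin n) :
    Normal (selCont c s r k i) := by
  unfold selCont
  split <;> simp [encSeq, encAssign]

lemma operandList_split {n : ℕ} (c : Fin n → Comm) (i : Fin n) :
    operandList c = ((List.ofFn c).take i).flatMap Comm.operands ++
      ((c i).operands ++ ((List.ofFn c).drop (i + 1)).flatMap Comm.operands) := by
  have hi : (i : ℕ) < (List.ofFn c).length := by simp
  conv_lhs => rw [operandList, ← List.take_append_drop i (List.ofFn c), List.flatMap_append,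
    List.drop_eq_getElem_cons hi, List.flatMap_cons]
  simp

lemma operandList_update {n : ℕ} (c : Fin n → Comm) (i : Fin n) (c' : Comm) :
    operandList (Function.update c i c') = ((List.ofFn c).take i).flatMap Comm.operands ++
      (c'.operands ++ ((List.ofFn c).drop (i + 1)).flatMap Comm.operands) := by
  have hset : List.ofFn (Function.update c i c') = (List.ofFn c).set i c' := by
    refine List.ext_getElem (by simp) fun j h₁ h₂ => ?_
    rw [List.getElem_set]
    by_cases h : (i : ℕ) = j
    · subst h
      simp
    · have hj : j < n := by simpa using h₁
      have : (⟨j, hj⟩ : Fin n) ≠ i := fun e => h (by rw [← e])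
      simp [h, Function.update_of_ne this]
  rw [operandList_split _ i, hset, Function.update_self]
  congr 2
  · rw [List.take_set_of_le (le_refl _)]
  · rw [List.drop_set_of_lt (Nat.lt_succ_self _)]

/-- Offsets depend on the clauses only through their numbers of operands. -/
lemma offset_update {n : ℕ} (c : Fin n → Comm) (i : Fin n) {c' : Comm}
    (h : c'.operands.length = (c i).operands.length) (j : Fin n) :
    offset (Function.update c i c') j = offset c j := by
  have hlen : ∀ l : List Comm, (l.flatMap Comm.operands).length =
      (l.map fun d => d.operands.length).sum := by
    intro l
    simp [List.length_flatMap]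
  have hmap : (List.ofFn (Function.update c i c')).map (fun d => d.operands.length) =
      (List.ofFn c).map fun d => d.operands.length := by
    rw [List.map_ofFn, List.map_ofFn]
    congr 1
    funext m
    by_cases hm : m = i
    · subst hm
      simpa using h
    · simp [Function.update_of_ne hm]
  rw [offset, offset, hlen, hlen, List.map_take, List.map_take, hmap]

/-- Same operation, up to the subexpressions. -/
def Comm.SameShape : Comm → Comm → Prop
  | .recv x _, .recv y _ => x = y
  | .send _ _, .send _ _ => True
  | _, _ => False

lemma Comm.SameShape.length_eq {c c' : Comm} (h : c.SameShape c') :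
    c'.operands.length = c.operands.length := by
  cases c <;> cases c' <;> first | rfl | exact h.elim

/-- The choice refers to operands by position, so evaluating an operand inside a clause does not
affect it. The same reason gives `selCont_update`. -/
lemma selPre_update {n : ℕ} (c : Fin n → Comm) (i : Fin n) {c' : Comm}
    (h : (c i).SameShape c') (hl : (operandList (Function.update c i c')).length =
      (operandList c).length) (k : ℕ) :
    selPre (Function.update c i c') k = selPre c k := by
  funext j
  unfold selPre
  rw [offset_update c i h.length_eq, hl]
  by_cases hj : j = i
  · subst hj
    rw [Function.update_self]
    cases hc : c j <;> rw [hc] at h <;> cases c' <;> first | rfl | exact h.elim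
  · rw [Function.update_of_ne hj]

lemma selCont_update {n : ℕ} (c : Fin n → Comm) (s : Fin n → Stm) (i : Fin n) {c' : Comm}
    (h : (c i).SameShape c') (hl : (operandList (Function.update c i c')).length =
      (operandList c).length) (r : Name) (k : ℕ) :
    selCont (Function.update c i c') s r k = selCont c s r k := by
  funext j
  unfold selCont
  rw [hl]
  by_cases hj : j = i
  · subst hj
    rw [Function.update_self]
    cases hc : c j <;> rw [hc] at h <;> cases c' <;>
      first | rfl | exact h.elim | (obtain rfl := h; rfl)
  · rw [Function.update_of_ne hj]

/-- Brings the operands of the active clause into the form required by `Ev.encLR`. -/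
lemma CStep.exists_split {σ : Store} {c c' : Comm} {δ δ' : ChanStore} {α : LAct}
    (h : CStep σ c δ α c' δ') : c.SameShape c' ∧ ∃ (vs : List Val) (e e' : Exp) (es : List Exp),
      c.operands = vs.map Exp.val ++ e :: es ∧ c'.operands = vs.map Exp.val ++ e' :: es ∧
      EStep σ e δ α e' δ' := by
  cases h with
  | @recv x e e' _ _ _ h => exact ⟨rfl, [], e, e', [], rfl, rfl, h⟩
  | @send1 e₁ e₁' e₂ _ _ _ h => exact ⟨trivial, [], e₁, e₁', [e₂], rfl, rfl, h⟩
  | @send2 v e₂ e₂' _ _ _ h => exact ⟨trivial, [v], e₂, e₂', [], rfl, rfl, h⟩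

lemma exists_vals {l : List Exp} (h : ∀ e ∈ l, ∃ v, e = .val v) : ∃ vs : List Val,
    l = vs.map Exp.val := by
  induction l with
  | nil => exact ⟨[], rfl⟩
  | cons e l ih =>
    obtain ⟨v, rfl⟩ := h e (by simp)
    obtain ⟨vs, rfl⟩ := ih fun e he => h e (List.mem_cons_of_mem _ he)
    exact ⟨v :: vs, rfl⟩

lemma exists_vals_take {n : ℕ} {c : Fin n → Comm} (i : ℕ)
    (h : ∀ j : Fin n, (j : ℕ) < i → (c j).Evaluated) :
    ∃ vs : List Val, ((List.ofFn c).take i).flatMap Comm.operands = vs.map Exp.val := by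
  refine exists_vals fun e he => ?_
  obtain ⟨d, hd, he⟩ := List.mem_flatMap.1 he
  obtain ⟨j, hj, rfl⟩ := List.mem_take_iff_getElem.1 hd
  simp only [List.length_ofFn, lt_inf_iff] at hj
  rw [List.getElem_ofFn] at he
  exact h _ (by simpa using hj.1) e he

lemma mem_freeNames_selCont {n : ℕ} {c : Fin n → Comm} {s : Fin n → Stm} {r : Name} {k : ℕ}
    {i : Fin n} {a : Name} (h : a ∈ (selCont c s r k i).freeNames) :
    a = r ∨ a = .aux (k + 1 + (operandList c).length) ∨ ∃ D C, Allowed D C a := by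
  unfold selCont at h
  split at h
  · rcases mem_freeNames_encSeq h with ⟨h, h₁⟩ | h
    · rcases mem_freeNames_encAssign h with h | h | ⟨h, h₂⟩
      · exact absurd h h₁
      · exact Or.inr (Or.inr ⟨Set.univ, ∅, by simp [h]⟩)
      · simp at h
        tauto
    · exact (mem_freeNames_encStm h).imp_right fun h => Or.inr ⟨_, _, h⟩
  · exact (mem_freeNames_encStm h).imp_right fun h => Or.inr ⟨_, _, h⟩

lemma aux_notMem_freeNames_select {n : ℕ} (c : Fin n → Comm) (s : Fin n → Stm) {r : Name} {k : ℕ}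
    (hr : Below k r) : Name.aux k ∉ (Proc.sum n (selPre c k) (selCont c s r k)).freeNames := by
  intro h
  obtain ⟨i, h | ⟨h, -⟩⟩ := Proc.mem_freeNames_sum.1 h
  · unfold selPre at h
    split at h
    · simp only [Pre.used, Set.mem_singleton_iff, Name.aux.injEq] at h
      omega
    · simp only [Pre.used, Set.mem_ofPred_eq, List.mem_singleton, Name.aux.injEq] at h
      omega
  · rcases mem_freeNames_selCont h with h | h | ⟨D, C, h⟩
    · exact hr.ne le_rfl h.symm
    · simp only [Name.aux.injEq] at h
      omega
    · exact h

/-- The operand names occur in the prefixes of the choice only. A continuation knows the result name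
and the received value, whose index comes after those of the operands. -/
lemma subst_selCont {n : ℕ} (c : Fin n → Comm) (s : Fin n → Stm) {r : Name} {k : ℕ}
    (hr : Below k r) (i : Fin n) (vs xs : List Name) :
    (selCont c s r k i).subst (fixOn (ren
      ((List.range (operandList c).length).map fun j => .aux (k + 1 + j)) vs) xs) =
      selCont c s r k i := by
  refine Proc.subst_eq_self fun a ha => ?_
  by_cases hax : a ∈ xs
  · exact fixOn_of_mem hax
  rw [fixOn_of_notMem hax]
  refine ren_of_notMem fun hm => ?_
  obtain ⟨j, hj, rfl⟩ := List.mem_map.1 hm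
  rw [List.mem_range] at hj
  rcases mem_freeNames_selCont ha with h | h | ⟨D, C, h⟩
  · exact hr.ne (by omega) h.symm
  · simp only [Name.aux.injEq] at h
    omega
  · exact h

/-- In a receive clause the assignment is encoded with the received name as its right-hand side;
when a value takes the place of that name, this is the encoding of the assignment of the value. -/
lemma subst_selCont_recv {n : ℕ} {c : Fin n → Comm} (s : Fin n → Stm) {r : Name} {k : ℕ}
    (hr : Below k r) {i : Fin n} {x : ℕ} {e : Exp} (hc : c i = .recv x e) (v : Val) :
    (selCont c s r k i).subst (ren [.aux (k + 1 + (operandList c).length)] [v.name]) =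
      encStm (.seq (.assign x (.val v)) (s i)) r (k + 2 + (operandList c).length) := by
  unfold selCont
  rw [hc]
  simp only [encStm, encSeq, encAssign, encExp]
  generalize hm : k + 1 + (operandList c).length = m
  have hm' : k + 2 + (operandList c).length = m + 1 := by omega
  rw [hm']
  have h₁ : r ≠ .aux m := hr.ne (by omega)
  have hs : (encStm (s i) r (m + 1 + 1)).subst
      (fixOn (ren [.aux m] [v.name]) [.aux (m + 1)]) = encStm (s i) r (m + 1 + 1) := by
    refine Proc.subst_eq_self fun a ha => ?_
    rw [fixOn_eq_self (by simp), ren_of_notMem]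
    rw [List.mem_singleton]
    rintro rfl
    rcases mem_freeNames_encStm ha with h | h
    · exact h₁ h.symm
    · exact h
  simp only [Proc.subst, Proc.subst_pre, Pre.subst, Pre.bound, fixOn_nil, hs]
  simp [fixOn, show m ≠ m + 1 + 1 by omega]

lemma getElem_auxs (k n j : ℕ) (hj : j < n) :
    ((List.range n).map fun j => Name.aux (k + j))[j]'(by simpa using hj) = .aux (k + j) := by
  simp

lemma ren_auxs {k j : ℕ} {vs : List Val} {n : ℕ} (hn : vs.length = n) {v : Val}
    (hv : vs[j]? = some v) :
    ren ((List.range n).map fun j => Name.aux (k + j)) (vs.map Val.name) (.aux (k + j)) =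
      v.name := by
  obtain ⟨hj, rfl⟩ := List.getElem?_eq_some_iff.1 hv
  have h := ren_getElem (nodup_auxs k n) (ds := vs.map Val.name) (by simpa using hn) (j := j)
    (by simpa [← hn] using hj)
  rw [getElem_auxs k n j (by omega)] at h
  rw [h, List.getElem_map]

/-- When the operands of a select statement are evaluated, its choice becomes active. -/
lemma reds_select {n : ℕ} {c : Fin n → Comm} (s : Fin n → Stm) {r : Name} {k : ℕ}
    (hr : Below k r) {vs : List Val} (hvs : operandList c = vs.map Exp.val) :
    Reds (encStm (.select n c s) r k) ((Proc.sum n (selPre c k) (selCont c s r k)).subst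
      (ren ((List.range (operandList c).length).map fun j => .aux (k + 1 + j))
        (vs.map Val.name))) := by
  have hwf : WF (.sum n (selPre c k) (selCont c s r k)) := by
    have := wf_encStm (.select n c s) r k
    rw [encStm_select] at this
    simp only [wf_nu, wf_par, wf_inp] at this
    exact this.2.2.2.2
  rw [encStm_select]
  have := Reds.pass (a := .aux k) (vs := vs)
    (xs := (List.range (operandList c).length).map fun j => .aux (k + 1 + j))
    (Q := .sum n (selPre c k) (selCont c s r k)) trivial (by simp [hvs]) hwf
    (aux_notMem_freeNames_select c s hr)
  rwa [← encLR_vals vs (.aux k) (k + 1), ← hvs] at this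

lemma getElem?_of_split {pre post : List Exp} {e : Exp} {vs : List Val} {v : Val} {m : ℕ}
    (h : vs.map Exp.val = pre ++ e :: post) (hm : pre.length = m) (he : e = .val v) :
    vs[m]? = some v := by
  have : (vs.map Exp.val)[m]? = some (.val v) := by
    rw [h, he, ← hm]
    simp
  rw [List.getElem?_map, Option.map_eq_some_iff] at this
  obtain ⟨w, hw, e'⟩ := this
  rw [hw]
  simpa using e'

/-! ### Statements -/

/-- The restricted name is auxiliary and hides no channel, so the channels of the context `R` are
among those of the whole statement. -/
lemma chan_notMem_freeNames {s : Stm} {r : Name} {k : ℕ} {L R : Proc Name}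
    (h : encStm s r k = .nu (.aux k) (.par L R)) (hi : r.Internal) {w : ℕ} (hw : w ∉ s.chans) :
    Name.chan w ∉ R.freeNames := by
  intro hf
  have : Name.chan w ∈ (encStm s r k).freeNames := by
    rw [h]
    exact ⟨Or.inr hf, by simp⟩
  rcases mem_freeNames_encStm this with h | h
  · exact absurd (h ▸ hi) (by simp)
  · exact hw h

lemma reds_assign (x : ℕ) (v : Val) {r : Name} {k : ℕ} (hr : Below k r) :
    Reds (encStm (.assign x (.val v)) r k) (writeRequest x v.name r (k + 2)) := by
  have h := Reds.pass (a := .aux k) (vs := [v]) (xs := [.aux (k + 1)])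
    (Q := writeRequest x (.aux (k + 1)) r (k + 2)) trivial rfl (by simp [writeRequest])
    (by simp [writeRequest, (hr.ne le_rfl).symm])
  refine h.trans (.refl ?_)
  simp [writeRequest, Proc.subst, Proc.subst_pre, Pre.subst, Pre.bound, fixOn,
    hr.ne (Nat.le_succ k)]

lemma reds_send (ch : ℕ) (v : Val) {r : Name} {k : ℕ} (hr : Below k r) :
    Reds (encStm (.send (.val (.chan ch)) (.val v)) r k)
      (out (.chan ch) [v.name] (out r [] .zero)) := by
  have h := Reds.pass (a := .aux k) (vs := [.chan ch, v]) (xs := [.aux (k + 1), .aux (k + 2)])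
    (Q := out (.aux (k + 1)) [.aux (k + 2)] (out r [] .zero)) trivial rfl (by simp)
    (by simp [(hr.ne le_rfl).symm])
  rw [← encLR_vals _ (.aux k) (k + 1)] at h
  refine h.trans (.refl ?_)
  simp [Proc.subst_pre, Pre.subst, Pre.bound, ren_cons, Val.name, hr.ne (Nat.le_succ k),
    (hr.ne (Nat.le_add_right k 2))]

lemma reds_go (f : ℕ) (vs : List Val) {r : Name} {k : ℕ} (hr : Below k r) :
    Reds (encStm (.go f (vs.map Exp.val)) r k)
      (out (.fn f) (vs.map Val.name) (out r [] .zero)) := by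
  have hnot : ∀ j, k ≤ j → r ≠ .aux j := fun j hj => hr.ne hj
  have h := Reds.pass (a := .aux k) (vs := vs)
    (xs := (List.range vs.length).map fun j => .aux (k + 1 + j))
    (Q := out (.fn f) ((List.range vs.length).map fun j => .aux (k + 1 + j)) (out r [] .zero))
    trivial (by simp) (by simp) (by
      simp only [Proc.mem_freeNames_out, List.mem_map, Name.aux.injEq, reduceCtorEq, false_or,
        Proc.mem_freeNames_zero, List.not_mem_nil, or_false, not_or]
      refine ⟨?_, (hr.ne le_rfl).symm⟩
      rintro ⟨j, -, hj⟩
      omega)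
  rw [← encLR_vals _ (.aux k) (k + 1)] at h
  have hlen : (vs.map Exp.val).length = vs.length := by simp
  simp only [encStm, hlen]
  refine h.trans (.refl ?_)
  simp only [Proc.subst_pre, Pre.subst, Pre.bound, fixOn_nil, Proc.subst_zero, List.map_nil]
  rw [ren_map_self (nodup_auxs _ _) (by simp), ren_of_notMem, ren_of_notMem]
  · intro hm
    obtain ⟨j, -, hj⟩ := List.mem_map.1 hm
    exact hnot _ (by omega) hj.symm
  · intro hm
    obtain ⟨j, -, hj⟩ := List.mem_map.1 hm
    simp at hj

lemma reds_nil_seq (s : Stm) {r : Name} {k : ℕ} (hr : Below k r) :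
    Reds (encStm (.seq .nil s) r k) (encStm s r k) := by
  have h := Reds.pass (a := .aux k) (vs := []) (xs := []) (Q := encStm s r (k + 1)) trivial rfl
    (by simp) (by
      intro h
      rcases mem_freeNames_encStm h with h | h
      · exact hr.ne le_rfl h.symm
      · exact h)
  refine h.trans (.refl ?_)
  rw [Proc.subst_eq_self fun a _ => ren_nil_left _ _]
  exact cl_encStm s hr (Nat.le_succ k)

/-- The kind of a step of a Go-routine, and the corresponding behaviour of its encoding. -/
theorem LStep.exists_kind {s s' : Stm} {σ σ' : Store} {δ δ' : ChanStore} {α : LAct}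
    (h : LStep s σ δ α s' σ' δ') :
    ∃ κ : Kind, κ.Effect σ δ α σ' δ' ∧ (κ.Accesses → s.AccessesNext) ∧
      (∀ x v, κ = .write x v → x ∈ s.vars) ∧
      ∀ W r k, Name.Internal r → Below k r → (∀ w ∈ W, w ∉ s.chans) →
        Ev W κ.redex (encStm s r k) (encStm s' r k) := by
  have hst : ∀ (κ : Kind) (j : ℕ), Stable κ.redex (.aux j) := fun κ j => κ.stable trivial (by simp)
  induction h with
  | @ass x v σ δ =>
    refine ⟨.write x v, ⟨rfl, rfl, rfl⟩, fun _ => Or.inl ⟨v, rfl⟩, ?_, fun W r k hi hr hW => ?_⟩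
    · rintro _ _ ⟨⟩
      exact Or.inl rfl
    · exact (Ev.base ⟨r, k + 2, hi, hr.ne (by omega), hr.ne (by omega), rfl, rfl⟩).before
        (reds_assign x v hr)
  | @asE x e e' σ δ δ' α h =>
    obtain ⟨κ, h₁, h₂, h₃, h₄⟩ := h.exists_kind
    refine ⟨κ, h₁, fun a => Or.inr (h₂ a), fun x v e => absurd e (h₃ x v),
      fun W r k hi hr hW => ?_⟩
    exact ((h₄ W (.aux k) (k + 1) trivial (below_aux (by omega))).par (by simp)
      fun w hw => chan_notMem_freeNames (s := .assign x e) rfl hi (hW w hw)).nu (Name.internal_aux k) (hst κ k)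
  | @sdU ch v g σ δ hch =>
    refine ⟨.send ch v, ⟨rfl, Or.inl ⟨g, hch, rfl, rfl⟩⟩, fun h => h.elim, by simp,
      fun W r k hi hr hW => ?_⟩
    exact (Ev.base ⟨1, _, _, 0, rfl, rfl, normal_pre, rfl⟩).before (reds_send ch v hr)
  | @sdB ch v n l g σ δ hch hn hl =>
    obtain ⟨m, rfl⟩ := Nat.exists_eq_succ_of_ne_zero hn.ne'
    refine ⟨.send ch v, ⟨rfl, Or.inr ⟨m, l, g, hch, hl, rfl, rfl⟩⟩, fun h => h.elim, by simp,
      fun W r k hi hr hW => ?_⟩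
    exact (Ev.base ⟨1, _, _, 0, rfl, rfl, normal_pre, rfl⟩).before (reds_send ch v hr)
  | @sdE1 e₁ e₁' e₂ σ δ δ' α h =>
    obtain ⟨κ, h₁, h₂, h₃, h₄⟩ := h.exists_kind
    refine ⟨κ, h₁, fun a => ⟨[], e₁, [e₂], rfl, h₂ a⟩, fun x v e => absurd e (h₃ x v),
      fun W r k hi hr hW => ?_⟩
    refine (((Ev.encLR h.pending [] [e₂] (r := .aux k) trivial (below_aux (by omega))
      (h₄ W) ?_)).par (by simp) fun w hw =>
      chan_notMem_freeNames (s := .send e₁ e₂) rfl hi (hW w hw)).nu (Name.internal_aux k) (hst κ k)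
    rintro w hw ⟨e, he, hwe⟩
    simp only [List.map_nil, List.nil_append, List.mem_cons, List.not_mem_nil, or_false] at he
    rcases he with rfl | rfl
    · exact hW w hw (Or.inl hwe)
    · exact hW w hw (Or.inr hwe)
  | @sdE2 ch e₂ e₂' σ δ δ' α h =>
    obtain ⟨κ, h₁, h₂, h₃, h₄⟩ := h.exists_kind
    refine ⟨κ, h₁, fun a => ⟨[.chan ch], e₂, [], rfl, h₂ a⟩, fun x v e => absurd e (h₃ x v),
      fun W r k hi hr hW => ?_⟩
    refine (((Ev.encLR h.pending [.chan ch] [] (r := .aux k) trivial (below_aux (by omega))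
      (h₄ W) ?_)).par (by simp) fun w hw =>
      chan_notMem_freeNames (s := .send (.val (.chan ch)) e₂) rfl hi (hW w hw)).nu (Name.internal_aux k) (hst κ k)
    rintro w hw ⟨e, he, hwe⟩
    simp only [List.map_cons, List.map_nil, List.cons_append, List.nil_append, List.mem_cons,
      List.not_mem_nil, or_false] at he
    rcases he with rfl | rfl
    · exact hW w hw (Or.inl hwe)
    · exact hW w hw (Or.inr hwe)
  | @go f vs σ δ =>
    refine ⟨.go f vs, ⟨rfl, rfl, rfl⟩, fun h => h.elim, by simp, fun W r k hi hr hW => ?_⟩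
    exact (Ev.base (ρ := (Kind.go f vs).redex) (P' := out r [] .zero) rfl).before (reds_go f vs hr)
  | @goE f vs e e' es σ δ δ' α h =>
    obtain ⟨κ, h₁, h₂, h₃, h₄⟩ := h.exists_kind
    refine ⟨κ, h₁, fun a => ⟨vs, e, es, rfl, h₂ a⟩, fun x v e => absurd e (h₃ x v),
      fun W r k hi hr hW => ?_⟩
    have hev := (((Ev.encLR h.pending vs es (r := .aux k) trivial
      (below_aux (Nat.lt_succ_self k)) (h₄ W) hW)).par (by simp) fun w hw =>
      chan_notMem_freeNames (s := .go f (vs.map Exp.val ++ e :: es)) (k := k) rfl hi (hW w hw)).nu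
      (Name.internal_aux k) (hst κ k)
    have hlen : (vs.map Exp.val ++ e' :: es).length = (vs.map Exp.val ++ e :: es).length := by
      simp
    simp only [encStm, hlen]
    exact hev
  | @slR n c s i x ch v σ δ δ' α hev hci h =>
    -- There are `n` clauses, so taking `n` of them gives the operands of all.
    obtain ⟨vs, hvs⟩ := exists_vals_take (c := c) n fun j _ => hev j
    rw [List.take_of_length_le (by simp)] at hvs
    change operandList c = _ at hvs
    have hoff : vs[offset c i]? = some (.chan ch) := by
      have hs := operandList_split c i
      rw [hvs, hci] at hs
      exact getElem?_of_split hs rfl rfl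
    have hev' : ∀ W r k, Name.Internal r → Below k r → (∀ w ∈ W, w ∉ (Stm.select n c s).chans) →
        Ev W (Kind.recv ch v).redex (encStm (.select n c s) r k)
          (encStm (.seq (.assign x (.val v)) (s i)) r k) := by
      intro W r k hi hr hW
      have hb : Ev W (Kind.recv ch v).redex
          ((Proc.sum n (selPre c k) (selCont c s r k)).subst
            (ren ((List.range (operandList c).length).map fun j => .aux (k + 1 + j))
              (vs.map Val.name)))
          (encStm (.seq (.assign x (.val v)) (s i)) r (k + 2 + (operandList c).length)) := by
        refine .base ⟨n, _, _, i, .aux (k + 1 + (operandList c).length), rfl, ?_, ?_,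
          (normal_selCont c s r k i).subst _, ?_⟩
        · simp only [selPre, hci, Pre.subst]
          rw [ren_auxs (by simp [hvs]) hoff]
          rfl
        · rw [Proc.boundNames_subst]
          intro hb
          have hwf := wf_encStm (.select n c s) r k
          rw [encStm_select] at hwf
          simp only [wf_nu, wf_par, wf_inp] at hwf
          exact v.not_internal_name ((hwf.2.2.2.2 i).2.2.internal_of_mem_boundNames hb)
        · rw [subst_selCont c s hr i,
            subst_selCont_recv s hr hci]
      -- Inside the choice the continuation is numbered from `k + 2 + (operandList c).length`; up to
      -- congruence it can be numbered from `k` again.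
      exact (hb.before (reds_select s hr hvs)).after (.refl (cl_encStm _ hr (by omega)))
    cases h with
    | @rvU _ _ g _ hch =>
      exact ⟨.recv ch v, ⟨rfl, Or.inl ⟨g, hch, rfl, rfl⟩⟩, fun h => h.elim, by simp, hev'⟩
    | @rvB _ m _ l g _ hch hm =>
      obtain ⟨m, rfl⟩ := Nat.exists_eq_succ_of_ne_zero hm.ne'
      exact ⟨.recv ch v, ⟨rfl, Or.inr ⟨m, l, g, hch, rfl, rfl⟩⟩, fun h => h.elim, by simp, hev'⟩
  | @slS n c s i ch v σ δ δ' α hev hci h ih =>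
    obtain ⟨vs, hvs⟩ := exists_vals_take (c := c) n fun j _ => hev j
    rw [List.take_of_length_le (by simp)] at hvs
    change operandList c = _ at hvs
    have hs := operandList_split c i
    rw [hvs, hci] at hs
    have hoff : vs[offset c i]? = some (.chan ch) := getElem?_of_split hs rfl rfl
    have hoff' : vs[offset c i + 1]? = some v := by
      refine getElem?_of_split (pre := ((List.ofFn c).take i).flatMap Comm.operands ++
        [.val (.chan ch)]) (e := .val v)
        (post := ((List.ofFn c).drop (i + 1)).flatMap Comm.operands) ?_ (by simp [offset]) rfl
      rw [hs]
      simp [Comm.operands]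
    have hev' : ∀ W r k, Name.Internal r → Below k r → (∀ w ∈ W, w ∉ (Stm.select n c s).chans) →
        Ev W (Kind.send ch v).redex (encStm (.select n c s) r k) (encStm (s i) r k) := by
      intro W r k hi hr hW
      have hb : Ev W (Kind.send ch v).redex
          ((Proc.sum n (selPre c k) (selCont c s r k)).subst
            (ren ((List.range (operandList c).length).map fun j => .aux (k + 1 + j))
              (vs.map Val.name)))
          (encStm (s i) r (k + 2 + (operandList c).length)) := by
        refine .base ⟨n, _, _, i, rfl, ?_, (normal_selCont c s r k i).subst _, ?_⟩
        · simp only [selPre, hci, Pre.subst, List.map_cons, List.map_nil]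
          rw [ren_auxs (by simp [hvs]) hoff, ren_auxs (by simp [hvs]) hoff']
          rfl
        · rw [subst_selCont c s hr i, selCont, hci]
      exact (hb.before (reds_select s hr hvs)).after (.refl (cl_encStm _ hr (by omega)))
    cases h with
    | @sdU _ _ g _ _ hch =>
      exact ⟨.send ch v, ⟨rfl, Or.inl ⟨g, hch, rfl, rfl⟩⟩, fun h => h.elim, by simp, hev'⟩
    | @sdB _ _ m l g _ _ hch hm hl =>
      obtain ⟨m, rfl⟩ := Nat.exists_eq_succ_of_ne_zero hm.ne'
      exact ⟨.send ch v, ⟨rfl, Or.inr ⟨m, l, g, hch, hl, rfl, rfl⟩⟩, fun h => h.elim, by simp,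
        hev'⟩
  | @slE n c s i c' σ δ δ' α hev h =>
    obtain ⟨hshape, vs, e, e', es, hc, hc', h⟩ := h.exists_split
    obtain ⟨vs', hvs'⟩ := exists_vals_take (c := c) i hev
    obtain ⟨κ, h₁, h₂, h₃, h₄⟩ := h.exists_kind
    -- The clauses before `i` are evaluated, so the list of all operands again consists of values,
    -- the active expression and a remainder.
    have e₁ : operandList c = (vs' ++ vs).map Exp.val ++
        e :: (es ++ ((List.ofFn c).drop (i + 1)).flatMap Comm.operands) := by
      rw [operandList_split c i, hvs', hc]
      simp
    have e₂ : operandList (Function.update c i c') = (vs' ++ vs).map Exp.val ++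
        e' :: (es ++ ((List.ofFn c).drop (i + 1)).flatMap Comm.operands) := by
      rw [operandList_update, hvs', hc']
      simp
    have hl : (operandList (Function.update c i c')).length = (operandList c).length := by
      rw [e₁, e₂]
      simp
    refine ⟨κ, h₁, fun a => ⟨_, e, _, e₁, h₂ a⟩, fun x v e => absurd e (h₃ x v),
      fun W r k hi hr hW => ?_⟩
    have hLR : Ev W κ.redex (encLR (operandList c) (.aux k) (k + 1))
        (encLR (operandList (Function.update c i c')) (.aux k) (k + 1)) := by
      rw [e₁, e₂]
      refine Ev.encLR h.pending _ _ trivial (below_aux (Nat.lt_succ_self k)) (h₄ W) ?_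
      rw [← e₁]
      rintro w hw ⟨e, he, hwe⟩
      refine hW w hw ?_
      simp only [operandList, List.mem_flatMap, List.mem_ofFn] at he
      obtain ⟨_, ⟨j, rfl⟩, he⟩ := he
      refine Set.mem_iUnion.2 ⟨j, Or.inl ?_⟩
      cases hcj : c j with
      | recv x e' =>
        simp only [hcj, Comm.operands, List.mem_singleton] at he
        exact he ▸ hwe
      | send e₁ e₂ =>
        simp only [hcj, Comm.operands, List.mem_cons, List.not_mem_nil, or_false] at he
        rcases he with rfl | rfl
        · exact Or.inl hwe
        · exact Or.inr hwe
    have := (hLR.par (by simp) fun w hw =>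
      chan_notMem_freeNames (encStm_select c s r k) hi (hW w hw)).nu (Name.internal_aux k) (hst κ k)
    rw [encStm_select, encStm_select, selPre_update c i hshape hl,
      selCont_update c s i hshape hl, hl]
    exact this
  | @seq1 s₁ s₁' s₂ σ σ' δ δ' α h ih =>
    obtain ⟨κ, h₁, h₂, h₃, h₄⟩ := ih
    refine ⟨κ, h₁, fun a => Or.inl (h₂ a), fun x v e => Or.inl (h₃ x v e),
      fun W r k hi hr hW => ?_⟩
    exact ((h₄ W (.aux k) (k + 1) trivial (below_aux (Nat.lt_succ_self k)) fun w hw hm =>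
      hW w hw (Or.inl hm)).par (by simp) fun w hw =>
        chan_notMem_freeNames (s := .seq s₁ s₂) rfl hi (hW w hw)).nu (Name.internal_aux k) (hst κ k)
  | @seq2 s₂ s₂' σ σ' δ δ' α h ih =>
    obtain ⟨κ, h₁, h₂, h₃, h₄⟩ := ih
    refine ⟨κ, h₁, fun a => Or.inr ⟨rfl, h₂ a⟩, fun x v e => Or.inr (h₃ x v e),
      fun W r k hi hr hW => ?_⟩
    -- The signal with which `nil` reports its completion is consumed first.
    exact (h₄ W r k hi hr fun w hw hm => hW w hw (Or.inr hm)).before (reds_nil_seq s₂ hr)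

end Go

namespace Go

open PiB

/-! ### Variable cells -/

lemma Normal.of_newGuarded {P : Proc Name} (h : P.NewGuarded) : Normal P := by
  induction P with
  | sum n π P ih => trivial
  | par P Q ihP ihQ => exact ⟨ihP h.1, ihQ h.2⟩
  | nuB c n P ih => trivial
  | nu c P ih => exact h.elim
  | repl P ih => exact h

/-- When a redex is joined with its partner, it does not reduce in one step but by a series of
communications. These take place inside the exposing context, which is normal and whose restrictions
`Sync` tolerates. -/
lemma Foc.flatten_ev {W : Set ℕ} {P P' : Proc Name} (h : Foc W (Ev ∅ Sync) P P') :
    Ev ∅ Sync P P' := by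
  obtain ⟨as, A, A', K, h₁, h₂, h₃, h₄, h₅, h₆⟩ := h ∅ Set.finite_empty
  have := (h₄.par (Normal.of_newGuarded h₂) (by simp)).nus
    fun c hc => ⟨(h₁ c hc).1, Sync.stable c⟩
  exact (this.before (.refl h₅)).after (.refl h₆.symm)

/-- The replicated part of a variable cell. -/
def cellLoop (x : Name) (k : ℕ) : Proc Name :=
  inp (.aux k) [.aux (k + 1)] (inp x [.aux (k + 2), .aux (k + 3)]
    (.par (inp (.aux (k + 3)) [.aux (k + 4)] (out (.aux k) [.aux (k + 4)] .zero))
      (out (.aux (k + 2)) [.aux (k + 1)] (out (.aux k) [.aux (k + 1)] .zero))))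

/-- A variable cell without the restriction. -/
def cellBody (x v : Name) (k : ℕ) : Proc Name :=
  .par (out (.aux k) [v] .zero) (.repl (cellLoop x k))

lemma encVar_eq (x v : Name) (k : ℕ) : encVar x v k = .nu (.aux k) (cellBody x v k) := rfl

/-- A dead branch for writing, left behind by a read access. -/
def deadPut (k : ℕ) : Proc Name :=
  .nu (.aux (k + 6)) (inp (.aux (k + 6)) [.aux (k + 4)] (out (.aux k) [.aux (k + 4)] .zero))

/-- A dead branch for reading, left behind by a write access. -/
def deadGet (w : Name) (k : ℕ) : Proc Name :=
  .nu (.aux (k + 5)) (out (.aux (k + 5)) [w] (out (.aux k) [w] .zero))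

/-- A variable cell with a dead branch for writing. -/
def readCell (x v : Name) (k : ℕ) : Proc Name :=
  .nu (.aux k) (.par (deadPut k) (cellBody x v k))

/-- A variable cell with a dead branch for reading. -/
def writtenCell (x w v : Name) (k : ℕ) : Proc Name :=
  .nu (.aux k) (.par (deadGet w k) (cellBody x v k))

@[simp] lemma normal_readCell (x v : Name) (k : ℕ) : Normal (readCell x v k) := by
  simp [readCell, deadPut, cellBody, cellLoop]

@[simp] lemma normal_writtenCell (x w v : Name) (k : ℕ) : Normal (writtenCell x w v k) := by
  simp [writtenCell, deadGet, cellBody, cellLoop]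

lemma cl_readCell (x : ℕ) (v : Val) (k : ℕ) :
    cl (readCell (.var x) v.name k) = cl (readCell (.var x) v.name 0) := by
  rw [← cl_map_shift (P := readCell (.var x) v.name 0) (k := 0) (d := k)]
  · simp [readCell, deadPut, cellBody, cellLoop, Proc.map, Proc.map_pre, Pre.map, shift,
      Nat.add_comm]
  · simp [readCell, deadPut, cellBody, cellLoop]
  · intro j hj
    simp only [readCell, deadPut, cellBody, cellLoop, Proc.mem_freeNames_nu,
      Proc.mem_freeNames_par, Proc.mem_freeNames_inp,
      Proc.mem_freeNames_repl, Proc.mem_freeNames_out, Proc.mem_freeNames_zero, List.mem_cons,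
      List.not_mem_nil, reduceCtorEq, (Val.name_ne_aux _ _).symm] at hj
    tauto

lemma cl_writtenCell (x : ℕ) (w v : Val) (k : ℕ) :
    cl (writtenCell (.var x) w.name v.name k) = cl (writtenCell (.var x) w.name v.name 0) := by
  rw [← cl_map_shift (P := writtenCell (.var x) w.name v.name 0) (k := 0) (d := k)]
  · simp [writtenCell, deadGet, cellBody, cellLoop, Proc.map, Proc.map_pre, Pre.map, shift,
      Nat.add_comm]
  · simp [writtenCell, deadGet, cellBody, cellLoop]
  · intro j hj
    simp only [writtenCell, deadGet, cellBody, cellLoop, Proc.mem_freeNames_nu,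
      Proc.mem_freeNames_par, Proc.mem_freeNames_inp,
      Proc.mem_freeNames_repl, Proc.mem_freeNames_out, Proc.mem_freeNames_zero, List.mem_cons,
      List.not_mem_nil, reduceCtorEq, (Val.name_ne_aux _ _).symm] at hj
    tauto

/-- A cell accepts a request with fresh reply names. -/
lemma ev_cell_access (x : ℕ) (w : Val) (m : ℕ) {C : Proc Name}
    (ht : Name.aux m ∉ C.freeNames) :
    Ev ∅ Sync
      (.par (.nus [.aux (m + 5), .aux (m + 6)] (out (.var x) [.aux (m + 5), .aux (m + 6)] C))
        (encVar (.var x) w.name m))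
      (.nus [.aux (m + 5), .aux (m + 6), .aux m] (.par C (.par
        (.par (inp (.aux (m + 6)) [.aux (m + 4)] (out (.aux m) [.aux (m + 4)] .zero))
          (out (.aux (m + 5)) [w.name] (out (.aux m) [w.name] .zero)))
        (.repl (cellLoop (.var x) m))))) := by
  have hI : ∀ c ∈ [Name.aux (m + 5), .aux (m + 6), .aux m], c.Internal := by simp
  have hw : ∀ j, w.name ≠ .aux j := fun j => Val.name_ne_aux _ _
  let B : Proc Name := .par (inp (.aux (m + 3)) [.aux (m + 4)] (out (.aux m) [.aux (m + 4)] .zero))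
      (out (.aux (m + 2)) [w.name] (out (.aux m) [w.name] .zero))
  let Rq : Proc Name := out (.var x) [.aux (m + 5), .aux (m + 6)] C
  -- An unfolded copy of the loop takes the stored value and then listens on `x`.
  have h₁ : Foc ∅ Sync (.par (out (.aux m) [w.name] .zero) (cellLoop (.var x) m))
      (.par .zero (inp (.var x) [.aux (m + 2), .aux (m + 3)] B)) := by
    refine .base ⟨.aux m, [w.name], [.aux (m + 1)], .zero, _, trivial, rfl, ?_, rfl, ?_⟩
    · intro v hv hb
      rw [List.mem_singleton] at hv
      subst hv
      simp [hw] at hb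
    · simp [B, Proc.subst, Proc.subst_pre, Pre.subst, Pre.bound, fixOn]
  -- The request hands over its reply names. The cell binds the indices `m` to `m + 4`, so `m + 5`
  -- and `m + 6` are not captured.
  have h₂ : Reds (.par Rq (inp (.var x) [.aux (m + 2), .aux (m + 3)] B))
      (.par C (.par
        (inp (.aux (m + 6)) [.aux (m + 4)] (out (.aux m) [.aux (m + 4)] .zero))
          (out (.aux (m + 5)) [w.name] (out (.aux m) [w.name] .zero)))) := by
    have := Reds.comm (a := .var x) (vs := [.aux (m + 5), .aux (m + 6)])
      (xs := [.aux (m + 2), .aux (m + 3)]) (P := C) (Q := B) trivial rfl (by simp [B])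
    refine this.trans (.refl ?_)
    simp [B, Proc.subst, Proc.subst_pre, Pre.subst, Pre.bound, fixOn, ren_cons, hw]
  have h₃ := ((Ev.of_foc h₁).par (R := .par Rq (.repl (cellLoop (.var x) m)))
    (by simp [Rq, cellLoop]) (by simp)).after (Q := .par (.par Rq
      (inp (.var x) [.aux (m + 2), .aux (m + 3)] B)) (.repl (cellLoop (.var x) m)))
      (.refl (by simp only [cl_par, cl_zero, one_mul]; ac_rfl))
  have h₄ := (h₃.after (h₂.par (R := .repl (cellLoop (.var x) m)) (by simp [cellLoop]))).nus
    fun c hc => ⟨hI c hc, Sync.stable c⟩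
  refine (h₄.before (.refl ?_)).after (.refl ?_)
  · have hfn : ∀ c ∈ [Name.aux (m + 5), .aux (m + 6)],
        c.Internal ∧ c ∉ (encVar (.var x) w.name m).freeNames := by
      intro c hc
      have hci : c.Internal := hI c (by simp at hc ⊢; tauto)
      refine ⟨hci, fun hf => ?_⟩
      rcases mem_freeNames_encVar hf with rfl | rfl
      · simp at hc
      · exact w.not_internal_name hci
    have hRq : Name.aux m ∉ Rq.freeNames := by simp [Rq, ht]
    rw [cl_par, cl_nus, ← nus_mul _ hfn, encVar_eq, cl_nu, mul_comm, ← nu_mul (Name.internal_aux m) _ hRq,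
      cl_nus]
    simp only [PClass.nus_cons, PClass.nus_nil, cellBody, cl_par]
    conv_lhs => rw [cl_repl (cellLoop (.var x) m)]
    congr 3
    ac_rfl
  · simp only [cl_nus, cl_par]
    congr 1
    ac_rfl

lemma mem_freeNames_cellLoop {x a : Name} {k : ℕ} (h : a ∈ (cellLoop x k).freeNames) :
    a = x ∨ a = .aux k := by
  simp only [cellLoop, Proc.mem_freeNames_par, Proc.mem_freeNames_inp, Proc.mem_freeNames_out,
    Proc.mem_freeNames_zero, List.mem_cons, List.not_mem_nil] at h
  tauto

/-- Restrictions of a request that remain after its reply are moved inwards. -/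
lemma cl_nu_dead {x : ℕ} {w : Val} {m : ℕ} {p g : Name} {D Z : Proc Name} (hp : p.Internal)
    (hg : g.Internal) (hpm : p ≠ .aux m) (hgm : g ≠ .aux m) (hpx : p ≠ .var x) (hgx : g ≠ .var x)
    (hZp : p ∉ Z.freeNames) (hZg : g ∉ Z.freeNames) (hZ : Name.aux m ∉ Z.freeNames)
    (hDg : g ∉ D.freeNames) :
    PClass.nu g (PClass.nu p (PClass.nu (.aux m)
      (cl D * (cl Z * cl (cellBody (.var x) w.name m))))) =
      cl Z * cl (.nu (.aux m) (.par (.nu p D) (cellBody (.var x) w.name m))) := by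
  have hB : ∀ a : Name, a.Internal → a ≠ .aux m → a ≠ .var x →
      a ∉ (cellBody (.var x) w.name m).freeNames := by
    intro a ha hm hx hf
    rcases hf with hf | hf
    · simp only [Proc.mem_freeNames_out, List.mem_singleton, Proc.mem_freeNames_zero,
        or_false] at hf
      rcases hf with rfl | rfl
      · exact hm rfl
      · exact w.not_internal_name ha
    · rcases mem_freeNames_cellLoop hf with rfl | rfl
      · exact hx rfl
      · exact hm rfl
  have e : PClass.nu p (PClass.nu (.aux m)
      (cl D * (cl Z * cl (cellBody (.var x) w.name m)))) =
      cl Z * cl (.nu (.aux m) (.par (.nu p D) (cellBody (.var x) w.name m))) := by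
    rw [PClass.nu_comm, ← cl_par Z, nu_mul hp, cl_par, mul_left_comm, mul_comm, nu_mul (Name.internal_aux m) _ hZ,
      mul_comm, cl_nu, cl_par, cl_nu]
    rintro (h | h)
    · exact hZp h
    · exact hB p hp hpm hpx h
  rw [e, ← cl_par, nu_cl_of_notMem hg]
  rintro (h | ⟨h | h, -⟩)
  · exact hZg h
  · exact hDg h.1
  · exact hB g hg hgm hgx h

/-- The reading branch answers the request and then returns the same value to the cell. The writing
branch is left waiting on a reply name that nobody else knows any more. -/
lemma ev_cell_read {x : ℕ} {v : Val} {A A' : Proc Name} (h : (Kind.read x v).redex A A') :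
    Ev ∅ Sync (.par A (encVar (.var x) v.name 0)) (.par A' (readCell (.var x) v.name 0)) := by
  obtain ⟨r, k, hr, h₀, h₁, h₂, rfl, rfl⟩ := h
  -- The request uses no index from `m` on, so its private names can be renamed to the reply names
  -- that `ev_cell_access` expects.
  obtain ⟨m, hm⟩ := exists_aux_bound (X := {r, .aux k, .aux (k + 1), .aux (k + 2)})
    (Set.toFinite _)
  simp only [Set.mem_insert_iff, Set.mem_singleton_iff, not_or, Name.aux.injEq] at hm
  have hv' : ∀ j, Name.aux j ≠ v.name := fun j => (Val.name_ne_aux _ _).symm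
  have hrm : ∀ j, Name.aux (m + j) ≠ r := fun j => (hm (m + j) (by omega)).1
  have hrm' : Name.aux m ≠ r := hrm 0
  have hk : ∀ j, m + j ≠ k ∧ m + j ≠ k + 1 ∧ m + j ≠ k + 2 := fun j => (hm (m + j) (by omega)).2
  have hk' : m ≠ k + 2 := (hk 0).2.2
  have e₁ : cl (encExp (.var x) r k) = cl (.nus [.aux (m + 5), .aux (m + 6)]
      (out (.var x) [.aux (m + 5), .aux (m + 6)]
        (inp (.aux (m + 5)) [.aux (k + 2)] (out r [.aux (k + 2)] .zero)))) := by
    have hk5 := hk 5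
    have hk6 := hk 6
    simp only [encExp]
    rw [cl_nu, cl_nu_alpha (c := .aux (k + 1)) (d := .aux (m + 6)) trivial trivial, ← cl_nu,
      cl_nu_alpha (c := .aux k) (d := .aux (m + 5)) trivial trivial]
    · simp only [Proc.subst, Proc.subst_pre, Pre.subst, Pre.bound, fixOn, ren_singleton,
        List.map_cons, List.map_nil, List.mem_singleton, Name.aux.injEq, Proc.subst_zero,
        reduceCtorEq, if_false, if_true]
      simp [h₀, h₁, h₂, Ne.symm hk6.1, PClass.nus_cons]
    · simp [Proc.names, Proc.pre, Pre.used, Pre.bound, Proc.subst, Pre.subst, Proc.zero, fixOn, h₁,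
        h₂, hrm]
      omega
    · simp [Proc.names, Proc.pre, Pre.used, Pre.bound, Proc.zero, hrm]
      omega
  have h₁' := ev_cell_access x v m
    (C := inp (.aux (m + 5)) [.aux (k + 2)] (out r [.aux (k + 2)] .zero)) (by simp [hrm', hk'])
  have h₂' : Reds (.par (out (.aux (m + 5)) [v.name] (out (.aux m) [v.name] .zero))
      (inp (.aux (m + 5)) [.aux (k + 2)] (out r [.aux (k + 2)] .zero)))
      (.par (out (.aux m) [v.name] .zero) (out r [v.name] .zero)) := by
    refine (Reds.comm (a := .aux (m + 5)) (vs := [v.name]) (xs := [.aux (k + 2)])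
      (P := out (.aux m) [v.name] .zero) (Q := out r [.aux (k + 2)] .zero) trivial rfl
      (by simp)).trans (.refl ?_)
    simp [Proc.subst_pre, Pre.subst, Pre.bound, h₂]
  refine (h₁'.before (.refl ?_)).after ((((h₂'.par
    (R := .par (inp (.aux (m + 6)) [.aux (m + 4)] (out (.aux m) [.aux (m + 4)] .zero))
      (.repl (cellLoop (.var x) m))) (by simp [cellLoop])).nus
        (cs := [.aux (m + 5), .aux (m + 6), .aux m]) (by simp))).congr ?_ ?_)
  · rw [cl_par, e₁, ← cl_encVar x v m, cl_par]
  · simp only [cl_nus, cl_par]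
    congr 1
    ac_rfl
  -- The reply name of the branch that was used vanishes, and the other one moves inwards to the
  -- dead branch.
  · have hd := cl_nu_dead (x := x) (w := v) (m := m) (p := .aux (m + 6)) (g := .aux (m + 5))
      (D := inp (.aux (m + 6)) [.aux (m + 4)] (out (.aux m) [.aux (m + 4)] .zero))
      (Z := out r [v.name] .zero) trivial trivial (by simp) (by simp) (by simp) (by simp)
      (by simp [hv', hrm]) (by simp [hv', hrm]) (by simp [hrm', hv']) (by simp)
    rw [cl_par, ← cl_readCell x v m, readCell, deadPut, ← hd]
    simp only [cl_nus, PClass.nus_cons, PClass.nus_nil, cellBody, cl_par]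
    congr 3
    ac_rfl

/-- The writing branch refills the cell with the new value, and the reading branch is left behind.
It still carries the old value `w`, which is why `writtenCell` has two values. -/
lemma ev_cell_write {x : ℕ} (w : Val) {v : Val} {A A' : Proc Name}
    (h : (Kind.write x v).redex A A') :
    Ev ∅ Sync (.par A (encVar (.var x) w.name 0))
      (.par A' (writtenCell (.var x) w.name v.name 0)) := by
  obtain ⟨r, k, hr, h₀, h₁, rfl, rfl⟩ := h
  obtain ⟨m, hm⟩ := exists_aux_bound (X := {r, .aux k, .aux (k + 1)})
    (Set.toFinite _)
  simp only [Set.mem_insert_iff, Set.mem_singleton_iff, not_or, Name.aux.injEq] at hm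
  have hv : ∀ j, v.name ≠ .aux j := fun j => Val.name_ne_aux _ _
  have hv' : ∀ j, Name.aux j ≠ v.name := fun j => (hv j).symm
  have hw' : ∀ j, Name.aux j ≠ w.name := fun j => (Val.name_ne_aux _ _).symm
  have hrm : ∀ j, Name.aux (m + j) ≠ r := fun j => (hm (m + j) (by omega)).1
  have hrm' : Name.aux m ≠ r := hrm 0
  have hk : ∀ j, m + j ≠ k ∧ m + j ≠ k + 1 := fun j => (hm (m + j) (by omega)).2
  have e₁ : cl (writeRequest x v.name r k) = cl (.nus [.aux (m + 5), .aux (m + 6)]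
      (out (.var x) [.aux (m + 5), .aux (m + 6)]
        (out (.aux (m + 6)) [v.name] (out r [] .zero)))) := by
    have hk5 := hk 5
    have hk6 := hk 6
    simp only [writeRequest]
    rw [cl_nu, cl_nu_alpha (c := .aux (k + 1)) (d := .aux (m + 6)) trivial trivial, ← cl_nu,
      cl_nu_alpha (c := .aux k) (d := .aux (m + 5)) trivial trivial]
    · simp only [Proc.subst, Proc.subst_pre, Pre.subst, Pre.bound, fixOn, ren_singleton,
        List.map_cons, List.map_nil, List.mem_singleton, Name.aux.injEq, Proc.subst_zero,
        reduceCtorEq, if_false, if_true]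
      simp [h₀, h₁, hv, Ne.symm hk6.1, PClass.nus_cons]
    · simp [Proc.names, Proc.pre, Pre.used, Pre.bound, Proc.subst, Pre.subst, Proc.zero, fixOn, h₁,
        hv, hv', hrm]
      omega
    · simp [Proc.names, Proc.pre, Pre.used, Pre.bound, Proc.zero, hrm, hv']
      omega
  have h₁' := ev_cell_access x w m
    (C := out (.aux (m + 6)) [v.name] (out r [] .zero)) (by simp [hrm', hv'])
  have h₂' : Reds (.par (out (.aux (m + 6)) [v.name] (out r [] .zero))
      (inp (.aux (m + 6)) [.aux (m + 4)] (out (.aux m) [.aux (m + 4)] .zero)))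
      (.par (out r [] .zero) (out (.aux m) [v.name] .zero)) := by
    refine (Reds.comm (a := .aux (m + 6)) (vs := [v.name]) (xs := [.aux (m + 4)])
      (P := out r [] .zero) (Q := out (.aux m) [.aux (m + 4)] .zero) trivial rfl
      (by simp)).trans (.refl ?_)
    simp [Proc.subst_pre, Pre.subst, Pre.bound]
  refine (h₁'.before (.refl ?_)).after ((((h₂'.par
    (R := .par (out (.aux (m + 5)) [w.name] (out (.aux m) [w.name] .zero))
      (.repl (cellLoop (.var x) m))) (by simp [cellLoop])).nus
        (cs := [.aux (m + 5), .aux (m + 6), .aux m]) (by simp))).congr ?_ ?_)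
  · rw [cl_par, e₁, ← cl_encVar x w m, cl_par]
  · simp only [cl_nus, cl_par]
    congr 1
    ac_rfl
  -- Compared with a read the two reply names exchange their roles, hence the additional
  -- `PClass.nu_comm`.
  · have hd := cl_nu_dead (x := x) (w := v) (m := m) (p := .aux (m + 5)) (g := .aux (m + 6))
      (D := out (.aux (m + 5)) [w.name] (out (.aux m) [w.name] .zero))
      (Z := out r [] .zero) trivial trivial (by simp) (by simp) (by simp) (by simp)
      (by simp [hrm]) (by simp [hrm]) (by simp [hrm']) (by simp [hw'])
    rw [cl_par, ← cl_writtenCell x w v m, writtenCell, deadGet, ← hd, PClass.nu_comm]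
    simp only [cl_nus, PClass.nus_cons, PClass.nus_nil, cellBody, cl_par]
    congr 3
    ac_rfl

/-! ### Dead branches -/

/-- `d` is a dead branch of a variable cell with private name `t`. -/
def IsDead (t : Name) (d : Proc Name) : Prop :=
  (∃ p y, p.Internal ∧ p ≠ t ∧ y ≠ t ∧ d = .nu p (inp p [y] (out t [y] .zero))) ∨
  ∃ g z, g.Internal ∧ g ≠ t ∧ ¬ z.Internal ∧ d = .nu g (out g [z] (out t [z] .zero))

/-- Consequently every restriction of an internal name other than `t` can be moved past a dead
branch. -/
lemma IsDead.eq_of_mem {t a : Name} {d : Proc Name} (h : IsDead t d) (ha : a.Internal)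
    (hm : a ∈ d.freeNames) : a = t := by
  rcases h with ⟨p, y, hp, hpt, hyt, rfl⟩ | ⟨g, z, hg, hgt, hz, rfl⟩
  · simp at hm
    tauto
  · simp at hm
    have haz : a ≠ z := fun e => hz (e ▸ ha)
    tauto

lemma IsDead.rename {t : Name} {d : Proc Name} (ht : t.Internal) (h : IsDead t d) {j : ℕ}
    (hj : Name.aux j ∉ d.names) : IsDead (.aux j) (d.subst (ren [t] [.aux j])) := by
  rcases h with ⟨p, y, hp, hpt, hyt, rfl⟩ | ⟨g, z, hg, hgt, hz, rfl⟩
  · simp [Proc.names, Proc.pre, Pre.used, Pre.bound, Proc.zero] at hj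
    refine Or.inl ⟨p, y, hp, fun e => hj.1.2 e.symm, fun e => hj.1.1 e.symm, ?_⟩
    simp [Proc.subst, Proc.subst_pre, Pre.subst, Pre.bound, fixOn, hpt.symm, hyt.symm]
  · simp [Proc.names, Proc.pre, Pre.used, Pre.bound, Proc.zero] at hj
    refine Or.inr ⟨g, z, hg, fun e => hj.1.1 e.symm, hz, ?_⟩
    have hzt : z ≠ t := fun e => hz (e ▸ ht)
    have hzg : z ≠ g := fun e => hz (e ▸ hg)
    simp [Proc.subst, Proc.subst_pre, Pre.subst, Pre.bound, fixOn, hgt.symm, hzt, hzg]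

/-- `P` is `Q` with an additional dead branch of a variable cell. -/
def Dead (P Q : Proc Name) : Prop :=
  ∃ t d T, t.Internal ∧ IsDead t d ∧ cl P = cl (.nu t (.par d T)) ∧ cl Q = cl (.nu t T)

namespace Dead

variable {P Q R : Proc Name}

/-- The private name of the cell is α-converted out of the way of a context, so that its scope can
be extended. -/
lemma exists_fresh (h : Dead P Q) {X : Set Name} (hX : X.Finite) :
    ∃ t d T, t.Internal ∧ t ∉ X ∧ IsDead t d ∧ cl P = cl (.nu t (.par d T)) ∧
      cl Q = cl (.nu t T) := by
  obtain ⟨t, d, T, ht, hd, hP, hQ⟩ := h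
  obtain ⟨j, hj⟩ := Go.exists_fresh ((hX.union d.names_finite).union T.names_finite)
  simp only [Set.mem_union, not_or] at hj
  refine ⟨.aux j, d.subst (ren [t] [.aux j]), T.subst (ren [t] [.aux j]), trivial, hj.1.1,
    hd.rename ht hj.1.2, ?_, ?_⟩
  · rw [hP, cl_nu_alpha ht (Name.internal_aux j) (P := .par d T)
      (fun h => Or.elim h hj.1.2 hj.2), Proc.subst]
  · rw [hQ, cl_nu_alpha ht (Name.internal_aux j) hj.2]

lemma congr {P' Q' : Proc Name} (h : Dead P Q) (e : cl P' = cl P) (e' : cl Q' = cl Q) :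
    Dead P' Q' := by
  obtain ⟨t, d, T, ht, hd, hP, hQ⟩ := h
  exact ⟨t, d, T, ht, hd, e.trans hP, e'.trans hQ⟩

lemma par (h : Dead P Q) (R : Proc Name) : Dead (.par P R) (.par Q R) := by
  obtain ⟨t, d, T, ht, hf, hd, hP, hQ⟩ := h.exists_fresh R.names_finite
  have hR : t ∉ R.freeNames := fun h => hf (Proc.freeNames_subset_names _ h)
  refine ⟨t, d, .par T R, ht, hd, ?_, ?_⟩
  · rw [cl_par, hP, cl_nu, ← nu_mul ht _ hR, cl_nu]
    simp only [cl_par, mul_assoc]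
  · rw [cl_par, hQ, cl_nu, ← nu_mul ht _ hR, cl_nu, cl_par]

lemma nu (h : Dead P Q) {c : Name} (hc : c.Internal) : Dead (.nu c P) (.nu c Q) := by
  obtain ⟨t, d, T, ht, hf, hd, hP, hQ⟩ := h.exists_fresh (Set.finite_singleton c)
  refine ⟨t, d, .nu c T, ht, hd, ?_, ?_⟩
  · have hcd : c ∉ d.freeNames := fun h => hf (hd.eq_of_mem hc h).symm
    simp only [cl_nu, cl_par, hP]
    rw [PClass.nu_comm, mul_comm (cl d), mul_comm (cl d), nu_mul hc _ hcd]
  · rw [cl_nu, hQ, cl_nu, PClass.nu_comm, cl_nu, cl_nu]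

lemma nus (h : Dead P Q) {cs : List Name} (hc : ∀ c ∈ cs, c.Internal) :
    Dead (.nus cs P) (.nus cs Q) := by
  induction cs with
  | nil => exact h
  | cons c cs ih => exact (ih fun d hd => hc d (List.mem_cons_of_mem _ hd)).nu (hc c (by simp))

end Dead

lemma dead_readCell (x v : Name) : Dead (readCell x v 0) (encVar x v 0) :=
  ⟨.aux 0, deadPut 0, cellBody x v 0, trivial,
    Or.inl ⟨.aux 6, .aux 4, trivial, by simp, by simp, rfl⟩, rfl, rfl⟩

lemma dead_writtenCell (x : Name) (w v : Val) :
    Dead (writtenCell x w.name v.name 0) (encVar x v.name 0) :=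
  ⟨.aux 0, deadGet w.name 0, cellBody x v.name 0, trivial,
    Or.inr ⟨.aux 5, w.name, trivial, by simp, w.not_internal_name, rfl⟩, rfl, rfl⟩

/-! ### Go-routines -/

/-- `toList` chooses an arbitrary enumeration of a multiset; in a commutative monoid the product is
independent of it. -/
lemma cl_prod_toList {ι : Type} (s : Multiset ι) (f : ι → Proc Name) :
    cl (.prod (s.toList.map f)) = (s.map fun i => cl (f i)).prod := by
  conv_rhs => rw [← Multiset.coe_toList s]
  rw [cl_prod, Multiset.map_coe, Multiset.prod_coe, List.map_map]
  rfl

lemma cl_encStore_insert {σ : Store} {x : ℕ} (hx : x ∉ σ) (w : Val) :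
    cl (encStore (σ.insert x w)) = cl (encVar (.var x) w.name 0) * cl (encStore σ) := by
  rw [encStore, encStore, cl_prod_toList, cl_prod_toList, Finmap.entries_insert_of_notMem hx,
    Multiset.map_cons, Multiset.prod_cons]

lemma perm_vars_insert {σ : Store} {x : ℕ} (hx : x ∉ σ) (w : Val) :
    ((σ.insert x w).entries.toList.map fun q => Name.var q.1).Perm
      (.var x :: σ.entries.toList.map fun q => Name.var q.1) := by
  rw [← Multiset.coe_eq_coe, ← Multiset.cons_coe, ← Multiset.map_coe, ← Multiset.map_coe,
    Multiset.coe_toList, Multiset.coe_toList, Finmap.entries_insert_of_notMem hx,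
    Multiset.map_cons]

/-- Splits off one entry, so that its cell, or its declaration, becomes a separate factor. -/
lemma exists_insert_of_lookup {α : Type} {σ : Finmap fun _ : ℕ => α} {x : ℕ} {w : α}
    (h : σ.lookup x = some w) : ∃ τ : Finmap fun _ : ℕ => α, x ∉ τ ∧ σ = τ.insert x w := by
  refine ⟨σ.erase x, Finmap.notMem_erase_self, Finmap.ext_lookup fun y => ?_⟩
  by_cases hy : y = x
  · subst hy
    rw [h, Finmap.lookup_insert]
  · rw [Finmap.lookup_insert_of_ne _ hy, Finmap.lookup_erase_ne hy]

lemma mem_freeNames_encStore {σ : Store} {a : Name} (h : a ∈ (encStore σ).freeNames) :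
    ∃ x v, σ.lookup x = some v ∧ (a = .var x ∨ a = v.name) := by
  simp only [encStore, Proc.mem_freeNames_prod, List.mem_map, Multiset.mem_toList] at h
  obtain ⟨P, ⟨p, hp, rfl⟩, ha⟩ := h
  exact ⟨p.1, p.2, Finmap.lookup_eq_some_iff.2 hp, mem_freeNames_encVar ha⟩

/-- An access to the variable `x`, whose cell `V` becomes `V'`. -/
lemma ev_routine_access {s s' : Stm} {σ : Store} {x : ℕ} {w v : Val} {κ : Kind} (hx : x ∉ σ)
    {V' : Proc Name}
    (hs : Ev ∅ κ.redex (encStm s (.aux 0) 1) (encStm s' (.aux 0) 1))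
    (hV : ∀ A A', κ.redex A A' → Ev ∅ Sync (.par A (encVar (.var x) w.name 0)) (.par A' V'))
    (hV' : Normal V') (hd : Dead V' (encVar (.var x) v.name 0)) :
    ∃ P, Ev ∅ Sync (encRoutine (s, σ.insert x w)) P ∧
      Dead P (encRoutine (s', σ.insert x v)) := by
  have hs' : Ev ∅ κ.redex (.nu (.aux 0) (encStm s (.aux 0) 1))
      (.nu (.aux 0) (encStm s' (.aux 0) 1)) := hs.nu trivial (κ.stable trivial (by simp))
  obtain ⟨N₁, N₂, h₁, h₂, h₃⟩ := hs'
  -- The redex meets its cell below the restrictions that expose it, and there `hV` turns it into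
  -- communications.
  have hf : Ev ∅ Sync (.par N₁ (encVar (.var x) w.name 0)) (.par N₂ V') := (h₂.join hV).flatten_ev
  have hvs : ∀ c ∈ (.var x :: σ.entries.toList.map fun q => Name.var q.1), Name.Internal c := by
    intro c hc
    rcases List.mem_cons.1 hc with rfl | hc
    · trivial
    · obtain ⟨q, -, rfl⟩ := List.mem_map.1 hc
      trivial
  have hg := (((hf.before (h₁.par (by simp))).after (h₃.par hV')).par (R := encStore σ) (by simp)
    (by simp)).nus fun c hc => ⟨hvs c hc, Sync.stable c⟩
  refine ⟨_, hg.before (.refl ?_), (((hd.par (encStore σ)).par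
    (.nu (.aux 0) (encStm s' (.aux 0) 1))).nus hvs).congr ?_ ?_⟩
  · rw [encRoutine, cl_nus, PClass.nus_perm (perm_vars_insert hx w), cl_par,
      cl_encStore_insert hx]
    simp only [cl_nus, cl_par, mul_assoc]
  · simp only [cl_nus, cl_par]
    congr 1
    ac_rfl
  · rw [encRoutine, cl_nus, PClass.nus_perm (perm_vars_insert hx v), cl_par,
      cl_encStore_insert hx]
    simp only [cl_nus, cl_par]
    congr 1
    ac_rfl

/-- The behaviour of the encoding of a Go-routine. -/
theorem LStep.routine {s s' : Stm} {σ σ' : Store} {δ δ' : ChanStore} {α : LAct}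
    (h : LStep s σ δ α s' σ' δ') (hv : ∀ x ∈ s.vars, x ∈ σ) :
    ∃ κ : Kind, κ.Effect σ δ α σ' δ' ∧
      ((s.AccessesNext ∧ δ' = δ ∧ α = .tau ∧ ∃ P, Ev ∅ Sync (encRoutine (s, σ)) P ∧
          Dead P (encRoutine (s', σ'))) ∨
        (¬ κ.Accesses ∧ ∀ W : Set ℕ, (∀ w ∈ W, w ∉ s.chans ∧ ∀ x v, σ.lookup x = some v →
          w ∉ v.chans) → Ev W κ.redex (encRoutine (s, σ)) (encRoutine (s', σ')))) := by
  obtain ⟨κ, hκ, hacc, hwr, hev⟩ := h.exists_kind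
  refine ⟨κ, hκ, ?_⟩
  have hev' := fun W hW => hev W (.aux 0) 1 trivial (below_aux Nat.one_pos) hW
  -- A redex that is independent of variables can be exposed through the restrictions of the
  -- variables, without the help of any cell.
  have hrest : (∀ y, κ.Avoids (.var y)) → σ' = σ → ∀ W : Set ℕ,
      (∀ w ∈ W, w ∉ s.chans ∧ ∀ x v, σ.lookup x = some v → w ∉ v.chans) →
      Ev W κ.redex (encRoutine (s, σ)) (encRoutine (s', σ')) := by
    rintro hav rfl W hW
    refine (((hev' W fun w hw => (hW w hw).1).nu (c := .aux 0) trivial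
      (κ.stable trivial (by simp))).par
      (by simp) fun w hw hf => ?_).nus fun c hc => ?_
    · obtain ⟨x, v, hl, he | he⟩ := mem_freeNames_encStore hf
      · simp at he
      · refine (hW w hw).2 x v hl ?_
        cases v with
        | int n => simp [Val.name] at he
        | chan ch =>
          simp only [Val.name, Name.chan.injEq] at he
          exact he
    · obtain ⟨q, -, rfl⟩ := List.mem_map.1 hc
      exact ⟨trivial, κ.stable trivial (hav _)⟩
  cases κ with
  | read x v =>
    obtain ⟨hl, rfl, rfl, rfl⟩ := hκ
    obtain ⟨τ, hτ, rfl⟩ := exists_insert_of_lookup hl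
    exact Or.inl ⟨hacc trivial, rfl, rfl, ev_routine_access hτ (hev' ∅ (by simp))
      (fun _ _ => ev_cell_read) (by simp) (dead_readCell _ _)⟩
  | write x v =>
    obtain ⟨rfl, rfl, rfl⟩ := hκ
    -- A variable that is written is declared, so it already has a cell, with some old value `w`.
    obtain ⟨w, hw⟩ := Finmap.mem_iff.1 (hv x (hwr x v rfl))
    obtain ⟨τ, hτ, rfl⟩ := exists_insert_of_lookup hw
    rw [Finmap.insert_insert]
    exact Or.inl ⟨hacc trivial, rfl, rfl, ev_routine_access hτ (hev' ∅ (by simp))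
      (fun _ _ => ev_cell_write w) (by simp) (dead_writtenCell _ _ _)⟩
  | make n ch => exact Or.inr ⟨id, hrest (fun _ => trivial) hκ.2.2.1⟩
  | recv ch v => exact Or.inr ⟨id, hrest (fun _ => trivial) hκ.1⟩
  | send ch v => exact Or.inr ⟨id, hrest (fun _ => trivial) hκ.1⟩
  | go f vs => exact Or.inr ⟨id, hrest (fun _ => by simp [Kind.Avoids]) hκ.2.1⟩

end Go

namespace Go

open PiB

/-! ### Function calls -/

lemma dedupKeys_eq_self {l : List (Sigma fun _ : ℕ => Val)} (h : l.NodupKeys) :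
    l.dedupKeys = l := by
  induction l with
  | nil => rfl
  | cons p l ih =>
    obtain ⟨h₁, h₂⟩ := List.nodupKeys_cons.1 h
    rw [List.dedupKeys_cons, ih h₂, List.kinsert_def, List.kerase_of_notMem_keys h₁]

/-- As the parameters are distinct, no entry overwrites another. With a repeated parameter the
encoded body would create two cells for a variable that has only one entry in the store. -/
lemma entries_argStore {xs : List ℕ} {vs : List Val} (hx : xs.Nodup) (hl : xs.length = vs.length) :
    (argStore xs vs).entries =
      ((xs.zip vs).map fun p => (⟨p.1, p.2⟩ : Sigma fun _ : ℕ => Val) : List _) := by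
  have : ((xs.zip vs).map fun p => (⟨p.1, p.2⟩ : Sigma fun _ : ℕ => Val)).NodupKeys := by
    rw [List.NodupKeys, List.keys, List.map_map]
    have e : (Sigma.fst ∘ fun p : ℕ × Val => (⟨p.1, p.2⟩ : Sigma fun _ : ℕ => Val)) = Prod.fst := rfl
    rw [e, List.map_fst_zip hl.le]
    exact hx
  rw [argStore, List.toFinmap, AList.toFinmap_entries]
  exact congrArg _ (dedupKeys_eq_self this)

/-- The body of the encoding of a function. -/
def funBody (d : FuncDef) : Proc Name :=
  .nus (d.params.map Name.var)
    (.par (.prod (d.params.zipIdx.map fun p => encVar (.var p.1) (.aux p.2) d.params.length))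
      (.nu (.aux d.params.length) (encStm d.body (.aux d.params.length) (d.params.length + 1))))

lemma encFun_eq (f : ℕ) (d : FuncDef) : encFun f d =
    .repl (inp (.fn f) ((List.range d.params.length).map Name.aux) (funBody d)) := rfl

lemma wf_funBody (d : FuncDef) : WF (funBody d) := by
  simp only [funBody, wf_nus, wf_par, wf_prod, wf_nu, wf_encStm, and_true]
  refine ⟨?_, ?_, trivial⟩
  · intro c hc
    obtain ⟨x, -, rfl⟩ := List.mem_map.1 hc
    trivial
  · intro P hP
    obtain ⟨p, -, rfl⟩ := List.mem_map.1 hP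
    exact wf_encVar _ _ _

lemma normal_funBody (d : FuncDef) : Normal (funBody d) := by
  simp only [funBody, normal_nus, normal_par, normal_prod, normal_nu, normal_encStm, and_true]
  refine ⟨?_, ?_, trivial⟩
  · intro c hc
    obtain ⟨x, -, rfl⟩ := List.mem_map.1 hc
    trivial
  · intro P hP
    obtain ⟨p, -, rfl⟩ := List.mem_map.1 hP
    simp

lemma subst_prod (σ : Name → Name) (Ps : List (Proc Name)) :
    (Proc.prod Ps).subst σ = .prod (Ps.map fun P => P.subst σ) := by
  induction Ps with
  | nil => simp
  | cons P Ps ih => rw [Proc.prod_cons, Proc.subst, ih, List.map_cons, Proc.prod_cons]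

lemma subst_encVar {σ : Name → Name} {x i n : ℕ} {w : Name} (hx : σ (.var x) = .var x)
    (hi : i < n) (hw : σ (.aux i) = w) :
    (encVar (.var x) (.aux i) n).subst σ = encVar (.var x) w n := by
  have : i ≠ n := hi.ne
  simp [encVar, Proc.subst, Proc.subst_pre, Pre.subst, Pre.bound, fixOn, hx, hw, this]

/-- An instance of a function body is a Go-routine. -/
lemma cl_funBody_subst {d : FuncDef} {vs : List Val} (hd : d.params.Nodup)
    (hl : d.params.length = vs.length) :
    cl ((funBody d).subst (ren ((List.range d.params.length).map Name.aux) (vs.map Val.name))) =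
      cl (encRoutine (d.body, argStore d.params vs)) := by
  set n := d.params.length with hn
  set σ := ren ((List.range n).map Name.aux) (vs.map Val.name) with hσ
  have hσ₁ : ∀ a : Name, (∀ j, j < n → a ≠ .aux j) → σ a = a := by
    intro a ha
    refine ren_of_notMem fun hm => ?_
    obtain ⟨j, hj, rfl⟩ := List.mem_map.1 hm
    exact ha j (List.mem_range.1 hj) rfl
  have hσ₂ : ∀ j (hj : j < vs.length), σ (.aux j) = vs[j].name := by
    intro j hj
    have := ren_auxs (k := 0) (j := j) (vs := vs) hl.symm (List.getElem?_eq_getElem hj)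
    simpa using this
  have e₁ : fixOn σ (d.params.map Name.var) = σ := by
    refine fixOn_eq_self fun a ha => hσ₁ a ?_
    obtain ⟨x, -, rfl⟩ := List.mem_map.1 ha
    simp
  have e₂ : ((d.params.zipIdx.map fun p => encVar (.var p.1) (.aux p.2) n).map fun P =>
      P.subst σ) = (d.params.zip vs).map fun q => encVar (.var q.1) q.2.name n := by
    refine List.ext_getElem (by simp [← hn, hl]) fun j h₁ h₂ => ?_
    have hj : j < n := by simpa using h₁
    simp only [List.getElem_map, List.getElem_zipIdx, List.getElem_zip, Nat.zero_add]
    exact subst_encVar (hσ₁ _ (by simp)) hj (hσ₂ j (hl ▸ hj))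
  -- The body has no free auxiliary name: arguments reach it only through the cells of its
  -- parameters.
  have e₃ : (Proc.nu (.aux n) (encStm d.body (.aux n) (n + 1))).subst σ =
      .nu (.aux n) (encStm d.body (.aux n) (n + 1)) := by
    refine Proc.subst_eq_self fun a ha => hσ₁ a ?_
    rintro j hj rfl
    rcases mem_freeNames_encStm ha.1 with h | h
    · exact ha.2 h
    · exact h
  rw [funBody, Proc.subst_nus, e₁, Proc.subst, subst_prod, e₂, e₃, encRoutine, cl_nus, cl_par,
    cl_nu_encStm, cl_nus, cl_par, encStore, cl_prod_toList]
  simp only [entries_argStore hd hl, Multiset.map_coe, Multiset.prod_coe, List.map_map]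
  have hp : ((argStore d.params vs).entries.toList.map fun q => Name.var q.1).Perm
      (d.params.map Name.var) := by
    rw [← Multiset.coe_eq_coe, ← Multiset.map_coe, Multiset.coe_toList, entries_argStore hd hl,
      Multiset.map_coe, List.map_map]
    have e : (fun q : Sigma fun _ : ℕ => Val => Name.var q.1) ∘
        (fun p : ℕ × Val => (⟨p.1, p.2⟩ : Sigma fun _ : ℕ => Val)) = Name.var ∘ Prod.fst := rfl
    rw [e, ← List.map_map, List.map_fst_zip hl.le]
  rw [entries_argStore hd hl] at hp
  rw [PClass.nus_perm hp, mul_comm, cl_prod, List.map_map]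
  congr 3
  refine List.map_congr_left fun q _ => ?_
  exact cl_encVar _ _ _

/-! ### Systems of Go-routines -/

/-- The Go-routines of a configuration together with the function declarations. -/
noncomputable def soup (δf : FunEnv) (Γ : Multiset (Stm × Store)) : Proc Name :=
  .par (.prod (Γ.toList.map encRoutine)) (encFunEnv δf)

/-- The names of the functions. -/
noncomputable def fns (δf : FunEnv) : List Name := δf.entries.toList.map fun p => Name.fn p.1

lemma internal_of_mem_fns {δf : FunEnv} {c : Name} (h : c ∈ fns δf) : c.Internal := by
  obtain ⟨p, -, rfl⟩ := List.mem_map.1 h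
  trivial

@[simp] lemma normal_soup (δf : FunEnv) (Γ : Multiset (Stm × Store)) : Normal (soup δf Γ) := by
  simp only [soup, normal_par, normal_prod, normal_encFunEnv, and_true, List.mem_map]
  rintro P ⟨p, -, rfl⟩
  simp

lemma cl_soup_cons (δf : FunEnv) (p : Stm × Store) (Γ : Multiset (Stm × Store)) :
    cl (soup δf (p ::ₘ Γ)) = cl (encRoutine p) * cl (soup δf Γ) := by
  simp only [soup, cl_par, cl_prod_toList, Multiset.map_cons, Multiset.prod_cons, mul_assoc]

lemma mem_chans_of_mem_encRoutine {p : Stm × Store} {w : ℕ}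
    (h : Name.chan w ∈ (encRoutine p).freeNames) :
    w ∈ p.1.chans ∨ ∃ x v, p.2.lookup x = some v ∧ w ∈ v.chans := by
  simp only [encRoutine, Proc.mem_freeNames_nus, Proc.mem_freeNames_par,
    Proc.mem_freeNames_nu] at h
  rcases h.1 with ⟨h, -⟩ | h
  · rcases mem_freeNames_encStm h with h | h
    · simp at h
    · exact Or.inl h
  · obtain ⟨x, v, hl, he | he⟩ := mem_freeNames_encStore h
    · simp at he
    · refine Or.inr ⟨x, v, hl, ?_⟩
      cases v with
      | int n => simp [Val.name] at he
      | chan ch =>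
        simp only [Val.name, Name.chan.injEq] at he
        exact he

lemma mem_chans_of_mem_encFunEnv {δf : FunEnv} {w : ℕ}
    (h : Name.chan w ∈ (encFunEnv δf).freeNames) :
    ∃ f d, δf.lookup f = some d ∧ w ∈ d.body.chans := by
  simp only [encFunEnv, Proc.mem_freeNames_prod, List.mem_map, Multiset.mem_toList] at h
  obtain ⟨P, ⟨p, hp, rfl⟩, ha⟩ := h
  refine ⟨p.1, p.2, Finmap.lookup_eq_some_iff.2 hp, ?_⟩
  simp only [encFun, Proc.mem_freeNames_repl, Proc.mem_freeNames_inp, reduceCtorEq, false_or,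
    Proc.mem_freeNames_nus, Proc.mem_freeNames_par, Proc.mem_freeNames_nu,
    Proc.mem_freeNames_prod, List.mem_map] at ha
  rcases ha.1.1 with ⟨P, ⟨q, -, rfl⟩, h⟩ | ⟨h, -⟩
  · rcases mem_freeNames_encVar h with h | h <;> simp at h
  · rcases mem_freeNames_encStm h with h | h
    · simp at h
    · exact h

lemma chan_notMem_soup {δf : FunEnv} {Γ : Multiset (Stm × Store)} {δ : ChanStore} {w : ℕ}
    (h : ¬ Occurs δf ⟨Γ, δ⟩ w) : Name.chan w ∉ (soup δf Γ).freeNames := by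
  rintro (hf | hf)
  · obtain ⟨P, hP, hf⟩ := Proc.mem_freeNames_prod.1 hf
    obtain ⟨p, hp, rfl⟩ := List.mem_map.1 hP
    exact h (Or.inl ⟨p, Multiset.mem_toList.1 hp, mem_chans_of_mem_encRoutine hf⟩)
  · exact h (Or.inr (Or.inr (Or.inr (mem_chans_of_mem_encFunEnv hf))))

lemma wf_encRoutine (p : Stm × Store) : WF (encRoutine p) := by
  simp only [encRoutine, wf_nus, wf_par, wf_nu, wf_encStm, encStore, wf_prod, List.mem_map,
    and_true]
  refine ⟨?_, trivial, ?_⟩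
  · rintro c ⟨q, -, rfl⟩
    trivial
  · rintro P ⟨q, -, rfl⟩
    exact wf_encVar _ _ _

lemma wf_soup (δf : FunEnv) (Γ : Multiset (Stm × Store)) : WF (soup δf Γ) := by
  simp only [soup, wf_par, wf_prod, List.mem_map, encFunEnv]
  refine ⟨?_, ?_⟩
  · rintro P ⟨p, -, rfl⟩
    exact wf_encRoutine p
  · rintro P ⟨p, -, rfl⟩
    rw [encFun_eq, wf_repl, wf_inp]
    refine ⟨?_, ?_, wf_funBody _⟩
    · simpa using nodup_auxs 0 p.2.params.length
    · simp

/-- A step of one Go-routine in its context. -/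
lemma Ev.soup {δf : FunEnv} {W : Set ℕ} {ρ : Redex} {p : Stm × Store} {P : Proc Name}
    (h : Ev W ρ (encRoutine p) P) (hρ : ∀ f, Stable ρ (.fn f)) {Γ : Multiset (Stm × Store)}
    (hW : ∀ w ∈ W, Name.chan w ∉ (soup δf Γ).freeNames) :
    Ev W ρ (.nus (fns δf) (soup δf (p ::ₘ Γ))) (.nus (fns δf) (.par P (Go.soup δf Γ))) := by
  refine ((h.par (normal_soup δf Γ) hW).nus fun c hc => ?_).before (.refl ?_)
  · obtain ⟨p, -, rfl⟩ := List.mem_map.1 hc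
    exact ⟨trivial, hρ _⟩
  · rw [cl_nus, cl_soup_cons, cl_nus, cl_par]

lemma cl_nus_soup_cons (δf : FunEnv) (p : Stm × Store) (Γ : Multiset (Stm × Store)) :
    cl (.nus (fns δf) (.par (encRoutine p) (soup δf Γ))) =
      cl (.nus (fns δf) (soup δf (p ::ₘ Γ))) := by
  rw [cl_nus, cl_nus, cl_soup_cons, cl_par]

/-- A sender and a receiver for the same channel and value. -/
def Com (ch : ℕ) (v : Val) (A A' : Proc Name) : Prop :=
  ∃ A₁ A₁' A₂ A₂', (Kind.recv ch v).redex A₁ A₁' ∧ (Kind.send ch v).redex A₂ A₂' ∧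
    A = .par A₂ A₁ ∧ A' = .par A₂' A₁'

lemma Com.stable (ch : ℕ) (v : Val) {c : Name} (hc : c.Internal) : Stable (Com ch v) c := by
  rintro A A' ⟨A₁, A₁', A₂, A₂', h₁, h₂, rfl, rfl⟩
  obtain ⟨Y₁, hY₁, g₁⟩ := (Kind.recv ch v).stable hc trivial _ _ h₁
  obtain ⟨Y₂, hY₂, g₂⟩ := (Kind.send ch v).stable hc trivial _ _ h₂
  refine ⟨Y₁ ∪ Y₂, hY₁.union hY₂, fun d hd => ?_⟩
  exact ⟨_, _, _, _, g₁ d fun h => hd (Or.inl h), g₂ d fun h => hd (Or.inr h), rfl, rfl⟩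

/-- Processes that expose redexes with normal residuals are congruent to normal ones. -/
lemma Foc.exists_normal {W : Set ℕ} {ρ : Redex} {P P' : Proc Name} (h : Foc W ρ P P')
    (hρ : ∀ A A', ρ A A' → Normal A ∧ Normal A') :
    ∃ Q Q', Normal Q ∧ Normal Q' ∧ cl P = cl Q ∧ cl P' = cl Q' := by
  obtain ⟨as, A, A', K, h₁, h₂, -, h₄, h₅, h₆⟩ := h ∅ Set.finite_empty
  have hN := hρ _ _ h₄
  have hK := Normal.of_newGuarded h₂
  exact ⟨_, _, normal_nus.2 ⟨fun c hc => (h₁ c hc).1, normal_par.2 ⟨hN.1, hK⟩⟩,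
    normal_nus.2 ⟨fun c hc => (h₁ c hc).1, normal_par.2 ⟨hN.2, hK⟩⟩, h₅, h₆⟩

/-- The receiver and the sender do their internal communications one after the other, then their
redexes are joined, and then both continue. The intermediate processes are known only up to
congruence, so they are replaced by normal ones before they serve as contexts. -/
lemma Ev.com {ch : ℕ} {v : Val} {P P' Q Q' : Proc Name} (hP : Ev ∅ (Kind.recv ch v).redex P P')
    (hQ : Ev ∅ (Kind.send ch v).redex Q Q') (hQN : Normal Q) (hQN' : Normal Q') :
    Ev ∅ (Com ch v) (.par P Q) (.par P' Q') := by
  obtain ⟨P₁, P₂, r₁, f, r₂⟩ := hP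
  obtain ⟨Q₁, Q₂, s₁, g, s₂⟩ := hQ
  obtain ⟨N₁, N₂, n₁, n₂, e₁, e₂⟩ := f.exists_normal (by
    rintro A A' ⟨n, π, R, j, z, rfl, -, -, h, rfl⟩
    exact ⟨trivial, h.subst _⟩)
  obtain ⟨M₁, M₂, m₁, m₂, d₁, d₂⟩ := g.exists_normal (by
    rintro A A' ⟨n, π, R, j, rfl, -, h, rfl⟩
    exact ⟨trivial, h⟩)
  refine ⟨.par P₁ Q₁, .par P₂ Q₂, ?_, ?_, ?_⟩
  · refine (r₁.par hQN).trans ((s₁.par n₁).congr ?_ ?_)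
    · rw [cl_par, cl_par, e₁, mul_comm]
    · rw [cl_par, cl_par, e₁, mul_comm]
  -- First the receiving redex is exposed, and next to it the sending one.
  · refine Foc.flatten (f.join fun A A' hA => ?_)
    refine (g.join (R := A) (R' := A') fun B B' hB => ?_).congr (by simp [mul_comm])
      (by simp [mul_comm])
    exact ⟨_, _, _, _, hA, hB, rfl, rfl⟩
  · refine ((s₂.par n₂).congr (P' := .par P₂ Q₂) (Q' := .par P₂ Q') ?_ ?_).trans (r₂.par hQN')
    · rw [cl_par, cl_par, e₂, mul_comm]
    · rw [cl_par, cl_par, e₂, mul_comm]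

lemma Ev.soup_com {δf : FunEnv} {ch : ℕ} {v : Val} {p p' q q' : Stm × Store}
    (hp : Ev ∅ (Kind.recv ch v).redex (encRoutine p) (encRoutine p'))
    (hq : Ev ∅ (Kind.send ch v).redex (encRoutine q) (encRoutine q'))
    (Γ : Multiset (Stm × Store)) :
    Ev ∅ (Com ch v) (.nus (fns δf) (Go.soup δf (p ::ₘ q ::ₘ Γ)))
      (.nus (fns δf) (Go.soup δf (p' ::ₘ q' ::ₘ Γ))) := by
  have h := ((hp.com hq (by simp) (by simp)).par (normal_soup δf Γ) (by simp)).nus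
    fun c hc => ⟨internal_of_mem_fns (δf := δf) hc, Com.stable ch v (internal_of_mem_fns hc)⟩
  refine (h.before (.refl ?_)).after (.refl ?_) <;>
  simp only [cl_nus, cl_par, cl_soup_cons, mul_assoc]

/-- A replicated declaration supplies a copy of its input and is still available afterwards. -/
lemma cl_encFunEnv_unfold {δf : FunEnv} {f : ℕ} {d : FuncDef} (h : δf.lookup f = some d) :
    cl (encFunEnv δf) = cl (inp (.fn f) ((List.range d.params.length).map Name.aux) (funBody d)) *
      cl (encFunEnv δf) := by
  obtain ⟨τ, hτ, rfl⟩ := exists_insert_of_lookup h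
  rw [encFunEnv, cl_prod_toList, Finmap.entries_insert_of_notMem hτ, Multiset.map_cons,
    Multiset.prod_cons, encFun_eq, ← mul_assoc, ← cl_repl]

/-- The call communicates with a copy of the declaration over the function name. By
`cl_funBody_subst` the instantiated body is the encoding of the new routine. -/
lemma Ev.soup_go {δf : FunEnv} {f : ℕ} {vs : List Val} {d : FuncDef} {p p' : Stm × Store}
    (h : Ev ∅ (Kind.go f vs).redex (encRoutine p) (encRoutine p')) (hf : δf.lookup f = some d)
    (hd : d.params.Nodup) (hl : d.params.length = vs.length) (Γ : Multiset (Stm × Store)) :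
    Ev ∅ Sync (.nus (fns δf) (Go.soup δf (p ::ₘ Γ)))
      (.nus (fns δf) (Go.soup δf (p' ::ₘ (d.body, argStore d.params vs) ::ₘ Γ))) := by
  have hj := h.join (ρ' := Sync)
    (R := inp (.fn f) ((List.range d.params.length).map Name.aux) (funBody d))
    (R' := (funBody d).subst (ren ((List.range d.params.length).map Name.aux) (vs.map Val.name)))
    (by simp) ((normal_funBody d).subst _) (by
      intro A A' hA
      obtain rfl : A = _ := hA
      refine ⟨.fn f, _, _, A', funBody d, trivial, by simp [hl], ?_, rfl, rfl⟩
      intro v hv hb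
      obtain ⟨w, -, rfl⟩ := List.mem_map.1 hv
      exact w.not_internal_name ((wf_funBody d).internal_of_mem_boundNames hb))
  have h' := (hj.par (normal_soup δf Γ) (by simp)).nus
    fun c hc => ⟨internal_of_mem_fns (δf := δf) hc, Sync.stable c⟩
  refine (h'.before (.refl ?_)).after (.refl ?_)
  · simp only [cl_nus, cl_soup_cons, cl_par]
    congr 1
    simp only [Go.soup, cl_par]
    conv_lhs => rw [cl_encFunEnv_unfold hf]
    ac_rfl
  · simp only [cl_nus, cl_par, cl_soup_cons, cl_funBody_subst hd hl, mul_assoc]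

end Go

namespace Go

open PiB

/-! ### Buffer stores -/

/-- A value in a buffer, where the names of the channels in `H` are marked. -/
def entry (H : List ℕ) : Val → Obj Name
  | .int n => .free (.int n)
  | .chan ch => if ch ∈ H then .priv (.chan ch) else .free (.chan ch)

/-- The buffer store of a channel store, where the names of the channels in `H` are marked. -/
def store (δ : ChanStore) (H : List ℕ) : BufStore Name
  | .chan ch => match δ.lookup ch with
    | some (n + 1, l, _) => some (n.succPNat, l.map (entry H))
    | _ => none
  | _ => none

lemma entry_of_notMem {H : List ℕ} {v : Val} (h : ∀ ch ∈ H, v ≠ .chan ch) :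
    entry H v = .free v.name := by
  cases v with
  | int n => rfl
  | chan ch => rw [entry, if_neg fun hm => h ch hm rfl]; rfl

lemma name_entry (H : List ℕ) (v : Val) : (entry H v).name = v.name := by
  cases v with
  | int n => rfl
  | chan ch => rw [entry]; split_ifs <;> rfl

lemma store_chan {δ : ChanStore} (H : List ℕ) {ch n : ℕ} {l : List Val} {g : Bool}
    (h : δ.lookup ch = some (n + 1, l, g)) :
    store δ H (.chan ch) = some (n.succPNat, l.map (entry H)) := by
  rw [store, h]

lemma store_chan_zero {δ : ChanStore} (H : List ℕ) {ch : ℕ} {l : List Val} {g : Bool}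
    (h : δ.lookup ch = some (0, l, g)) : store δ H (.chan ch) = none := by
  rw [store, h]

lemma store_chan_none {δ : ChanStore} (H : List ℕ) {ch : ℕ} (h : δ.lookup ch = none) :
    store δ H (.chan ch) = none := by
  rw [store, h]

lemma store_eq_some {δ : ChanStore} {H : List ℕ} {a : Name} {p : ℕ+ × List (Obj Name)}
    (h : store δ H a = some p) : ∃ ch n l g, a = .chan ch ∧ δ.lookup ch = some (n + 1, l, g) ∧
      p = (n.succPNat, l.map (entry H)) := by
  cases a with
  | chan ch =>
    rcases e : δ.lookup ch with _ | ⟨_ | n, l, g⟩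
    · rw [store_chan_none H e] at h
      cases h
    · rw [store_chan_zero H e] at h
      cases h
    · rw [store_chan H e, Option.some.injEq] at h
      exact ⟨ch, n, l, g, rfl, e, h.symm⟩
  | int n => cases h
  | var n => cases h
  | fn n => cases h
  | aux n => cases h

lemma good_store (δ : ChanStore) (H : List ℕ) : Good (store δ H) := by
  have key : ∀ b n l o, store δ H b = some (n, l) → o ∈ l → ¬ o.name.Internal := by
    intro b n l o h ho
    obtain ⟨ch, m, l', g, -, -, e⟩ := store_eq_some h
    rw [Prod.mk.injEq] at e
    rw [e.2] at ho
    obtain ⟨v, -, rfl⟩ := List.mem_map.1 ho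
    rw [name_entry]
    exact v.not_internal_name
  rintro a ((h | ⟨b, n, l, h, ho⟩) | ⟨b, n, l, h, ho⟩)
  · obtain ⟨p, hp⟩ := Option.ne_none_iff_exists'.1 h
    obtain ⟨ch, m, l', g, rfl, -, e⟩ := store_eq_some hp
    simp
  · exact key b n l _ h ho
  · exact key b n l _ h ho

lemma notMem_gn_store (δ : ChanStore) {H : List ℕ} {ch : ℕ} (hch : ch ∈ H) :
    Name.chan ch ∉ (store δ H).gn := by
  rintro ⟨b, n, l, h, ho⟩
  obtain ⟨ch, m, l', g, -, -, e⟩ := store_eq_some h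
  rw [Prod.mk.injEq] at e
  rw [e.2] at ho
  obtain ⟨v, -, he⟩ := List.mem_map.1 ho
  cases v with
  | int n => simp [entry] at he
  | chan c =>
    rw [entry] at he
    split_ifs at he with hc
    simp only [Obj.free.injEq, Name.chan.injEq] at he
    exact hc (he ▸ hch)

lemma notMem_ln_store (δ : ChanStore) {H : List ℕ} {a : Name} (ha : a ∉ H.map Name.chan) :
    a ∉ (store δ H).ln := by
  rintro ⟨b, n, l, h, ho⟩
  obtain ⟨ch, m, l', g, -, -, e⟩ := store_eq_some h
  rw [Prod.mk.injEq] at e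
  rw [e.2] at ho
  obtain ⟨v, -, he⟩ := List.mem_map.1 ho
  cases v with
  | int n => simp [entry] at he
  | chan c =>
    rw [entry] at he
    split_ifs at he with hc
    simp only [Obj.priv.injEq] at he
    exact ha (he ▸ List.mem_map_of_mem hc)

/-- The rule for `(νch)` takes its premise in the exposed store. Thus `H` loses one channel whenever
a restriction is entered, and below all of them nothing is marked. -/
lemma expose_store (δ : ChanStore) {H : List ℕ} {ch : ℕ} (h : ch ∉ H) :
    (store δ (ch :: H)).expose (.chan ch) = store δ H := by
  funext a
  rw [BufStore.expose]
  cases a with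
  | chan c =>
    rcases e : δ.lookup c with _ | ⟨_ | n, l, g⟩
    · rw [store_chan_none _ e, store_chan_none _ e, Option.map_none]
    · rw [store_chan_zero _ e, store_chan_zero _ e, Option.map_none]
    · rw [store_chan _ e, store_chan _ e, Option.map_some, List.map_map]
      congr 2
      refine List.map_congr_left fun v _ => ?_
      cases v with
      | int n => rfl
      | chan d =>
        simp only [Function.comp_apply, entry, List.mem_cons]
        by_cases hd : d = ch
        · subst hd
          simp [h, Obj.expose]
        · by_cases hH : d ∈ H <;> simp [hd, hH, Obj.expose]
  | int n => rfl
  | var n => rfl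
  | fn n => rfl
  | aux n => rfl

lemma hide_store (δ : ChanStore) (H : List ℕ) (ch : ℕ) :
    (store δ H).hide (.chan ch) = store δ (ch :: H) := by
  funext a
  rw [BufStore.hide]
  cases a with
  | chan c =>
    rcases e : δ.lookup c with _ | ⟨_ | n, l, g⟩
    · rw [store_chan_none _ e, store_chan_none _ e, Option.map_none]
    · rw [store_chan_zero _ e, store_chan_zero _ e, Option.map_none]
    · rw [store_chan _ e, store_chan _ e, Option.map_some, List.map_map]
      congr 2
      refine List.map_congr_left fun v _ => ?_
      cases v with
      | int n => rfl
      | chan d =>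
        simp only [Function.comp_apply, entry, List.mem_cons]
        by_cases hd : d = ch
        · subst hd
          by_cases hH : d ∈ H <;> simp [hH, Obj.hide]
        · by_cases hH : d ∈ H <;> simp [hd, hH, Obj.hide]
  | int n => rfl
  | var n => rfl
  | fn n => rfl
  | aux n => rfl

lemma store_ext {δ δ' : ChanStore} {H H' : List ℕ}
    (h : ∀ ch, store δ H (.chan ch) = store δ' H' (.chan ch)) : store δ H = store δ' H' := by
  funext a
  cases a with
  | chan c => exact h c
  | int n => rfl
  | var n => rfl
  | fn n => rfl
  | aux n => rfl

lemma store_insert (δ : ChanStore) (H : List ℕ) (ch n : ℕ) (l : List Val) (g : Bool) :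
    store (δ.insert ch (n + 1, l, g)) H =
      (store δ H).set (.chan ch) n.succPNat (l.map (entry H)) := by
  funext a
  by_cases ha : a = .chan ch
  · subst ha
    rw [store_chan H (Finmap.lookup_insert _), BufStore.set, Function.update_self]
  · rw [BufStore.set, Function.update_of_ne ha]
    cases a with
    | chan c =>
      have hc : c ≠ ch := fun e => ha (by rw [e])
      rw [store, store, Finmap.lookup_insert_of_ne _ hc]
    | int n => rfl
    | var n => rfl
    | fn n => rfl
    | aux n => rfl

lemma store_insert_zero {δ : ChanStore} (H : List ℕ) {ch : ℕ} (hch : ch ∉ δ) (g : Bool) :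
    store (δ.insert ch (0, [], g)) H = store δ H := by
  refine store_ext fun c => ?_
  by_cases hc : c = ch
  · subst hc
    rw [store_chan_zero H (Finmap.lookup_insert _),
      store_chan_none H (Finmap.lookup_eq_none.2 hch)]
  · rw [store, store, Finmap.lookup_insert_of_ne _ hc]

/-- Whether a channel is global enters a buffer store only through the list of marked names. -/
lemma store_insert_flag {δ : ChanStore} (H : List ℕ) {ch n : ℕ} {l : List Val} {g : Bool}
    (h : δ.lookup ch = some (n, l, g)) (g' : Bool) :
    store (δ.insert ch (n, l, g')) H = store δ H := by
  refine store_ext fun c => ?_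
  by_cases hc : c = ch
  · subst hc
    rw [store, store, Finmap.lookup_insert, h]
    cases n <;> rfl
  · rw [store, store, Finmap.lookup_insert_of_ne _ hc]

/-- Only the marks of channels in the buffers matter. -/
lemma store_congr {δ : ChanStore} {H H' : List ℕ}
    (h : ∀ ch, (∃ b n l g, δ.lookup b = some (n, l, g) ∧ Val.chan ch ∈ l) →
      (ch ∈ H ↔ ch ∈ H')) : store δ H = store δ H' := by
  refine store_ext fun c => ?_
  rcases e : δ.lookup c with _ | ⟨_ | n, l, g⟩
  · rw [store_chan_none _ e, store_chan_none _ e]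
  · rw [store_chan_zero _ e, store_chan_zero _ e]
  · rw [store_chan _ e, store_chan _ e]
    congr 2
    refine List.map_congr_left fun v hv => ?_
    cases v with
    | int n => rfl
    | chan d => simp only [entry, h d ⟨c, _, l, g, e, hv⟩]

/-- The local channels. -/
noncomputable def localList (δ : ChanStore) : List ℕ :=
  (δ.entries.toList.filter fun p => !p.2.2.2).map fun p => p.1

lemma localChans_eq (δ : ChanStore) : localChans δ = (localList δ).map Name.chan := by
  rw [localChans, localList, List.map_map]
  rfl

lemma mem_localList {δ : ChanStore} {ch : ℕ} :
    ch ∈ localList δ ↔ ∃ n l, δ.lookup ch = some (n, l, false) := by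
  simp only [localList, List.mem_map, List.mem_filter, Multiset.mem_toList]
  constructor
  · rintro ⟨⟨c, n, l, g⟩, ⟨h, hg⟩, rfl⟩
    obtain rfl : g = false := by simpa using hg
    exact ⟨n, l, Finmap.lookup_eq_some_iff.2 h⟩
  · rintro ⟨n, l, h⟩
    exact ⟨⟨ch, n, l, false⟩, ⟨Finmap.lookup_eq_some_iff.1 h, rfl⟩, rfl⟩

lemma nodup_localList (δ : ChanStore) : (localList δ).Nodup := by
  have h : (δ.entries.toList.map fun p => p.1).Nodup := by
    have := δ.nodupKeys
    rw [← Multiset.coe_toList δ.entries, Multiset.coe_nodupKeys] at this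
    exact this
  exact h.sublist (List.filter_sublist.map _)

lemma encChans_eq_store (δ : ChanStore) : encChans δ = store δ (localList δ) := by
  have he : ∀ v, encEntry δ v = entry (localList δ) v := by
    intro v
    cases v with
    | int n => rfl
    | chan ch =>
      rw [encEntry, entry]
      rcases e : δ.lookup ch with _ | ⟨n, l, _ | _⟩
      · rw [if_neg]
        rw [mem_localList, e]
        simp
      · rw [if_pos (mem_localList.2 ⟨n, l, e⟩)]
      · rw [if_neg]
        rw [mem_localList, e]
        simp
  funext a
  cases a with
  | chan c =>
    rcases e : δ.lookup c with _ | ⟨_ | n, l, g⟩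
    · rw [store_chan_none _ e, encChans, e]
    · rw [store_chan_zero _ e, encChans, e]
    · rw [store_chan _ e, encChans, e]
      simp only [List.map_congr_left fun v _ => he v]
  | int n => rfl
  | var n => rfl
  | fn n => rfl
  | aux n => rfl

lemma good_encChans (δ : ChanStore) : Good (encChans δ) := encChans_eq_store δ ▸ good_store _ _

lemma mem_localList_insert {δ : ChanStore} {ch n n' : ℕ} {l l' : List Val} {g : Bool}
    (h : δ.lookup ch = some (n, l, g)) (c : ℕ) :
    c ∈ localList (δ.insert ch (n', l', g)) ↔ c ∈ localList δ := by
  rw [mem_localList, mem_localList]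
  by_cases hc : c = ch
  · subst hc
    rw [Finmap.lookup_insert, h]
    simp
  · rw [Finmap.lookup_insert_of_ne _ hc]

/-! ### Transitions of configurations -/

lemma expose_eq_self {B : BufStore Name} {c : Name} (h : c ∉ B.ln) : B.expose c = B := by
  funext b
  rw [BufStore.expose]
  rcases e : B b with _ | ⟨n, l⟩
  · rfl
  · rw [Option.map_some]
    congr 2
    conv_rhs => rw [← List.map_id l]
    refine List.map_congr_left fun o ho => ?_
    cases o with
    | free d => rfl
    | priv d =>
      rw [Obj.expose, if_neg]
      · rfl
      · rintro rfl
        exact h ⟨b, n, l, e, ho⟩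

lemma hide_eq_self {B : BufStore Name} {c : Name} (h : c ∉ B.gn) : B.hide c = B := by
  funext b
  rw [BufStore.hide]
  rcases e : B b with _ | ⟨n, l⟩
  · rfl
  · rw [Option.map_some]
    congr 2
    conv_rhs => rw [← List.map_id l]
    refine List.map_congr_left fun o ho => ?_
    cases o with
    | priv d => rfl
    | free d =>
      rw [Obj.hide, if_neg]
      · rfl
      · rintro rfl
        exact h ⟨b, n, l, e, ho⟩

/-- Internal names never occur in good stores, so exposing and hiding them has no effect and the
side conditions of the rule `new` hold. -/
lemma step_nus_internal {P P' : Proc Name} {B B' : BufStore Name} {α : Act Name}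
    (h : Step P B α P' B') (hB : Good B) (hB' : Good B') (hα : ∀ a ∈ α.names, ¬ a.Internal)
    {as : List Name} (has : ∀ a ∈ as, a.Internal) : Step (.nus as P) B α (.nus as P') B' := by
  induction as with
  | nil => exact h
  | cons a as ih =>
    have ha := has a (by simp)
    have := ih fun b hb => has b (List.mem_cons_of_mem _ hb)
    rw [← expose_eq_self (hB.notMem_ln ha)] at this
    have := Step.new this (fun h => hα a h ha) (hB.notMem_gn ha) (hB'.notMem_ln ha)
    rwa [hide_eq_self (hB'.notMem_gn ha)] at this

/-- A transition of the redex gives a transition of the process that exposes it. The residual may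
be below restrictions `cs` of channels that do not occur in the context. -/
lemma Foc.step {W : Set ℕ} {ρ : Redex} {P P' : Proc Name} {B B' : BufStore Name} {α : Act Name}
    {cs : List Name} (h : Foc W ρ P P') (hB : Good B) (hB' : Good B') (hln : ∀ a, a ∉ B'.ln)
    (hα : ∀ a ∈ α.names, ¬ a.Internal)
    (hdom : ∀ b ∈ B'.dom, b ∉ B.dom → ∃ w ∈ W, b = .chan w)
    (hcs : ∀ c ∈ cs, ∃ w ∈ W, c = .chan w)
    (hρ : ∀ A A', ρ A A' → A.NewGuarded ∧ Step A B α (.nus cs A') B') :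
    Step P B α (.nus cs P') B' := by
  obtain ⟨as, A, A', K, h₁, h₂, h₃, h₄, h₅, h₆⟩ := h ∅ Set.finite_empty
  obtain ⟨hg, hs⟩ := hρ A A' h₄
  -- This is the reason for `W`: the parallel rule demands that the name of a newly created buffer
  -- is not free in the other component.
  have hs' : Step (.par A K) B α (.par (.nus cs A') K) B' := by
    refine .par hs ⟨hg, h₂⟩ fun b hb hb' => ?_
    obtain ⟨w, hw, rfl⟩ := hdom b hb hb'
    exact h₃ w hw
  have hs'' := step_nus_internal hs' hB hB' hα fun a ha => (h₁ a ha).1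
  -- The restrictions of created channels are extended over the context. The law needs an unmarked
  -- name, and nothing is marked in `B'`.
  have hsc : ∀ cs : List Name, (∀ c ∈ cs, ∃ w ∈ W, c = .chan w) →
      SC B' (.par (.nus cs A') K) (.nus cs (.par A' K)) := by
    intro cs hcs
    induction cs with
    | nil => exact .refl _
    | cons c cs ih =>
      obtain ⟨w, hw, rfl⟩ := hcs c (by simp)
      exact .trans (.symm (.nu_par (hln _) (h₃ w hw)))
        (.nu (ih fun d hd => hcs d (List.mem_cons_of_mem _ hd)))
  have hcong : ∀ (as : List Name) {P Q : Proc Name}, SC B' P Q →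
      SC B' (.nus as P) (.nus as Q) := by
    intro as P Q h
    induction as with
    | nil => exact h
    | cons c cs ih => exact .nu ih
  refine .stru (cl_eq.1 h₅ B hB) hs'' (.trans (hcong as (hsc cs hcs)) ?_)
  refine cl_eq.1 ?_ B' hB'
  rw [cl_nus, cl_nus, cl_nus, h₆, cl_nus, ← PClass.nus_append, ← PClass.nus_append]
  exact PClass.nus_perm List.perm_append_comm _

/-- A transition is lifted to restrictions of local channels. -/
lemma step_nus_chans {P P' : Proc Name} {δ δ' : ChanStore} {α : Act Name} {H : List ℕ}
    (h : Step P (store δ []) α P' (store δ' [])) (hH : H.Nodup)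
    (hα : ∀ ch ∈ H, Name.chan ch ∉ α.names) :
    Step (.nus (H.map Name.chan) P) (store δ H) α (.nus (H.map Name.chan) P') (store δ' H) := by
  induction H with
  | nil => exact h
  | cons c H ih =>
    obtain ⟨hc, hH⟩ := List.nodup_cons.1 hH
    have := ih hH fun d hd => hα d (List.mem_cons_of_mem _ hd)
    rw [← expose_store δ hc] at this
    have := Step.new this (hα c (by simp)) (notMem_gn_store δ (by simp))
      (notMem_ln_store δ' (by simpa using hc))
    rwa [hide_store] at this

lemma step_congr {P P' Q Q' : Proc Name} {B B' : BufStore Name} {α : Act Name}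
    (h : Step P B α P' B') (hB : Good B) (hB' : Good B') (e : cl Q = cl P) (e' : cl P' = cl Q') :
    Step Q B α Q' B' := .stru (cl_eq.1 e B hB) h (cl_eq.1 e' B' hB')

/-- A transition that does not change the set of local channels. -/
lemma step_config {P P' : Proc Name} {δ δ' : ChanStore} {α : Act Name}
    (h : Step P (store δ []) α P' (store δ' []))
    (hα : ∀ ch ∈ localList δ, Name.chan ch ∉ α.names)
    (hδ : ∀ ch, ch ∈ localList δ' ↔ ch ∈ localList δ) :
    Step (.nus (localChans δ) P) (encChans δ) α (.nus (localChans δ') P') (encChans δ') := by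
  have := step_nus_chans h (nodup_localList δ) hα
  rw [encChans_eq_store, encChans_eq_store, localChans_eq, localChans_eq,
    store_congr (δ := δ') (H' := localList δ) fun ch _ => hδ ch]
  refine step_congr this (good_store _ _) (good_store _ _) rfl ?_
  rw [cl_nus, cl_nus]
  refine PClass.nus_perm (List.Perm.map _ ?_) _
  exact (List.perm_ext_iff_of_nodup (nodup_localList δ) (nodup_localList δ')).2
    fun ch => (hδ ch).symm

/-- The communication rule has the receiver on the left, hence the two exchanges of components. -/
lemma Sync.step {A A' : Proc Name} (h : Sync A A') {B : BufStore Name} (hB : Good B) :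
    A.NewGuarded ∧ Step A B .tau A' B := by
  obtain ⟨a, vs, xs, P, Q, ha, hl, hv, rfl, rfl⟩ := h
  refine ⟨⟨trivial, trivial⟩, .stru (.par_comm _ _) ?_ (.par_comm _ _)⟩
  exact .com (.iu (hB.notMem_dom ha) hl hv) (.ou (hB.notMem_dom ha)) (hB.notMem_dom ha)

lemma step_sync {P P' : Proc Name} (h : Foc ∅ Sync P P') (δ : ChanStore) :
    Step (.nus (localChans δ) P) (encChans δ) .tau (.nus (localChans δ) P') (encChans δ) := by
  refine step_config (h.step (cs := []) (good_store _ _) (good_store _ _)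
    (fun a => notMem_ln_store _ (by simp)) ?_ (fun b hb hb' => absurd hb hb') (by simp)
    fun A A' hA => hA.step (good_store _ _)) (fun _ _ h => h.elim) fun _ => Iff.rfl
  exact fun _ h => h.elim

/-- `Reds` is closed under congruence, whereas `TauStar` with no transition demands equal end
points. Here the slack is left at the end, in `Reds.tauStar_to` at the beginning. -/
lemma Reds.tauStar_from {P Q : Proc Name} (h : Reds P Q) (δ : ChanStore) :
    ∃ Q₀, cl Q₀ = cl Q ∧ TauStar (.nus (localChans δ) P, encChans δ)
      (.nus (localChans δ) Q₀, encChans δ) := by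
  induction h with
  | @refl P Q e => exact ⟨P, e, .refl⟩
  | step f _ ih =>
    obtain ⟨Q₀, e, ht⟩ := ih
    exact ⟨Q₀, e, .head (step_sync f δ) ht⟩

lemma Reds.tauStar_to {P Q : Proc Name} (h : Reds P Q) (δ : ChanStore) :
    ∃ P₀, cl P₀ = cl P ∧ TauStar (.nus (localChans δ) P₀, encChans δ)
      (.nus (localChans δ) Q, encChans δ) := by
  induction h with
  | @refl P Q e => exact ⟨Q, e.symm, .refl⟩
  | step f _ ih =>
    obtain ⟨P₀, e, ht⟩ := ih
    exact ⟨_, rfl, .head (step_sync (f.congr rfl e) δ) ht⟩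

/-- The slack on both sides is moved to the essential step, which absorbs congruences. Hence source
and target are met exactly. -/
lemma Ev.weakStep {W : Set ℕ} {ρ : Redex} {P P' : Proc Name} {δ δ' : ChanStore} {α : Act Name}
    (h : Ev W ρ P P') (hs : ∀ Q Q', Foc W ρ Q Q' →
      Step (.nus (localChans δ) Q) (encChans δ) α (.nus (localChans δ') Q') (encChans δ')) :
    WeakStep (.nus (localChans δ) P, encChans δ) α (.nus (localChans δ') P', encChans δ') := by
  obtain ⟨P₁, P₂, r₁, f, r₂⟩ := h
  obtain ⟨Q₁, e₁, t₁⟩ := r₁.tauStar_from δ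
  obtain ⟨Q₂, e₂, t₂⟩ := r₂.tauStar_to δ'
  exact ⟨_, _, t₁, hs _ _ (f.congr e₁ e₂), t₂⟩

end Go

namespace Go

open PiB

lemma notMem_dom_store {δ : ChanStore} {H : List ℕ} {ch : ℕ} {l : List Val} {g : Bool}
    (h : δ.lookup ch = some (0, l, g)) : Name.chan ch ∉ (store δ H).dom :=
  fun hd => hd (store_chan_zero H h)

/-! ### Transitions of redexes -/

lemma step_recv_unbuffered {δ : ChanStore} {ch : ℕ} {v : Val} {g : Bool} {A A' : Proc Name}
    (h : (Kind.recv ch v).redex A A') (hδ : δ.lookup ch = some (0, [], g)) :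
    A.NewGuarded ∧ Step A (store δ []) (.inp (.chan ch) [v.name]) A' (store δ []) := by
  obtain ⟨n, π, P, j, z, rfl, hπ, hv, -, rfl⟩ := h
  refine ⟨trivial, .sum j ?_⟩
  rw [hπ]
  exact .iu (notMem_dom_store hδ) rfl (by simpa using hv)

lemma step_recv_buffered {δ : ChanStore} {ch n : ℕ} {v : Val} {l : List Val} {g : Bool}
    {A A' : Proc Name} (h : (Kind.recv ch v).redex A A')
    (hδ : δ.lookup ch = some (n + 1, v :: l, g)) :
    A.NewGuarded ∧
      Step A (store δ []) .tau A' (store (δ.insert ch (n + 1, l, g)) []) := by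
  obtain ⟨m, π, P, j, z, rfl, hπ, hv, -, rfl⟩ := h
  refine ⟨trivial, .sum j ?_⟩
  rw [hπ, store_insert]
  refine .ib ?_ hv
  rw [store_chan [] hδ, List.map_cons, entry_of_notMem (by simp)]

lemma step_send_unbuffered {δ : ChanStore} {ch : ℕ} {v : Val} {g : Bool} {A A' : Proc Name}
    (h : (Kind.send ch v).redex A A') (hδ : δ.lookup ch = some (0, [], g)) :
    A.NewGuarded ∧ Step A (store δ []) (.out (.chan ch) [.free v.name]) A' (store δ []) := by
  obtain ⟨n, π, P, j, rfl, hπ, -, rfl⟩ := h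
  refine ⟨trivial, .sum j ?_⟩
  rw [hπ]
  exact .ou (ds := [v.name]) (notMem_dom_store hδ)

lemma step_send_buffered {δ : ChanStore} {ch n : ℕ} {v : Val} {l : List Val} {g : Bool}
    {A A' : Proc Name} (h : (Kind.send ch v).redex A A')
    (hδ : δ.lookup ch = some (n + 1, l, g)) (hl : l.length < n + 1) :
    A.NewGuarded ∧
      Step A (store δ []) .tau A' (store (δ.insert ch (n + 1, l ++ [v], g)) []) := by
  obtain ⟨m, π, P, j, rfl, hπ, -, rfl⟩ := h
  refine ⟨trivial, .sum j ?_⟩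
  rw [hπ, store_insert, List.map_append, List.map_cons, List.map_nil,
    entry_of_notMem (v := v) (by simp)]
  exact .ob (store_chan [] hδ) (by simpa using hl)

lemma Com.step {δ : ChanStore} {ch : ℕ} {v : Val} {g : Bool} {A A' : Proc Name}
    (h : Com ch v A A') (hδ : δ.lookup ch = some (0, [], g)) :
    A.NewGuarded ∧ Step A (store δ []) .tau A' (store δ []) := by
  obtain ⟨A₁, A₁', A₂, A₂', h₁, h₂, rfl, rfl⟩ := h
  have s₁ := step_recv_unbuffered h₁ hδ
  have s₂ := step_send_unbuffered h₂ hδ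
  exact ⟨⟨s₂.1, s₁.1⟩, .stru (.par_comm _ _) (.com (ds := [v.name]) s₁.2 s₂.2 (notMem_dom_store hδ))
    (.par_comm _ _)⟩

/-- The bound auxiliary name is converted to `ch`: before the step if the channel is buffered, since
the step enters the name into the store, and after the `τ` if it is unbuffered. Both are allowed
because neither name occurs in the store at that point. -/
lemma step_make {δ : ChanStore} {n ch : ℕ} {A A' : Proc Name}
    (h : (Kind.make n ch).redex A A') (hch : ch ∉ δ)
    (hf : Name.chan ch ∉ (store δ []).names) :
    A.NewGuarded ∧ Step A (store δ []) .tau (.nus [.chan ch] A')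
      (store (δ.insert ch (n, [], false)) []) := by
  obtain ⟨r, k, t, hr, hrk, rfl, rfl⟩ := h
  have hk : Name.aux k ∉ (store δ []).names := fun h => good_store δ [] _ h trivial
  have hcr : Name.chan ch ≠ r := by
    rintro rfl
    exact hr
  have hsub : (out r [.aux k] .zero).subst (ren [.aux k] [.chan ch]) =
      out r [.chan ch] .zero := by
    simp [Proc.subst_pre, Pre.subst, Pre.bound, hrk]
  have hnames : Name.chan ch ∉ (out r [.aux k] .zero).names := by
    simp [Proc.names, Proc.pre, Pre.used, Pre.bound, Proc.zero, hcr]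
  cases n with
  | zero =>
    rw [store_insert_zero [] hch]
    refine ⟨trivial, .stru (.refl _) .tau ?_⟩
    have := SC.alpha_nu hk hf hnames
    rwa [hsub] at this
  | succ n =>
    rw [store_insert]
    refine ⟨trivial, ?_⟩
    have := SC.alpha_nuB (n := n.succPNat) hk hf hnames
    rw [hsub] at this
    refine .stru this (.newB ?_) (.refl _)
    exact fun hd => hd (store_chan_none [] (Finmap.lookup_eq_none.2 hch))

/-- A redex whose transition preserves the domain of the buffer store. -/
lemma Foc.step_config {ρ : Redex} {P P' : Proc Name} {δ δ' : ChanStore} {α : Act Name}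
    (h : Foc ∅ ρ P P')
    (hα : ∀ a ∈ α.names, ¬ a.Internal)
    (hα' : ∀ ch ∈ localList δ, Name.chan ch ∉ α.names)
    (hdom : (store δ' []).dom ⊆ (store δ []).dom)
    (hδ : ∀ ch, ch ∈ localList δ' ↔ ch ∈ localList δ)
    (hρ : ∀ A A', ρ A A' → A.NewGuarded ∧ Step A (store δ []) α A' (store δ' [])) :
    Step (.nus (localChans δ) P) (encChans δ) α (.nus (localChans δ') P') (encChans δ') :=
  Go.step_config (h.step (cs := []) (good_store _ _) (good_store _ _)
    (fun _ => notMem_ln_store _ (by simp)) hα (fun _ hb hb' => absurd (hdom hb) hb') (by simp) hρ)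
    hα' hδ

lemma dom_store_insert_subset {δ : ChanStore} {ch n : ℕ} {l l' : List Val} {g : Bool}
    (h : δ.lookup ch = some (n + 1, l, g)) :
    (store (δ.insert ch (n + 1, l', g)) []).dom ⊆ (store δ []).dom := by
  intro b hb
  by_cases hc : b = .chan ch
  · subst hc
    intro e
    rw [store_chan [] h] at e
    cases e
  · rw [store_insert] at hb
    intro e
    refine hb ?_
    rw [BufStore.set, Function.update_of_ne hc, e]

/-- The creation of a channel. -/
lemma Foc.step_make {P P' : Proc Name} {δ : ChanStore} {n ch : ℕ}
    (h : Foc {ch} (Kind.make n ch).redex P P') (hch : ch ∉ δ)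
    (hbuf : ¬ ∃ b n l g, δ.lookup b = some (n, l, g) ∧ Val.chan ch ∈ l) :
    Step (.nus (localChans δ) P) (encChans δ) .tau
      (.nus (localChans (δ.insert ch (n, [], false))) P')
      (encChans (δ.insert ch (n, [], false))) := by
  set δ' := δ.insert ch (n, [], false) with hδ'
  have hnone : δ.lookup ch = none := Finmap.lookup_eq_none.2 hch
  have hf : Name.chan ch ∉ (store δ []).names := by
    rintro ((hd | hg) | hl)
    · exact hd (store_chan_none [] hnone)
    · obtain ⟨b, m, l, hb, ho⟩ := hg
      obtain ⟨c, m', l', g, -, hc, e⟩ := store_eq_some hb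
      rw [Prod.mk.injEq] at e
      rw [e.2] at ho
      obtain ⟨v, hv, he⟩ := List.mem_map.1 ho
      rw [entry_of_notMem (by simp), Obj.free.injEq] at he
      refine hbuf ⟨c, _, l', g, hc, ?_⟩
      cases v with
      | int n => simp [Val.name] at he
      | chan d =>
        simp only [Val.name, Name.chan.injEq] at he
        exact he ▸ hv
    · exact notMem_ln_store δ (by simp) hl
  have hs : Step P (store δ []) .tau (.nus [.chan ch] P') (store δ' []) := by
    refine h.step (good_store _ _) (good_store _ _) (fun _ => notMem_ln_store _ (by simp))
      (fun _ h => h.elim) (fun b hb hb' => ⟨ch, rfl, ?_⟩) (by simp)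
      fun A A' hA => Go.step_make hA hch hf
    by_contra hne
    refine hb' ?_
    cases n with
    | zero => rwa [hδ', store_insert_zero [] hch] at hb
    | succ n =>
      rw [hδ', store_insert] at hb
      intro e
      refine hb ?_
      rw [BufStore.set, Function.update_of_ne hne, e]
  have hmem : ∀ c, c ∈ localList δ' ↔ c ∈ ch :: localList δ := by
    intro c
    rw [List.mem_cons, mem_localList, mem_localList]
    by_cases hc : c = ch
    · subst hc
      rw [hδ', Finmap.lookup_insert]
      simp
    · rw [hδ', Finmap.lookup_insert_of_ne _ hc]
      simp [hc]
  have hnl : ch ∉ localList δ := by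
    rw [mem_localList, hnone]
    simp
  have := step_nus_chans hs (nodup_localList δ) fun _ _ h => h.elim
  rw [encChans_eq_store, encChans_eq_store, localChans_eq, localChans_eq,
    store_congr (δ := δ') (H' := localList δ)]
  · refine step_congr this (good_store _ _) (good_store _ _) rfl ?_
    rw [cl_nus, cl_nus, cl_nus, ← PClass.nus_append]
    refine PClass.nus_perm (List.perm_append_comm.trans ?_) _
    exact ((List.perm_ext_iff_of_nodup (nodup_localList δ')
      (List.nodup_cons.2 ⟨hnl, nodup_localList δ⟩)).2 hmem).symm.map Name.chan
  -- The new buffer is empty and no other buffer contains `ch`, so it does not matter whether `ch`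
  -- counts as marked.
  · rintro c ⟨b, m, l, g, hb, hc⟩
    rw [hmem, List.mem_cons, or_iff_right]
    rintro rfl
    by_cases hbc : b = c
    · subst hbc
      rw [hδ', Finmap.lookup_insert, Option.some.injEq, Prod.mk.injEq, Prod.mk.injEq] at hb
      rw [← hb.2.1] at hc
      simp at hc
    · rw [hδ', Finmap.lookup_insert_of_ne _ hbc] at hb
      exact hbuf ⟨b, m, l, g, hb, hc⟩

/-- An output that extrudes a local channel. -/
lemma step_open {P P' : Proc Name} {δ δ' δ'' : ChanStore} {ch ch' n' : ℕ} {l' : List Val}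
    (h : Step P (store δ []) (.out (.chan ch) [.free (.chan ch')]) P' (store δ' []))
    (hl : δ.lookup ch' = some (n', l', false)) (hch : ch ∉ localList δ)
    (hδ : ∀ c, c ∈ localList δ'' ↔ c ≠ ch' ∧ c ∈ localList δ)
    (hst : ∀ H, store δ'' H = store δ' H) :
    Step (.nus (localChans δ) P) (encChans δ) (.out (.chan ch) [.priv (.chan ch')])
      (.nus (localChans δ'') P') (encChans δ'') := by
  have hmem : ch' ∈ localList δ := mem_localList.2 ⟨n', l', hl⟩
  have hnd := nodup_localList δ
  -- The restriction of `ch'` is to be the outermost one: the other local channels are restricted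
  -- first, then the scope of `ch'` is opened.
  set H := (localList δ).erase ch' with hH
  have hp : (localList δ).Perm (ch' :: H) := List.perm_cons_erase hmem
  have hnd' : (ch' :: H).Nodup := hp.nodup_iff.1 hnd
  obtain ⟨hn, hndH⟩ := List.nodup_cons.1 hnd'
  have hne : ch ≠ ch' := fun e => hch (e ▸ hmem)
  have hp' : H.Perm (localList δ'') :=
    (List.perm_ext_iff_of_nodup hndH (nodup_localList δ'')).2 fun c => by
      rw [hH, hnd.mem_erase_iff, hδ]
  have h₁ := step_nus_chans h hndH (by
    intro c hc hm
    rcases hm with hm | ⟨o, ho, hm⟩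
    · simp only [Name.chan.injEq] at hm
      subst hm
      exact hch (List.mem_of_mem_erase hc)
    · rw [List.mem_singleton] at ho
      subst ho
      simp only [Obj.name, Name.chan.injEq] at hm
      exact hn (hm ▸ hc))
  rw [← expose_store δ hn] at h₁
  -- Unlike `new`, this rule does not hide the name again in the resulting store, in accordance with
  -- `ch'` being global from now on.
  have h₂ := Step.opn h₁ (by simpa using hne) (by simp) (by simp)
    (notMem_gn_store δ (by simp))
  simp only [List.map_cons, List.map_nil, Obj.hide, if_true] at h₂
  rw [encChans_eq_store, encChans_eq_store, localChans_eq, localChans_eq,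
    store_congr (δ := δ) (H' := ch' :: H) fun c _ => hp.mem_iff,
    hst, store_congr (δ := δ') (H' := H) fun c _ => hp'.mem_iff.symm]
  refine step_congr h₂ (good_store _ _) (good_store _ _) ?_ ?_
  · rw [cl_nus, PClass.nus_perm (hp.map Name.chan), List.map_cons, PClass.nus_cons, cl_nu, cl_nus]
  · rw [cl_nus, cl_nus, PClass.nus_perm (hp'.map Name.chan)]

/-! ### Operational completeness -/

/-- The label excludes all other kinds; as it is not silent, variables are not involved either. The
same holds for `LStep.routine_send` and `LStep.routine_go`. -/
lemma LStep.routine_recv {s s' : Stm} {σ : Store} {δ : ChanStore} {ch : ℕ} {v : Val}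
    (h : LStep s σ δ (.r ch v) s' σ δ) (hv : ∀ x ∈ s.vars, x ∈ σ) :
    ∃ g, δ.lookup ch = some (0, [], g) ∧
      Ev ∅ (Kind.recv ch v).redex (encRoutine (s, σ)) (encRoutine (s', σ)) := by
  obtain ⟨κ, hκ, ⟨-, -, h, -⟩ | ⟨-, h⟩⟩ := h.routine hv
  · cases h
  · have hE := h ∅ (by simp)
    cases κ with
    | read x v => cases hκ.2.1
    | write x v => cases hκ.1
    | make n ch => cases hκ.2.1
    | recv c w =>
      rcases hκ.2 with ⟨g, hl, he, -⟩ | ⟨n, l, g, -, he, -⟩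
      · cases he
        exact ⟨g, hl, hE⟩
      · cases he
    | send c w =>
      rcases hκ.2 with ⟨g, hl, he, -⟩ | ⟨n, l, g, -, -, he, -⟩ <;> cases he
    | go f vs => cases hκ.1

lemma LStep.routine_send {s s' : Stm} {σ : Store} {δ : ChanStore} {ch : ℕ} {v : Val}
    (h : LStep s σ δ (.s ch v) s' σ δ) (hv : ∀ x ∈ s.vars, x ∈ σ) :
    ∃ g, δ.lookup ch = some (0, [], g) ∧
      Ev ∅ (Kind.send ch v).redex (encRoutine (s, σ)) (encRoutine (s', σ)) := by
  obtain ⟨κ, hκ, ⟨-, -, h, -⟩ | ⟨-, h⟩⟩ := h.routine hv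
  · cases h
  · have hE := h ∅ (by simp)
    cases κ with
    | read x v => cases hκ.2.1
    | write x v => cases hκ.1
    | make n ch => cases hκ.2.1
    | recv c w =>
      rcases hκ.2 with ⟨g, hl, he, -⟩ | ⟨n, l, g, -, he, -⟩ <;> cases he
    | send c w =>
      rcases hκ.2 with ⟨g, hl, he, -⟩ | ⟨n, l, g, -, -, he, -⟩
      · cases he
        exact ⟨g, hl, hE⟩
      · cases he
    | go f vs => cases hκ.1

lemma LStep.routine_go {s s' : Stm} {σ : Store} {δ : ChanStore} {f : ℕ} {vs : List Val}
    (h : LStep s σ δ (.g f vs) s' σ δ) (hv : ∀ x ∈ s.vars, x ∈ σ) :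
    Ev ∅ (Kind.go f vs).redex (encRoutine (s, σ)) (encRoutine (s', σ)) := by
  obtain ⟨κ, hκ, ⟨-, -, h, -⟩ | ⟨-, h⟩⟩ := h.routine hv
  · cases h
  · have hE := h ∅ (by simp)
    cases κ with
    | read x v => cases hκ.2.1
    | write x v => cases hκ.1
    | make n ch => cases hκ.2.1
    | recv c w =>
      rcases hκ.2 with ⟨g, hl, he, -⟩ | ⟨n, l, g, -, he, -⟩ <;> cases he
    | send c w =>
      rcases hκ.2 with ⟨g, hl, he, -⟩ | ⟨n, l, g, -, -, he, -⟩ <;> cases he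
    | go f vs =>
      cases hκ.1
      exact hE

lemma SC.nus {B : BufStore Name} {P Q : Proc Name} (h : SC B P Q) (cs : List Name) :
    SC B (.nus cs P) (.nus cs Q) := by
  induction cs with
  | nil => exact h
  | cons c cs ih => exact .nu ih

lemma DropsDead.nus {B : BufStore Name} {P Q : Proc Name} (h : DropsDead B P Q)
    (cs : List Name) : DropsDead B (.nus cs P) (.nus cs Q) := by
  induction cs with
  | nil => exact h
  | cons c cs ih => exact .nu ih

/-- The subject of a dead branch is internal, hence not in the domain of a good store, that is,
unbuffered. -/
lemma Dead.upToDeadBranch {P Q : Proc Name} (h : Dead P Q) (δ : ChanStore) :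
    UpToDeadBranch (.nus (localChans δ) P, encChans δ) (.nus (localChans δ) Q, encChans δ) := by
  obtain ⟨t, d, T, ht, hd, hP, hQ⟩ := h
  have hB := good_encChans δ
  have hdrop : DropsDead (encChans δ) d .zero := by
    rcases hd with ⟨p, y, hp, -, -, rfl⟩ | ⟨g, z, hg, -, -, rfl⟩
    · exact .put (hB.notMem_dom hp)
    · exact .get (hB.notMem_dom hg)
  refine ⟨rfl, _, _, SC.nus (cl_eq.1 hP _ hB) _, DropsDead.nus (.nu (.par hdrop)) _,
    SC.nus (cl_eq.1 ?_ _ hB) _⟩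
  rw [hQ, cl_nu, cl_par, cl_zero, one_mul, cl_nu]

lemma Kind.stable_fn {κ : Kind} (h : ∀ f vs, κ ≠ .go f vs) (f : ℕ) : Stable κ.redex (.fn f) := by
  refine κ.stable trivial ?_
  cases κ with
  | read x v => simp [Kind.Avoids]
  | write x v => simp [Kind.Avoids]
  | make n ch => trivial
  | recv ch v => trivial
  | send ch v => trivial
  | go g vs => exact absurd rfl (h g vs)

lemma localNames_subset_boundNames (P : Proc Name) : P.localNames ⊆ P.boundNames := by
  induction P with
  | sum n π P ih =>
    intro a ha
    obtain ⟨i, hi⟩ := Set.mem_iUnion.1 ha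
    exact Set.mem_iUnion.2 ⟨i, Or.inr (ih i hi)⟩
  | par P Q ihP ihQ => exact Set.union_subset_union ihP ihQ
  | nuB c n P ih => exact Set.union_subset_union_right _ ih
  | nu c P ih => exact Set.union_subset_union_right _ ih
  | repl P ih => exact ih

/-- The environment may use a buffer only if its name is not local in the process. All binders of
the encoding are internal, and the restrictions of local channels lie further outside. -/
lemma chan_notMem_localNames (δf : FunEnv) (Γ : Multiset (Stm × Store)) (ch : ℕ) :
    Name.chan ch ∉ (Proc.nus (fns δf) (soup δf Γ)).localNames := by
  intro h
  have hwf : WF (.nus (fns δf) (soup δf Γ)) :=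
    wf_nus.2 ⟨fun c hc => internal_of_mem_fns hc, wf_soup δf Γ⟩
  exact hwf.internal_of_mem_boundNames (localNames_subset_boundNames _ h)

lemma WeakStep.of_step {P P' : Proc Name} {B B' : BufStore Name} {α : Act Name}
    (h : Step P B α P' B') : WeakStep (P, B) α (P', B') := ⟨_, _, .refl, h, .refl⟩

lemma notMem_localList {δ : ChanStore} {ch n : ℕ} {l : List Val}
    (h : δ.lookup ch = some (n, l, true)) : ch ∉ localList δ := by
  rw [mem_localList, h]
  simp

lemma chan_eq_name {ch : ℕ} {v : Val} (h : Name.chan ch = v.name) : v = .chan ch := by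
  cases v with
  | int n => cases h
  | chan c => cases h; rfl

lemma insert_lookup {δ : ChanStore} {ch : ℕ} {p : ℕ × List Val × Bool}
    (h : δ.lookup ch = some p) : δ.insert ch p = δ := by
  refine Finmap.ext_lookup fun c => ?_
  by_cases hc : c = ch
  · subst hc
    rw [Finmap.lookup_insert, h]
  · rw [Finmap.lookup_insert_of_ne _ hc]

lemma inp_not_internal {ch : ℕ} {v : Val} :
    ∀ a ∈ (Act.inp (Name.chan ch) [v.name]).names, ¬ a.Internal := by
  rintro a (rfl | ha)
  · exact id
  · rw [List.mem_singleton] at ha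
    exact ha ▸ v.not_internal_name

lemma out_not_internal {ch : ℕ} {v : Val} :
    ∀ a ∈ (Act.out (Name.chan ch) [Obj.free v.name]).names, ¬ a.Internal := by
  rintro a (rfl | ⟨o, ho, rfl⟩)
  · exact id
  · rw [List.mem_singleton] at ho
    exact ho ▸ v.not_internal_name

lemma inp_notMem_names {δ : ChanStore} {ch : ℕ} {v : Val} (hch : ch ∉ localList δ)
    (hv : ∀ c ∈ localList δ, v ≠ .chan c) :
    ∀ c ∈ localList δ, Name.chan c ∉ (Act.inp (Name.chan ch) [v.name]).names := by
  rintro c hc (h | h)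
  · cases h
    exact hch hc
  · rw [List.mem_singleton] at h
    exact hv c hc (chan_eq_name h)

lemma out_notMem_names {δ : ChanStore} {ch : ℕ} {v : Val} (hch : ch ∉ localList δ)
    (hv : ∀ c ∈ localList δ, v ≠ .chan c) :
    ∀ c ∈ localList δ, Name.chan c ∉ (Act.out (Name.chan ch) [Obj.free v.name]).names := by
  rintro c hc (h | ⟨o, ho, h⟩)
  · cases h
    exact hch hc
  · rw [List.mem_singleton] at ho
    subst ho
    exact hv c hc (chan_eq_name h.symm)

lemma ne_chan_of_not_inDom {δ : ChanStore} {v : Val} (h : ¬ v.InDom δ) :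
    ∀ c ∈ localList δ, v ≠ .chan c := by
  rintro c hc rfl
  obtain ⟨n, l, hl⟩ := mem_localList.1 hc
  exact h (Finmap.mem_of_lookup_eq_some hl)

lemma mem_localList_globalize {δ : ChanStore} {ch n : ℕ} {l : List Val} (c : ℕ) :
    c ∈ localList (δ.insert ch (n, l, true)) ↔ c ≠ ch ∧ c ∈ localList δ := by
  rw [mem_localList, mem_localList]
  by_cases hc : c = ch
  · subst hc
    rw [Finmap.lookup_insert]
    simp
  · rw [Finmap.lookup_insert_of_ne _ hc]
    simp [hc]

/-- Silent steps of one Go-routine. -/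
theorem LStep.weakStep {δf : FunEnv} {Γ : Multiset (Stm × Store)} {s s' : Stm} {σ σ' : Store}
    {δ δ' : ChanStore} (h : LStep s σ δ .tau s' σ' δ') (hv : ∀ x ∈ s.vars, x ∈ σ)
    (hn : ∀ ch ∈ δ', ch ∉ δ → ¬ Occurs δf ⟨(s, σ) ::ₘ Γ, δ⟩ ch) :
    ∃ C, WeakStep (encConfig δf ⟨(s, σ) ::ₘ Γ, δ⟩) .tau C ∧
      (C = encConfig δf ⟨(s', σ') ::ₘ Γ, δ'⟩ ∨
        VarAccess ⟨(s, σ) ::ₘ Γ, δ⟩ ⟨(s', σ') ::ₘ Γ, δ'⟩ ∧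
          UpToDeadBranch C (encConfig δf ⟨(s', σ') ::ₘ Γ, δ'⟩)) := by
  obtain ⟨κ, hκ, ⟨hacc, hδ, -, P, hE, hD⟩ | ⟨hna, hE⟩⟩ := h.routine hv
  · subst hδ
    have hd : Dead (.nus (fns δf) (.par P (soup δf Γ)))
        (.nus (fns δf) (soup δf ((s', σ') ::ₘ Γ))) :=
      ((hD.par _).nus fun c hc => internal_of_mem_fns hc).congr rfl
        (cl_nus_soup_cons δf (s', σ') Γ).symm
    exact ⟨_, (hE.soup (fun f => Sync.stable _) (by simp)).weakStep
      fun Q Q' hQ => step_sync hQ _, Or.inr ⟨⟨Γ, s, s', σ, σ', _, rfl, rfl, h, hacc⟩,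
        hd.upToDeadBranch _⟩⟩
  · refine ⟨_, ?_, Or.inl rfl⟩
    have hsoup : ∀ W : Set ℕ, (∀ f vs, κ ≠ .go f vs) →
        (∀ w ∈ W, ¬ Occurs δf ⟨(s, σ) ::ₘ Γ, δ⟩ w) →
        Ev W κ.redex (.nus (fns δf) (soup δf ((s, σ) ::ₘ Γ)))
          (.nus (fns δf) (soup δf ((s', σ') ::ₘ Γ))) := by
      intro W hgo hW
      have hE' := hE W fun w hw => ⟨fun hm => hW w hw (Or.inl ⟨(s, σ), by simp, Or.inl hm⟩),
        fun x v hl hm => hW w hw (Or.inl ⟨(s, σ), by simp, Or.inr ⟨x, v, hl, hm⟩⟩)⟩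
      refine (hE'.soup (Kind.stable_fn hgo) fun w hw => ?_).after
        (.refl (cl_nus_soup_cons δf (s', σ') Γ))
      refine chan_notMem_soup (δ := δ) fun ho => hW w hw ?_
      rcases ho with ⟨p, hp, h⟩ | h
      · exact Or.inl ⟨p, Multiset.mem_cons_of_mem hp, h⟩
      · exact Or.inr h
    cases κ with
    | read x v => exact absurd trivial hna
    | write x v => exact absurd trivial hna
    | make n ch =>
      obtain ⟨hch, -, rfl, rfl⟩ := hκ
      -- By the name convention the new channel occurs in no routine, function or buffer, which
      -- makes `W = {ch}` admissible.
      have ho := hn ch (Finmap.mem_insert.2 (Or.inl rfl)) hch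
      refine (hsoup {ch} (by simp) (by rintro w rfl; exact ho)).weakStep fun Q Q' hQ =>
        hQ.step_make hch ?_
      rintro ⟨b, m, l, g, hb, hm⟩
      exact ho (Or.inr (Or.inr (Or.inl ⟨b, m, l, g, hb, _, hm, rfl⟩)))
    | recv ch v =>
      rcases hκ.2 with ⟨g, -, he, -⟩ | ⟨n, l, g, hl, -, rfl⟩
      · cases he
      · exact (hsoup ∅ (by simp) (by simp)).weakStep fun Q Q' hQ =>
          hQ.step_config (fun _ h => h.elim) (fun _ _ h => h.elim) (dom_store_insert_subset hl)
            (mem_localList_insert hl) fun A A' hA => step_recv_buffered hA hl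
    | send ch v =>
      rcases hκ.2 with ⟨g, -, he, -⟩ | ⟨n, l, g, hl, hlen, -, rfl⟩
      · cases he
      · exact (hsoup ∅ (by simp) (by simp)).weakStep fun Q Q' hQ =>
          hQ.step_config (fun _ h => h.elim) (fun _ _ h => h.elim) (dom_store_insert_subset hl)
            (mem_localList_insert hl) fun A A' hA => step_send_buffered hA hl hlen
    | go f vs => cases hκ.1

end Go

namespace Go

open PiB

/-- Operational completeness of the encoding. -/
theorem GStep.weakStep {δf : FunEnv} {Λ Λ' : Config} {α : GAct}
    (hparams : ∀ f d, δf.lookup f = some d → d.params.Nodup) (hvars : Λ.VarsDeclared)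
    (hnames : NameConvention δf Λ α Λ') (hstep : GStep δf Λ α Λ') :
    ∃ C : Conf Name, WeakStep (encConfig δf Λ) α.enc C ∧
      (C = encConfig δf Λ' ∨
        (α = .tau ∧ VarAccess Λ Λ' ∧ UpToDeadBranch C (encConfig δf Λ'))) := by
  cases hstep with
  | loc h =>
    obtain ⟨C, hC, h | ⟨h₁, h₂⟩⟩ := h.weakStep
      (hvars _ (Multiset.mem_cons_self _ _)) hnames.1
    · exact ⟨C, hC, Or.inl h⟩
    · exact ⟨C, hC, Or.inr ⟨rfl, h₁, h₂⟩⟩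
  | com h₁ h₂ =>
    obtain ⟨g, hl, e₁⟩ := h₁.routine_recv (hvars _ (Multiset.mem_cons_self _ _))
    obtain ⟨_, -, e₂⟩ := h₂.routine_send
      (hvars _ (Multiset.mem_cons_of_mem (Multiset.mem_cons_self _ _)))
    refine ⟨_, (e₁.soup_com e₂ _).weakStep fun Q Q' hQ => ?_, Or.inl rfl⟩
    exact hQ.step_config (fun _ h => h.elim) (fun _ _ h => h.elim) subset_rfl (fun _ => Iff.rfl)
      fun A A' hA => hA.step hl
  | lgo h hf hl =>
    have e := h.routine_go (hvars _ (Multiset.mem_cons_self _ _))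
    exact ⟨_, (e.soup_go hf (hparams _ _ hf) hl _).weakStep fun Q Q' hQ => step_sync hQ _,
      Or.inl rfl⟩
  | @gru Γ s s' σ δ ch v h hl =>
    obtain ⟨g, -, e⟩ := h.routine_recv (hvars _ (Multiset.mem_cons_self _ _))
    refine ⟨_, ((e.soup (Kind.stable_fn (by simp)) (by simp)).after
      (.refl (cl_nus_soup_cons δf (s', σ) Γ))).weakStep fun Q Q' hQ => ?_, Or.inl rfl⟩
    refine hQ.step_config inp_not_internal (inp_notMem_names (notMem_localList hl) ?_) subset_rfl
      (fun _ => Iff.rfl) fun A A' hA => step_recv_unbuffered hA hl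
    -- The environment does not send a local channel, so the label avoids the restricted names.
    rintro c hc rfl
    exact hnames.2 ch _ rfl (mem_localList.1 hc)
  | @grb Γ δ ch n l v hl hn hlen =>
    obtain ⟨n, rfl⟩ := Nat.exists_eq_succ_of_ne_zero hn.ne'
    -- The environment fills the buffer by itself and no routine moves, so a single transition
    -- suffices.
    refine ⟨_, WeakStep.of_step (step_config ?_ (inp_notMem_names (notMem_localList hl) ?_)
      (mem_localList_insert hl)), Or.inl rfl⟩
    · rw [store_insert, List.map_append, List.map_cons, List.map_nil,
        entry_of_notMem (v := v) (by simp)]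
      exact .ibg (store_chan [] hl) (by simpa using hlen) (chan_notMem_localNames δf Γ ch)
    · rintro c hc rfl
      exact hnames.2 ch _ rfl (mem_localList.1 hc)
  | @gsu1 Γ s s' σ δ ch v h hl hv =>
    obtain ⟨g, -, e⟩ := h.routine_send (hvars _ (Multiset.mem_cons_self _ _))
    refine ⟨_, ((e.soup (Kind.stable_fn (by simp)) (by simp)).after
      (.refl (cl_nus_soup_cons δf (s', σ) Γ))).weakStep fun Q Q' hQ => ?_, Or.inl rfl⟩
    exact hQ.step_config out_not_internal (out_notMem_names (notMem_localList hl)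
      (ne_chan_of_not_inDom hv)) subset_rfl (fun _ => Iff.rfl)
      fun A A' hA => step_send_unbuffered hA hl
  | @gsu2 Γ s s' σ δ ch ch' n' l' g' h hl hl' =>
    obtain ⟨g, -, e⟩ := h.routine_send (hvars _ (Multiset.mem_cons_self _ _))
    refine ⟨_, ((e.soup (Kind.stable_fn (by simp)) (by simp)).after
      (.refl (cl_nus_soup_cons δf (s', σ) Γ))).weakStep fun Q Q' hQ => ?_, Or.inl rfl⟩
    -- A channel that is global already is sent as a plain name and the store is unchanged; a local
    -- one is extruded.
    cases g' with
    | true =>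
      rw [insert_lookup hl']
      refine hQ.step_config (out_not_internal (v := .chan ch'))
        (out_notMem_names (v := .chan ch') (notMem_localList hl) ?_) subset_rfl
        (fun _ => Iff.rfl) fun A A' hA => step_send_unbuffered hA hl
      rintro c hc e
      cases e
      exact notMem_localList hl' hc
    | false =>
      exact step_open (hQ.step (cs := []) (good_store δ []) (good_store δ [])
        (fun _ => notMem_ln_store _ (by simp)) (out_not_internal (v := .chan ch'))
        (fun b hb hb' => absurd hb hb') (by simp) fun A A' hA => step_send_unbuffered hA hl)
        hl' (notMem_localList hl) mem_localList_globalize fun H => store_insert_flag H hl' true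
  | @gsb1 Γ δ ch n v l hl hn hv =>
    obtain ⟨n, rfl⟩ := Nat.exists_eq_succ_of_ne_zero hn.ne'
    refine ⟨_, WeakStep.of_step (step_config ?_ (out_notMem_names (notMem_localList hl)
      (ne_chan_of_not_inDom hv)) (mem_localList_insert hl)), Or.inl rfl⟩
    rw [store_insert]
    refine .obg ?_ (chan_notMem_localNames δf Γ ch)
    rw [store_chan [] hl, List.map_cons, entry_of_notMem (v := v) (by simp)]
  | @gsb2 Γ δ ch n ch' l n' l' g' hl hn hl' =>
    obtain ⟨n, rfl⟩ := Nat.exists_eq_succ_of_ne_zero hn.ne'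
    have hs : Step (.nus (fns δf) (soup δf Γ)) (store δ [])
        (.out (.chan ch) [.free (.chan ch')]) (.nus (fns δf) (soup δf Γ))
        (store (δ.insert ch (n + 1, l, true)) []) := by
      rw [store_insert]
      refine .obg ?_ (chan_notMem_localNames δf Γ ch)
      rw [store_chan [] hl, List.map_cons, entry_of_notMem (by simp)]
      rfl
    refine ⟨_, WeakStep.of_step ?_, Or.inl rfl⟩
    cases g' with
    | true =>
      rw [insert_lookup hl']
      refine step_config hs (out_notMem_names (v := .chan ch') (notMem_localList hl) ?_)
        (mem_localList_insert hl)
      rintro c hc e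
      cases e
      exact notMem_localList hl' hc
    | false =>
      refine step_open hs hl' (notMem_localList hl) (fun c => ?_) fun H => ?_
      -- `ch` is global and `ch'` is local, so the two updates concern different channels.
      · have hne : ch ≠ ch' := by
          rintro rfl
          rw [hl] at hl'
          simp at hl'
        rw [mem_localList_insert (g := true) (n := n + 1) (l := .chan ch' :: l)
          (by rw [Finmap.lookup_insert_of_ne _ hne, hl]), mem_localList_globalize]
      · rw [store_insert, store_insert, store_insert_flag H hl' true]

end Go

theorem mainTheorem5 (δf : Go.FunEnv) (Λ Λ' : Go.Config) (α : Go.GAct)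
    (hparams : ∀ f d, δf.lookup f = some d → d.params.Nodup)
    (hvars : Λ.VarsDeclared)
    (hnames : Go.NameConvention δf Λ α Λ')
    (hstep : Go.GStep δf Λ α Λ') :
    ∃ C : PiB.Conf Go.Name,
      PiB.WeakStep (Go.encConfig δf Λ) α.enc C ∧
      (C = Go.encConfig δf Λ' ∨
        (α = .tau ∧ Go.VarAccess Λ Λ' ∧
          Go.UpToDeadBranch C (Go.encConfig δf Λ'))) := by
  exact hstep.weakStep hparams hvars hnames
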